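/- Let $d\ge 1$, let $\Omega\subset\mathbb R^d$ be a polygonal/polyhedral domain (open, connected, with a finite simplicial mesh), let $\hat K$ be a fixed reference simplex with $|\hat K|=1$, and let $\mathcal L u=-\operatorname{div}(a\nabla u)+b\cdot\nabla u+cu$ be an elliptic operator on $\Omega$: $a,b,c$ are bounded and measurable, $a$ is uniformly positive definite, and the bilinear form $B(w,v)=\int_\Omega (a\nabla w\cdot\nabla v+(b\cdot\nabla w)v+cwv)\,dx$ is coercive on $H^1_0(\Omega)$. Then there is a constant $C>0$, depending only on $d$, $\Omega$, $\mathcal L$ and $\hat K$, such that the following holds. Let $f\in L^2(\Omega)$ and let $u\in H^2(\Omega)\cap C(\overline\Omega)$, with Hessian $H$, be a weak solution of $\mathcal Lu=f$ in $\Omega$, $u=g$ on $\partial\Omega$. Let $\mathcal T_h$ be a conforming simplicial mesh of $\Omega$ with $N$ elements, with affine maps $F_K$ from $\hat K$ onto $K\in\mathcal T_h$, and let $u_h$ be the linear finite element solution: $u_h$ is continuous and piecewise affine, $u_h=g$ at the boundary vertices, and $B(u_h,v)=\int_\Omega fv\,dx$ for all continuous piecewise affine $v$ vanishing on $\partial\Omega$.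 Let $R$ be a symmetric matrix field (the recovered Hessian), let $R_K$ be an average of $R$ over $K$ (its mean with respect to some probability measure on $K$), and let $\alpha_h>0$. Write $|A|=\sqrt{A^2}$ for symmetric $A$ and $\|\cdot\|_2$ for the spectral norm. Assume that for all $K\in\mathcal T_h$ and almost all $x\in K$ $$C_{R-,K}\,I\le(\alpha_hI+|R_K|)^{-1}(\alpha_hI+|H(x)|),\qquad(\alpha_hI+|R_K|)^{-1}|H(x)|\le C_{R+,K}\,I,$$ where the inequalities mean that all eigenvalues of the matrix product are $\ge C_{R-,K}$, respectively $\le C_{R+,K}$, and that for constants $C_{R-},C_{R+}>0$ $$C_{R-}\le\min_{K\in\mathcal T_h}C_{R-,K},\qquad\sqrt{\frac1N\sum_{K\in\mathcal T_h}C_{R+,K}^2}\le C_{R+}.$$ Let $$M_K=\det(\alpha_hI+|R_K|)^{-\frac1{d+2}}\,\|\alpha_hI+|R_K|\|_2^{\frac2{d+2}}\,(\alpha_hI+|R_K|)$$ and assume that the mesh is quasi-$M$-uniform with constants $C_{eq},C_{ali}\ge1$: for all $K\in\mathcal T_h$ $$|K|\det(M_K)^{\frac12}\le C_{eq}\frac1N\sum_{\tilde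 K\in\mathcal T_h}|\tilde K|\det(M_{\tilde K})^{\frac12},\qquad\frac1d\operatorname{tr}\bigl((F_K')^TM_KF_K'\bigr)\le C_{ali}|K|^{\frac2d}\det(M_K)^{\frac1d}.$$ Then $$|u-u_h|_{H^1(\Omega)}\le C\cdot C_{ali}^{\frac{d+1}2}C_{eq}^{\frac{d+2}{2d}}\cdot\frac{C_{R+}}{C_{R-}}\cdot N^{-\frac1d}\,\Bigl\|\det(\alpha_hI+|H|)^{\frac1d}(\alpha_hI+|H|)\Bigr\|_{L^{\frac d{d+2}}(\Omega)}^{\frac12},$$ where the $L^{d/(d+2)}$ quasi-norm is that of the spectral norm of the matrix function. -/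

import Mathlib

open MeasureTheory
open scoped ContDiff

namespace AnisoFEM

noncomputable section

/-- `ℝ^d` with the Euclidean norm. -/
abbrev Space (d : ℕ) : Type := EuclideanSpace ℝ (Fin d)

/-- Real `d × d` matrices. -/
abbrev Mat (d : ℕ) : Type := Matrix (Fin d) (Fin d) ℝ

/-! ### Matrices -/

open scoped MatrixOrder in
/-- `|A| = √(A²)` for a symmetric matrix `A` (positive semidefinite square root). -/
def matAbs {d : ℕ} (A : Mat d) : Mat d := CFC.sqrt (A * A)

/-- The regularised matrix `α I + |A|`. -/
def regAbs {d : ℕ} (α : ℝ) (A : Mat d) : Mat d := α • (1 : Mat d) + matAbs A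

/-- The spectral norm `‖A‖₂`, the operator norm induced by the Euclidean norm. -/
def norm2 {d : ℕ} (A : Mat d) : ℝ := ‖Matrix.toEuclideanCLM (n := Fin d) (𝕜 := ℝ) A‖

/-- `c I ≤ S`: all eigenvalues of `S` are at least `c`. It is used for products `S = A⁻¹ B` with `A`
symmetric positive definite and `B` symmetric, which are similar to symmetric matrices. -/
def ScalarLE {d : ℕ} (c : ℝ) (S : Mat d) : Prop := ∀ μ ∈ spectrum ℝ S, c ≤ μ

/-- `S ≤ c I`: all eigenvalues of `S` are at most `c`. -/
def LEScalar {d : ℕ} (S : Mat d) (c : ℝ) : Prop := ∀ μ ∈ spectrum ℝ S, μ ≤ c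

/-- The metric tensor
`M = det(α I + |R|)^{-1/(d+2)} ‖α I + |R|‖₂^{2/(d+2)} (α I + |R|)`. -/
def metric {d : ℕ} (α : ℝ) (R : Mat d) : Mat d :=
  ((regAbs α R).det ^ (-(1 / ((d : ℝ) + 2))) * norm2 (regAbs α R) ^ (2 / ((d : ℝ) + 2))) •
    regAbs α R

/-! ### Weak derivatives and `H²` -/

/-- Test functions `φ ∈ C_c^∞(Ω)`. -/
def IsTestFunction {d : ℕ} (Ω : Set (Space d)) (φ : Space d → ℝ) : Prop :=
  ContDiff ℝ ∞ φ ∧ HasCompactSupport φ ∧ tsupport φ ⊆ Ω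

/-- `w'` is the weak partial derivative `∂w/∂xᵢ` in `Ω`. -/
def HasWeakPartial {d : ℕ} (Ω : Set (Space d)) (i : Fin d) (w w' : Space d → ℝ) : Prop :=
  ∀ φ, IsTestFunction Ω φ →
    ∫ x in Ω, w x * gradient φ x i = -∫ x in Ω, w' x * φ x

/-- `u ∈ H²(Ω)`, with weak gradient `Du` and weak Hessian `H`. -/
structure IsH2 {d : ℕ} (Ω : Set (Space d)) (u : Space d → ℝ) (Du : Space d → Space d)
    (H : Space d → Mat d) : Prop where
  memLp : MemLp u 2 (volume.restrict Ω)
  memLp_grad : ∀ i, MemLp (fun x => Du x i) 2 (volume.restrict Ω)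
  memLp_hess : ∀ i j, MemLp (fun x => H x i j) 2 (volume.restrict Ω)
  grad : ∀ i, HasWeakPartial Ω i u (fun x => Du x i)
  hess : ∀ i j, HasWeakPartial Ω j (fun x => Du x i) (fun x => H x i j)

/-! ### The boundary value problem -/

/-- Coefficients of `𝓛 u = -div (a ∇u) + b · ∇u + c u`. -/
structure Coeffs (d : ℕ) where
  a : Space d → Mat d
  b : Space d → Space d
  c : Space d → ℝ

/-- The bilinear form `∫_Ω (a ∇w · ∇v + (b · ∇w) v + c w v)` of `𝓛`; the gradients of `w` and `v`
are passed explicitly as `Dw` and `Dv`. -/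
def Coeffs.form {d : ℕ} (L : Coeffs d) (Ω : Set (Space d))
    (w : Space d → ℝ) (Dw : Space d → Space d) (v : Space d → ℝ) (Dv : Space d → Space d) : ℝ :=
  ∫ x in Ω, (inner ℝ (Matrix.toEuclideanLin (L.a x) (Dw x)) (Dv x)
    + inner ℝ (L.b x) (Dw x) * v x + L.c x * w x * v x)

/-- `𝓛` is an elliptic operator on `Ω`: bounded measurable coefficients, uniformly positive
definite principal part, and a bilinear form that is coercive on `H¹₀(Ω)`
(equivalently, by density, on `C_c^∞(Ω)`). -/
structure Coeffs.IsElliptic {d : ℕ} (L : Coeffs d) (Ω : Set (Space d)) : Prop where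
  bdd_a : ∀ i j, MemLp (fun x => L.a x i j) ⊤ (volume.restrict Ω)
  bdd_b : ∀ i, MemLp (fun x => L.b x i) ⊤ (volume.restrict Ω)
  bdd_c : MemLp L.c ⊤ (volume.restrict Ω)
  elliptic : ∃ lam > 0, ∀ᵐ x ∂(volume.restrict Ω), ∀ ξ : Space d,
    lam * ‖ξ‖ ^ 2 ≤ inner ℝ (Matrix.toEuclideanLin (L.a x) ξ) ξ
  coercive : ∃ β > 0, ∀ φ, IsTestFunction Ω φ →
    β * ∫ x in Ω, ‖gradient φ x‖ ^ 2 ≤ L.form Ω φ (gradient φ) φ (gradient φ)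

/-- `u`, with weak gradient `Du`, is a (weak) solution of `𝓛 u = f` in `Ω`, `u = g` on `∂Ω`.
Here `u` is continuous up to the boundary, so that its boundary and nodal values make sense. -/
structure IsSolution {d : ℕ} (L : Coeffs d) (Ω : Set (Space d)) (f g u : Space d → ℝ)
    (Du : Space d → Space d) : Prop where
  continuousOn : ContinuousOn u (closure Ω)
  eq : ∀ φ, IsTestFunction Ω φ → L.form Ω u Du φ (gradient φ) = ∫ x in Ω, f x * φ x
  boundary : ∀ x ∈ frontier Ω, u x = g x

/-! ### Simplicial meshes and linear finite elements -/

/-- A (conforming) simplicial mesh of `Ω`: a finite simplicial complex, all of whose maximal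
simplices are `d`-dimensional, that triangulates `closure Ω` and whose faces resolve `∂Ω`. -/
structure Mesh {d : ℕ} (Ω : Set (Space d)) extends
    Geometry.SimplicialComplex ℝ (Space d) where
  finite : faces.Finite
  pure : ∀ s ∈ faces, ∃ t ∈ faces, s ⊆ t ∧ t.card = d + 1
  space_eq : toSimplicialComplex.space = closure Ω
  boundary : ∀ x ∈ frontier Ω, ∃ s ∈ faces,
    x ∈ convexHull ℝ (s : Set (Space d)) ∧ convexHull ℝ (s : Set (Space d)) ⊆ frontier Ω

/-- A polygonal / polyhedral domain: open, connected, and admitting a simplicial mesh. -/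
structure IsPolyhedralDomain {d : ℕ} (Ω : Set (Space d)) : Prop where
  isOpen : IsOpen Ω
  isConnected : IsConnected Ω
  nonempty_mesh : Nonempty (Mesh Ω)

/-- The simplex spanned by a finite set of vertices. -/
def simplex {d : ℕ} (K : Finset (Space d)) : Set (Space d) := convexHull ℝ (K : Set (Space d))

/-- The volume `|K|`. -/
def vol {d : ℕ} (K : Finset (Space d)) : ℝ := volume.real (simplex K)

/-- The mesh elements, given by their vertex sets. -/
def Mesh.elements {d : ℕ} {Ω : Set (Space d)} (T : Mesh Ω) : Finset (Finset (Space d)) :=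
  {K ∈ T.finite.toFinset | K.card = d + 1}

/-- The number `N` of mesh elements. -/
def Mesh.N {d : ℕ} {Ω : Set (Space d)} (T : Mesh Ω) : ℕ := T.elements.card

/-- The linear finite element space: continuous, affine on every element. -/
def Mesh.IsFEFunction {d : ℕ} {Ω : Set (Space d)} (T : Mesh Ω) (v : Space d → ℝ) : Prop :=
  ContinuousOn v (closure Ω) ∧
    ∀ K ∈ T.elements, ∃ ℓ : Space d →ᵃ[ℝ] ℝ, Set.EqOn v ℓ (simplex K)

/-- `uh` is the linear finite element solution: it takes the boundary data at the boundary
vertices and satisfies the Galerkin equations for all finite element functions that vanish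
on `∂Ω`. Gradients of finite element functions are the elementwise ones. -/
structure IsFESolution {d : ℕ} {Ω : Set (Space d)} (L : Coeffs d) (T : Mesh Ω)
    (f g uh : Space d → ℝ) : Prop where
  mem : T.IsFEFunction uh
  boundary : ∀ p, p ∈ T.vertices → p ∈ frontier Ω → uh p = g p
  galerkin : ∀ v, T.IsFEFunction v → (∀ x ∈ frontier Ω, v x = 0) →
    L.form Ω uh (gradient uh) v (gradient v) = ∫ x in Ω, f x * v x

/-- The vertex set of a reference element: a nondegenerate simplex of unit volume. -/
def IsReferenceElement {d : ℕ} (V : Finset (Space d)) : Prop :=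
  V.card = d + 1 ∧ AffineIndependent ℝ ((↑) : V → Space d) ∧ vol V = 1

/-- The Jacobian matrix `F'` of an affine map `F`. -/
def jacobian {d : ℕ} (F : Space d →ᵃ[ℝ] Space d) : Mat d := Matrix.toEuclideanLin.symm F.linear

/-- The mesh is quasi-`M`-uniform for the metric tensor `M_K`: equidistribution with constant
`Ceq` and alignment with constant `Cali`, where `F_K` maps the reference element onto `K`. -/
structure IsQuasiMUniform {d : ℕ} {Ω : Set (Space d)} (T : Mesh Ω)
    (F : Finset (Space d) → Space d →ᵃ[ℝ] Space d) (M : Finset (Space d) → Mat d)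
    (Ceq Cali : ℝ) : Prop where
  equidistribution : ∀ K ∈ T.elements,
    vol K * (M K).det ^ (1 / 2 : ℝ) ≤
      Ceq * ((1 / (T.N : ℝ)) * ∑ K' ∈ T.elements, vol K' * (M K').det ^ (1 / 2 : ℝ))
  alignment : ∀ K ∈ T.elements,
    (1 / (d : ℝ)) * ((jacobian (F K)).transpose * M K * jacobian (F K)).trace ≤
      Cali * vol K ^ (2 / (d : ℝ)) * (M K).det ^ (1 / (d : ℝ))

/-- `A` is an average of the matrix field `R` over `S`, i.e. its mean with respect to some
probability measure on `S` (normalised Lebesgue measure, nodal averages, quadrature rules, ...). -/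
def IsAverageOver {d : ℕ} (S : Set (Space d)) (R : Space d → Mat d) (A : Mat d) : Prop :=
  ∃ μ : Measure (Space d), IsProbabilityMeasure μ ∧ μ Sᶜ = 0 ∧
    ∀ i j, Integrable (fun x => R x i j) μ ∧ A i j = ∫ x, R x i j ∂μ

/-! ### The quantities in the error bound -/

/-- The `H¹(Ω)` semi-norm of a function whose gradient is `G`. -/
def gradSeminorm {d : ℕ} (Ω : Set (Space d)) (G : Space d → Space d) : ℝ :=
  Real.sqrt (∫ x in Ω, ‖G x‖ ^ 2)

/-- `‖det(α I + |H|)^{1/d} (α I + |H|)‖_{L^{d/(d+2)}(Ω)}`, with the spectral norm of matrices. -/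
def hessianFactor {d : ℕ} (Ω : Set (Space d)) (α : ℝ) (H : Space d → Mat d) : ℝ :=
  (eLpNorm (fun x => norm2 ((regAbs α (H x)).det ^ (1 / (d : ℝ)) • regAbs α (H x)))
    (ENNReal.ofReal ((d : ℝ) / ((d : ℝ) + 2))) (volume.restrict Ω)).toReal

end

end AnisoFEM

open AnisoFEM

namespace AnisoFEM

noncomputable section

open Matrix
open scoped MatrixOrder

/-! ### Matrix inequalities: Loewner order, determinant, spectral norm and trace -/

section MatrixLemmas

variable {d : ℕ}

/-! Write A = αI + |R_K| and c = C_{R+,K} on an element K, and let v be the nodal interpolant of u.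
Three estimates are chained: quasi-optimality, an anisotropic interpolation bound on each element,
and a comparison of a mesh sum with the integral of the Hessian.

Quasi-optimality (`exists_cea_constant`). The function w = u_h - v is piecewise affine and vanishes
on ∂Ω, and B(w,w) = B(u-v,w) because u and u_h satisfy the same equation when tested with w.
Coercivity, Poincaré's inequality and Young's inequality then bound the squared H¹ seminorm of u-u_h
by a constant times the squared full H¹ norm of u-v. The weak equation and coercivity are given only
for smooth compactly supported functions; they reach w by soft thresholding, mollification and
bounded convergence.

Interpolation (`ae_interpolation_error_le`). The closeness condition says that |H| ≤ cA in the
Loewner order almost everywhere on K. This is an L^∞ bound, so mollification yields a Taylor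
inequality with quadratic form |c|A, valid at almost every x in K and simultaneously for all y in K
(`ae_abs_taylor_le`). The interpolant minus the first order Taylor polynomial at x is affine, hence
controlled on K by its values at the vertices, and its gradient by its oscillation over the image of
a ball in the reference simplex. Everything is expressed through S = F'ᵀAF', with det S = |K|² det A
= τ^d and, by alignment, tr S ≤ d C_ali τ, where τ = |K|^{2/d} det(A)^{1/d}. The eigenvalues of S
lie between det S / (tr S)^{d-1} and tr S, so both squared errors are at most a constant times c²
C_ali^{d+1} ‖A‖₂ τ pointwise, with no shape regularity.

Summation. The metric is chosen so that |K| ‖A‖₂ τ = (|K| det(M_K)^{1/2})^{(d+2)/d}.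
Equidistribution replaces the bracket by C_eq σ/N, where σ is the sum of |K| det(M_K)^{1/2}; what
remains is the sum of C_{R+,K}², at most N C_{R+}². Finally det(M_K)^{1/2} = (det(A)^{1/d}
‖A‖₂)^{d/(d+2)}, and αI + |H| ≥ C_{R-} A makes σ^{(d+2)/d} at most C_{R-}^{-2} times the Hessian
quasi-norm (`rpow_sum_le_hessianFactor`). -/

theorem matAbs_posSemidef (A : Mat d) : (matAbs A).PosSemidef :=
  Matrix.nonneg_iff_posSemidef.1 (CFC.sqrt_nonneg _)

theorem regAbs_posDef {α : ℝ} (hα : 0 < α) (A : Mat d) : (regAbs α A).PosDef :=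
  Matrix.PosDef.add_posSemidef (Matrix.PosDef.one.smul hα) (matAbs_posSemidef A)

theorem matAbs_eq_cfcAbs {H : Mat d} (hH : H.IsHermitian) : matAbs H = CFC.abs H := by
  rw [matAbs, CFC.abs, Matrix.star_eq_conjTranspose, hH.eq]

/-- The difference is twice the negative part of H. Together with its counterpart for the positive
part it gives |ξᵀHξ| ≤ ξᵀ|H|ξ. -/
theorem matAbs_sub_self_posSemidef {H : Mat d} (hH : H.IsHermitian) :
    (matAbs H - H).PosSemidef := by
  rw [matAbs_eq_cfcAbs hH, CFC.abs_sub_self H hH]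
  exact Matrix.nonneg_iff_posSemidef.1 (smul_nonneg (by norm_num) (CFC.negPart_nonneg H))

theorem matAbs_add_self_posSemidef {H : Mat d} (hH : H.IsHermitian) :
    (matAbs H + H).PosSemidef := by
  rw [matAbs_eq_cfcAbs hH, CFC.abs_add_self H hH]
  exact Matrix.nonneg_iff_posSemidef.1 (smul_nonneg (by norm_num) (CFC.posPart_nonneg H))

theorem exists_hermitian_sqrt {A : Mat d} (hA : A.PosDef) :
    ∃ P : Mat d, P.IsHermitian ∧ IsUnit P.det ∧ A = P * P := by
  refine ⟨CFC.sqrt A, (Matrix.nonneg_iff_posSemidef.1 (CFC.sqrt_nonneg A)).isHermitian, ?_,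
    (CFC.sqrt_mul_sqrt_self A hA.posSemidef.nonneg).symm⟩
  have h : IsUnit (CFC.sqrt A * CFC.sqrt A).det := by
    rw [CFC.sqrt_mul_sqrt_self A hA.posSemidef.nonneg]
    exact hA.det_pos.ne'.isUnit
  rw [Matrix.det_mul] at h
  exact isUnit_of_mul_isUnit_left h

/-- With A = P², the product A⁻¹B is similar to the symmetric matrix P⁻¹BP⁻¹, so the eigenvalue
bound becomes P⁻¹BP⁻¹ - cI ≥ 0; congruence with P gives B - cA ≥ 0. This turns the closeness
conditions into Loewner inequalities. -/
theorem posSemidef_sub_smul_of_scalarLE {A B : Mat d} {c : ℝ} (hA : A.PosDef)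
    (hB : B.IsHermitian) (h : ScalarLE c (A⁻¹ * B)) : (B - c • A).PosSemidef := by
  obtain ⟨P, hP, hPu, rfl⟩ := exists_hermitian_sqrt hA
  have h1 : P * P⁻¹ = 1 := Matrix.mul_nonsing_inv P hPu
  have h2 : P⁻¹ * P = 1 := Matrix.nonsing_inv_mul P hPu
  have hPi : (P⁻¹).IsHermitian := hP.inv
  set Y : Mat d := P⁻¹ * B * P⁻¹ - c • 1 with hY
  have hYh : Y.IsHermitian := by
    refine Matrix.IsHermitian.sub ?_ (by
      simp [Matrix.IsHermitian])
    rw [Matrix.IsHermitian, Matrix.conjTranspose_mul, Matrix.conjTranspose_mul, hPi.eq, hB.eq,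
      Matrix.mul_assoc]
  have hYp : Y.PosSemidef := by
    rw [Matrix.posSemidef_iff_isHermitian_and_spectrum_nonneg]
    refine ⟨hYh, fun μ hμ => ?_⟩
    have : μ + c ∈ spectrum ℝ ((P * P)⁻¹ * B) := by
      rw [spectrum.mem_iff] at hμ ⊢
      intro hu
      apply hμ
      have hPU : IsUnit P := (Matrix.isUnit_iff_isUnit_det P).2 hPu
      have hPIU : IsUnit P⁻¹ := by
        rw [Matrix.isUnit_nonsing_inv_iff]; exact hPU
      have := (hPU.mul hu).mul hPIU
      convert this using 1
      rw [hY, Matrix.mul_inv_rev, Matrix.mul_sub, Matrix.sub_mul, Algebra.algebraMap_eq_smul_one,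
        Algebra.algebraMap_eq_smul_one, Matrix.mul_smul, Matrix.smul_mul, Matrix.mul_one, h1,
        Matrix.mul_assoc P⁻¹ P⁻¹ B, ← Matrix.mul_assoc P P⁻¹ _, h1, Matrix.one_mul, add_smul]
      abel
    have := h _ this
    show (0 : ℝ) ≤ μ
    linarith
  have := hYp.mul_mul_conjTranspose_same P
  convert this using 1
  rw [hY, hP.eq, Matrix.mul_sub, Matrix.sub_mul, Matrix.mul_smul, Matrix.mul_one, Matrix.smul_mul]
  congr 1
  rw [Matrix.mul_assoc P⁻¹, ← Matrix.mul_assoc P P⁻¹, h1, Matrix.one_mul, Matrix.mul_assoc, h2,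
    Matrix.mul_one]

theorem posSemidef_smul_sub_of_leScalar {A B : Mat d} {c : ℝ} (hA : A.PosDef)
    (hB : B.IsHermitian) (h : LEScalar (A⁻¹ * B) c) : (c • A - B).PosSemidef := by
  have : ScalarLE (-c) (A⁻¹ * (-B)) := by
    intro μ hμ
    rw [Matrix.mul_neg, ← spectrum.neg_eq, Set.mem_neg] at hμ
    linarith [h _ hμ]
  have := posSemidef_sub_smul_of_scalarLE hA hB.neg this
  convert this using 1
  rw [neg_smul]; abel

theorem posSemidef_sub_smul_one {S : Mat d} {c : ℝ} (hS : S.IsHermitian)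
    (h : ∀ i, c ≤ hS.eigenvalues i) : (S - c • (1 : Mat d)).PosSemidef := by
  refine posSemidef_sub_smul_of_scalarLE Matrix.PosDef.one hS fun μ hμ => ?_
  rw [inv_one, one_mul, hS.spectrum_real_eq_range_eigenvalues] at hμ
  obtain ⟨i, rfl⟩ := hμ
  exact h i

theorem le_eigenvalues {S : Mat d} {c : ℝ} (hS : S.IsHermitian)
    (h : (S - c • (1 : Mat d)).PosSemidef) (i : Fin d) : c ≤ hS.eigenvalues i := by
  have h1 := hS.eigenvalues_mem_spectrum_real i
  have h2 : hS.eigenvalues i - c ∈ spectrum ℝ (S - c • (1 : Mat d)) := by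
    rw [spectrum.mem_iff] at h1 ⊢
    convert h1 using 2
    rw [map_sub, Algebra.algebraMap_eq_smul_one c]
    abel
  have := ((Matrix.posSemidef_iff_isHermitian_and_spectrum_nonneg).1 h).2 h2
  have : (0 : ℝ) ≤ hS.eigenvalues i - c := this
  linarith

/-- With A = P², the matrix P⁻¹BP⁻¹ dominates I, so all its eigenvalues, and hence its determinant,
are at least 1. -/
theorem det_le_det_of_posSemidef_sub {A B : Mat d} (hA : A.PosDef) (h : (B - A).PosSemidef) :
    A.det ≤ B.det := by
  obtain ⟨P, hP, hPu, rfl⟩ := exists_hermitian_sqrt hA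
  have h1 : P * P⁻¹ = 1 := Matrix.mul_nonsing_inv P hPu
  have h2 : P⁻¹ * P = 1 := Matrix.nonsing_inv_mul P hPu
  have hPi : (P⁻¹).IsHermitian := hP.inv
  set Y : Mat d := P⁻¹ * B * P⁻¹ with hY
  have hB : B = P * Y * P := by
    rw [hY, Matrix.mul_assoc P⁻¹, ← Matrix.mul_assoc P P⁻¹, h1, Matrix.one_mul, Matrix.mul_assoc,
      h2, Matrix.mul_one]
  have hYp : (Y - (1 : ℝ) • (1 : Mat d)).PosSemidef := by
    have := h.mul_mul_conjTranspose_same P⁻¹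
    convert this using 1
    rw [hPi.eq, Matrix.mul_sub, Matrix.sub_mul, ← Matrix.mul_assoc P⁻¹ P P, h2, Matrix.one_mul, h1,
      one_smul]
  have hYh : Y.IsHermitian := by
    have := hYp.isHermitian.add (Matrix.isHermitian_one (n := Fin d) (α := ℝ))
    simpa using this
  have hdet : 1 ≤ Y.det := by
    rw [hYh.det_eq_prod_eigenvalues]
    calc (1 : ℝ) = ∏ _i : Fin d, (1 : ℝ) := by simp
      _ ≤ _ := Finset.prod_le_prod (fun _ _ => zero_le_one) fun i _ => le_eigenvalues hYh hYp i
  rw [hB, Matrix.det_mul, Matrix.det_mul, Matrix.det_mul]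
  nlinarith [mul_self_nonneg P.det]

/-- The quadratic form `ξ ↦ ξᵀ A ξ`. -/
def quad (A : Mat d) (ξ : Space d) : ℝ := inner ℝ ξ (Matrix.toEuclideanCLM (𝕜 := ℝ) A ξ)

theorem quad_eq_dotProduct (A : Mat d) (ξ : Space d) :
    quad A ξ = ξ.ofLp ⬝ᵥ A *ᵥ ξ.ofLp := Matrix.inner_toEuclideanCLM A ξ ξ

theorem quad_eq_sum (A : Mat d) (ξ : Space d) :
    quad A ξ = ∑ i, ∑ j, ξ i * ξ j * A i j := by
  rw [quad_eq_dotProduct]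
  simp only [dotProduct, Matrix.mulVec, Finset.mul_sum]
  exact Finset.sum_congr rfl fun i _ => Finset.sum_congr rfl fun j _ => by ring

theorem quad_add (A B : Mat d) (ξ : Space d) : quad (A + B) ξ = quad A ξ + quad B ξ := by
  simp [quad, inner_add_right]

theorem quad_sub (A B : Mat d) (ξ : Space d) : quad (A - B) ξ = quad A ξ - quad B ξ := by
  simp [quad, inner_sub_right]

theorem quad_smul (c : ℝ) (A : Mat d) (ξ : Space d) : quad (c • A) ξ = c * quad A ξ := by
  simp [quad, inner_smul_right]

theorem quad_one (ξ : Space d) : quad (1 : Mat d) ξ = ‖ξ‖ ^ 2 := by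
  simp [quad]

theorem quad_nonneg {A : Mat d} (hA : A.PosSemidef) (ξ : Space d) : 0 ≤ quad A ξ := by
  rw [quad_eq_dotProduct]
  simpa using hA.dotProduct_mulVec_nonneg ξ.ofLp

theorem quad_le_quad {A B : Mat d} (h : (B - A).PosSemidef) (ξ : Space d) :
    quad A ξ ≤ quad B ξ := by
  have := quad_nonneg h ξ
  rw [quad_sub] at this
  linarith

theorem abs_quad_le_quad_matAbs {H : Mat d} (hH : H.IsHermitian) (ξ : Space d) :
    |quad H ξ| ≤ quad (matAbs H) ξ := by
  have h1 := quad_nonneg (matAbs_sub_self_posSemidef hH) ξ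
  have h2 := quad_nonneg (matAbs_add_self_posSemidef hH) ξ
  rw [quad_sub] at h1
  rw [quad_add] at h2
  exact abs_le.2 ⟨by linarith, by linarith⟩

theorem quad_le_norm2 (A : Mat d) (ξ : Space d) : quad A ξ ≤ norm2 A * ‖ξ‖ ^ 2 := by
  refine (real_inner_le_norm _ _).trans ?_
  have := (Matrix.toEuclideanCLM (n := Fin d) (𝕜 := ℝ) A).le_opNorm ξ
  rw [norm2]
  nlinarith [norm_nonneg ξ]

theorem norm2_nonneg (A : Mat d) : 0 ≤ norm2 A := norm_nonneg _

theorem norm2_smul (c : ℝ) (A : Mat d) : norm2 (c • A) = |c| * norm2 A := by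
  simp [norm2, norm_smul]

/-- The operator norm of a symmetric operator is the supremum of the absolute Rayleigh quotients. -/
theorem norm2_le_of_quad_le {A : Mat d} (hA : A.PosSemidef) {m : ℝ} (hm : 0 ≤ m)
    (h : ∀ ξ, quad A ξ ≤ m * ‖ξ‖ ^ 2) : norm2 A ≤ m := by
  have hsym : (Matrix.toEuclideanCLM (n := Fin d) (𝕜 := ℝ) A : Space d →ₗ[ℝ] Space d).IsSymmetric := by
    rw [Matrix.coe_toEuclideanCLM_eq_toEuclideanLin]
    exact Matrix.isSymmetric_toEuclideanLin_iff.2 hA.isHermitian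
  rw [norm2, ContinuousLinearMap.norm_eq_iSup_rayleighQuotient _ hsym]
  refine ciSup_le fun x => ?_
  have hq : (Matrix.toEuclideanCLM (n := Fin d) (𝕜 := ℝ) A).reApplyInnerSelf x = quad A x := by
    rw [ContinuousLinearMap.reApplyInnerSelf_apply, quad, real_inner_comm]; rfl
  rw [ContinuousLinearMap.rayleighQuotient, hq,
    abs_of_nonneg (div_nonneg (quad_nonneg hA x) (by positivity))]
  exact div_le_of_le_mul₀ (by positivity) hm (h x)

theorem norm2_le_norm2 {A B : Mat d} (hA : A.PosSemidef) (h : (B - A).PosSemidef) :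
    norm2 A ≤ norm2 B :=
  norm2_le_of_quad_le hA (norm2_nonneg B) fun ξ => (quad_le_quad h ξ).trans (quad_le_norm2 B ξ)

theorem norm2_pos (hd : 1 ≤ d) {A : Mat d} (hA : A.PosDef) : 0 < norm2 A := by
  refine (norm2_nonneg A).lt_of_ne' fun h => ?_
  have h0 : Matrix.toEuclideanCLM (n := Fin d) (𝕜 := ℝ) A = 0 := norm_eq_zero.1 h
  have h1 : A = 0 := by simpa using h0
  have : Nonempty (Fin d) := ⟨⟨0, hd⟩⟩
  have := hA.det_pos
  rw [h1, Matrix.det_zero] at this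
  exact lt_irrefl _ this

theorem quad_le_trace {S : Mat d} (hS : S.PosSemidef) (ξ : Space d) :
    quad S ξ ≤ S.trace * ‖ξ‖ ^ 2 := by
  have hH := hS.isHermitian
  have h : (S.trace • (1 : Mat d) - S).PosSemidef := by
    refine posSemidef_smul_sub_of_leScalar Matrix.PosDef.one hH fun μ hμ => ?_
    rw [inv_one, one_mul, hH.spectrum_real_eq_range_eigenvalues] at hμ
    obtain ⟨i, rfl⟩ := hμ
    rw [hH.trace_eq_sum_eigenvalues]
    exact Finset.single_le_sum (f := fun i => hH.eigenvalues i)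
      (fun j _ => hS.eigenvalues_nonneg j) (Finset.mem_univ i)
  have := quad_le_quad h ξ
  rwa [quad_smul, quad_one] at this

/-- Each eigenvalue is the determinant divided by the product of the other d - 1, and each of these
is at most the trace; so det S / (tr S)^{d-1} is a lower bound for the spectrum. -/
theorem det_mul_sq_le_trace_pow_mul_quad {S : Mat d} (hS : S.PosDef) (ξ : Space d) :
    S.det * ‖ξ‖ ^ 2 ≤ S.trace ^ (d - 1) * quad S ξ := by
  rcases Nat.eq_zero_or_pos d with rfl | hd
  · have : ξ = 0 := Subsingleton.elim _ _
    simp [this, quad]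
  have : Nonempty (Fin d) := ⟨⟨0, hd⟩⟩
  have hH := hS.isHermitian
  have ht : 0 < S.trace := hS.trace_pos
  have hp : 0 < S.trace ^ (d - 1) := pow_pos ht _
  have h : (S - (S.det / S.trace ^ (d - 1)) • (1 : Mat d)).PosSemidef := by
    refine posSemidef_sub_smul_one hH fun i => ?_
    rw [div_le_iff₀ hp, hH.det_eq_prod_eigenvalues, ← Finset.mul_prod_erase _ _ (Finset.mem_univ i)]
    refine mul_le_mul_of_nonneg_left ?_ (hS.posSemidef.eigenvalues_nonneg i)
    have hc : (Finset.univ.erase i).card = d - 1 := by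
      rw [Finset.card_erase_of_mem (Finset.mem_univ i), Finset.card_univ, Fintype.card_fin]
    rw [← hc, ← Finset.prod_const]
    refine Finset.prod_le_prod (fun j _ => hS.posSemidef.eigenvalues_nonneg j) fun j _ => ?_
    rw [hH.trace_eq_sum_eigenvalues]
    exact Finset.single_le_sum (f := fun i => hH.eigenvalues i)
      (fun j _ => hS.posSemidef.eigenvalues_nonneg j) (Finset.mem_univ j)
  have := quad_le_quad h ξ
  rw [quad_smul, quad_one, div_mul_eq_mul_div, div_le_iff₀ hp] at this
  linarith

end MatrixLemmas

end

end AnisoFEM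

namespace AnisoFEM

noncomputable section

/-! ### Geometry of simplices and meshes, nodal interpolation -/

section MeshGeometry

variable {d : ℕ}

theorem isCompact_simplex (s : Finset (Space d)) : IsCompact (simplex s) :=
  s.finite_toSet.isCompact_convexHull ℝ

theorem isClosed_simplex (s : Finset (Space d)) : IsClosed (simplex s) :=
  (isCompact_simplex s).isClosed

theorem convex_simplex (s : Finset (Space d)) : Convex ℝ (simplex s) := convex_convexHull ℝ _

theorem simplex_mono {s t : Finset (Space d)} (h : s ⊆ t) : simplex s ⊆ simplex t :=
  convexHull_mono (Finset.coe_subset.2 h)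

theorem mem_simplex {s : Finset (Space d)} {p : Space d} (hp : p ∈ s) : p ∈ simplex s :=
  subset_convexHull ℝ _ hp

theorem affineSpan_eq_top_iff_card {s : Finset (Space d)}
    (hs : AffineIndependent ℝ ((↑) : s → Space d)) :
    affineSpan ℝ (s : Set (Space d)) = ⊤ ↔ s.card = d + 1 := by
  have := hs.affineSpan_eq_top_iff_card_eq_finrank_add_one
  simpa using this

theorem interior_simplex_nonempty_iff {s : Finset (Space d)}
    (hs : AffineIndependent ℝ ((↑) : s → Space d)) :
    (interior (simplex s)).Nonempty ↔ s.card = d + 1 := by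
  rw [simplex, interior_convexHull_nonempty_iff_affineSpan_eq_top, affineSpan_eq_top_iff_card hs]

theorem vol_pos {s : Finset (Space d)} (hs : AffineIndependent ℝ ((↑) : s → Space d))
    (hc : s.card = d + 1) : 0 < vol s := by
  have h := (interior_simplex_nonempty_iff hs).2 hc
  refine ENNReal.toReal_pos ?_ (isCompact_simplex s).measure_lt_top.ne
  exact ((isOpen_interior.measure_pos volume h).trans_le (measure_mono interior_subset)).ne'

/-- The preimage of [-m, m] under an affine map is convex and contains the vertices. -/
theorem abs_affine_le_of_mem_simplex {s : Finset (Space d)} (ℓ : Space d →ᵃ[ℝ] ℝ) {m : ℝ}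
    (h : ∀ p ∈ s, |ℓ p| ≤ m) {x : Space d} (hx : x ∈ simplex s) : |ℓ x| ≤ m := by
  have hc : Convex ℝ (ℓ ⁻¹' Set.Icc (-m) m) := (convex_Icc (-m) m).affine_preimage ℓ
  have hsub : simplex s ⊆ ℓ ⁻¹' Set.Icc (-m) m :=
    convexHull_min (fun p hp => abs_le.1 (h p hp)) hc
  exact abs_le.2 (hsub hx)

theorem affine_eq_of_mem_simplex {s : Finset (Space d)} (ℓ ℓ' : Space d →ᵃ[ℝ] ℝ)
    (h : ∀ p ∈ s, ℓ p = ℓ' p) {x : Space d} (hx : x ∈ simplex s) : ℓ x = ℓ' x := by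
  have := abs_affine_le_of_mem_simplex (ℓ - ℓ') (m := 0) (s := s)
    (fun p hp => by simp [h p hp]) hx
  simpa [sub_eq_zero] using this

theorem exists_affine_interpolant {s : Finset (Space d)}
    (hs : AffineIndependent ℝ ((↑) : s → Space d)) (hc : s.card = d + 1) (u : Space d → ℝ) :
    ∃ ℓ : Space d →ᵃ[ℝ] ℝ, ∀ p ∈ s, ℓ p = u p := by
  have htop := (affineSpan_eq_top_iff_card hs).2 hc
  let b : AffineBasis s ℝ (Space d) := ⟨(↑), hs, by simpa using htop⟩
  refine ⟨∑ i : s, u i • b.coord i, fun p hp => ?_⟩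
  have h1 : ∀ t : Finset s, (∑ i ∈ t, u i • b.coord i : Space d →ᵃ[ℝ] ℝ) p
      = ∑ i ∈ t, u i * b.coord i p := by
    intro t
    induction t using Finset.induction_on with
    | empty => simp
    | insert a t ha ih => rw [Finset.sum_insert ha, Finset.sum_insert ha]; simp [ih]
  have h2 : ∀ i : s, b.coord i p = if i = ⟨p, hp⟩ then 1 else 0 := fun i =>
    b.coord_apply i ⟨p, hp⟩
  rw [h1]
  simp [h2]

variable {Ω : Set (Space d)} (T : Mesh Ω)

theorem Mesh.mem_elements {K : Finset (Space d)} :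
    K ∈ T.elements ↔ K ∈ T.faces ∧ K.card = d + 1 := by
  simp [Mesh.elements]

theorem Mesh.closure_eq : closure Ω = ⋃ K ∈ T.elements, simplex K := by
  rw [← T.space_eq]
  apply Set.Subset.antisymm
  · intro x hx
    obtain ⟨s, hs, hxs⟩ := Geometry.SimplicialComplex.mem_space_iff.1 hx
    obtain ⟨t, ht, hst, hc⟩ := T.pure s hs
    exact Set.mem_biUnion (T.mem_elements.2 ⟨ht, hc⟩) (simplex_mono hst hxs)
  · refine Set.iUnion₂_subset fun K hK => ?_
    exact Geometry.SimplicialComplex.convexHull_subset_space (T.mem_elements.1 hK).1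

theorem Mesh.exists_mem_simplex {x : Space d} (hx : x ∈ closure Ω) :
    ∃ K ∈ T.elements, x ∈ simplex K := by
  rw [T.closure_eq] at hx
  simpa using hx

variable {T}

theorem Mesh.simplex_subset {K : Finset (Space d)} (hK : K ∈ T.elements) :
    simplex K ⊆ closure Ω := by
  rw [T.closure_eq]
  exact Set.subset_biUnion_of_mem (u := fun K => simplex K) hK

theorem Mesh.indep_of_mem {K : Finset (Space d)} (hK : K ∈ T.elements) :
    AffineIndependent ℝ ((↑) : K → Space d) := T.indep (T.mem_elements.1 hK).1

theorem Mesh.vol_pos {K : Finset (Space d)} (hK : K ∈ T.elements) : 0 < vol K :=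
  AnisoFEM.vol_pos (Mesh.indep_of_mem hK) (T.mem_elements.1 hK).2

theorem Mesh.mem_vertices_of_mem {K : Finset (Space d)} (hK : K ∈ T.elements) {p : Space d}
    (hp : p ∈ K) : p ∈ T.vertices :=
  T.down_closed (T.mem_elements.1 hK).1 (Finset.singleton_subset_iff.2 hp)
    (Finset.singleton_nonempty p)

theorem Mesh.isCompact_closure (T : Mesh Ω) : IsCompact (closure Ω) := by
  rw [T.closure_eq]
  exact T.elements.isCompact_biUnion fun K _ => isCompact_simplex K

theorem Mesh.isBounded (T : Mesh Ω) : Bornology.IsBounded Ω :=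
  T.isCompact_closure.isBounded.subset subset_closure

theorem Mesh.volume_lt_top (T : Mesh Ω) : volume Ω < ⊤ :=
  (measure_mono subset_closure).trans_lt T.isCompact_closure.measure_lt_top

/-- Two faces whose hulls share a point interior to an element: the face contains the element. -/
theorem Mesh.subset_of_mem_interior {K s : Finset (Space d)} (hK : K ∈ T.elements)
    (hs : s ∈ T.faces) {x : Space d} (hx : x ∈ interior (simplex K)) (hxs : x ∈ simplex s) :
    K ⊆ s := by
  classical
  by_contra hne
  obtain ⟨p, hpK, hps⟩ := Finset.not_subset.1 hne
  have hxi : x ∈ simplex (K ∩ s) := by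
    have := T.inter_subset_convexHull (T.mem_elements.1 hK).1 hs ⟨interior_subset hx, hxs⟩
    rw [← Finset.coe_inter] at this
    exact this
  have hind := Mesh.indep_of_mem hK
  have htop := (affineSpan_eq_top_iff_card hind).2 (T.mem_elements.1 hK).2
  let b : AffineBasis K ℝ (Space d) := ⟨(↑), hind, by simpa using htop⟩
  have hb : Set.range b = (K : Set (Space d)) := Subtype.range_coe
  -- All barycentric coordinates are positive at an interior point of K, whereas the one belonging
  -- to p vanishes on the hull of K ∩ s.
  have hpos : 0 < b.coord ⟨p, hpK⟩ x := by
    have hx' := hx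
    rw [simplex, ← hb, b.interior_convexHull] at hx'
    exact hx' ⟨p, hpK⟩
  have hzero : b.coord ⟨p, hpK⟩ x = (AffineMap.const ℝ (Space d) (0 : ℝ)) x := by
    refine affine_eq_of_mem_simplex _ _ (fun q hq => ?_) hxi
    have hqK := (Finset.mem_inter.1 hq).1
    have hne : (⟨p, hpK⟩ : K) ≠ ⟨q, hqK⟩ := by
      intro h
      have : p = q := congrArg Subtype.val h
      exact hps (this ▸ (Finset.mem_inter.1 hq).2)
    have h0 : b.coord ⟨p, hpK⟩ q = 0 := (b.coord_apply ⟨p, hpK⟩ ⟨q, hqK⟩).trans (if_neg hne)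
    rw [h0]
    rfl
  rw [hzero] at hpos
  simp at hpos

theorem Mesh.interior_disjoint {K K' : Finset (Space d)} (hK : K ∈ T.elements)
    (hK' : K' ∈ T.elements) (hne : K ≠ K') :
    Disjoint (interior (simplex K)) (interior (simplex K')) := by
  rw [Set.disjoint_left]
  intro x hx hx'
  have h := Mesh.subset_of_mem_interior hK (T.mem_elements.1 hK').1 hx (interior_subset hx')
  exact hne (Finset.eq_of_subset_of_card_le h
    (by rw [(T.mem_elements.1 hK).2, (T.mem_elements.1 hK').2]))

theorem Mesh.interior_subset (hΩ : IsOpen Ω) {K : Finset (Space d)} (hK : K ∈ T.elements) :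
    interior (simplex K) ⊆ Ω := by
  intro x hx
  by_contra hxΩ
  have hxf : x ∈ frontier Ω := by
    rw [hΩ.frontier_eq]
    exact ⟨Mesh.simplex_subset hK (_root_.interior_subset hx), hxΩ⟩
  obtain ⟨s, hs, hxs, hsub⟩ := T.boundary x hxf
  have hKs := Mesh.subset_of_mem_interior hK hs hx hxs
  -- Otherwise an open set would lie in the frontier of the open set Ω, which has empty interior.
  have h1 : interior (simplex K) ⊆ interior (frontier Ω) :=
    interior_mono ((simplex_mono hKs).trans hsub)
  rw [← frontier_compl, interior_frontier hΩ.isClosed_compl] at h1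
  exact h1 hx

theorem volume_frontier_simplex (K : Finset (Space d)) : volume (frontier (simplex K)) = 0 :=
  (convex_simplex K).addHaar_frontier volume

theorem Mesh.ae_mem_interior (hΩ : IsOpen Ω) (T : Mesh Ω) :
    ∀ᵐ x ∂(volume.restrict Ω), ∃ K ∈ T.elements, x ∈ interior (simplex K) := by
  have h1 : ∀ᵐ x ∂(volume : Measure (Space d)), ∀ K ∈ T.elements, x ∉ frontier (simplex K) := by
    refine (Finset.eventually_all T.elements).2 fun K _ => ?_
    exact measure_eq_zero_iff_ae_notMem.1 (volume_frontier_simplex K)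
  have h2 : ∀ᵐ x ∂(volume : Measure (Space d)), x ∈ Ω →
      ∃ K ∈ T.elements, x ∈ interior (simplex K) := by
    filter_upwards [h1] with x hx hxΩ
    obtain ⟨K, hK, hxK⟩ := T.exists_mem_simplex (subset_closure hxΩ)
    refine ⟨K, hK, ?_⟩
    by_contra hni
    exact hx K hK ⟨subset_closure hxK, hni⟩
  exact (ae_restrict_iff' hΩ.measurableSet).2 h2

theorem Mesh.elements_nonempty (T : Mesh Ω) (hΩ : Ω.Nonempty) : T.elements.Nonempty := by
  obtain ⟨x, hx⟩ := hΩ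
  obtain ⟨K, hK, _⟩ := T.exists_mem_simplex (subset_closure hx)
  exact ⟨K, hK⟩

theorem Mesh.N_pos (T : Mesh Ω) (hΩ : Ω.Nonempty) : 0 < T.N := (T.elements_nonempty hΩ).card_pos

/-! ### Finite element functions -/

theorem Mesh.exists_interpolant (T : Mesh Ω) (u : Space d → ℝ) :
    ∃ v, T.IsFEFunction v ∧ ∀ p ∈ T.vertices, v p = u p := by
  classical
  have hex : ∀ K, ∃ ℓ : Space d →ᵃ[ℝ] ℝ, K ∈ T.elements → ∀ p ∈ K, ℓ p = u p := by
    intro K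
    by_cases hK : K ∈ T.elements
    · obtain ⟨ℓ, hℓ⟩ := exists_affine_interpolant (Mesh.indep_of_mem hK) (T.mem_elements.1 hK).2 u
      exact ⟨ℓ, fun _ => hℓ⟩
    · exact ⟨0, fun h => absurd h hK⟩
  choose ℓ hℓ using hex
  -- The choice of element is immaterial: two elements meet in the hull of their common vertices,
  -- where both affine pieces interpolate u.
  let v : Space d → ℝ := fun x =>
    if h : ∃ K ∈ T.elements, x ∈ simplex K then ℓ h.choose x else 0
  have hv : ∀ K ∈ T.elements, Set.EqOn v (ℓ K) (simplex K) := by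
    intro K hK x hx
    have h : ∃ K ∈ T.elements, x ∈ simplex K := ⟨K, hK, hx⟩
    have hv : v x = ℓ h.choose x := dif_pos h
    rw [hv]
    have hK' := h.choose_spec.1
    have hx' := h.choose_spec.2
    have hxi : x ∈ simplex (h.choose ∩ K) := by
      have := T.inter_subset_convexHull (T.mem_elements.1 hK').1 (T.mem_elements.1 hK).1 ⟨hx', hx⟩
      rw [← Finset.coe_inter] at this
      exact this
    refine affine_eq_of_mem_simplex _ _ (fun q hq => ?_) hxi
    rw [hℓ _ hK' q (Finset.mem_inter.1 hq).1, hℓ _ hK q (Finset.mem_inter.1 hq).2]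
  refine ⟨v, ⟨?_, fun K hK => ⟨ℓ K, hv K hK⟩⟩, fun p hp => ?_⟩
  · rw [T.closure_eq]
    have : ⋃ K ∈ T.elements, simplex K = ⋃ K : T.elements, simplex (K : Finset (Space d)) := by
      ext x; simp
    rw [this]
    refine (locallyFinite_of_finite _).continuousOn_iUnion (fun K => isClosed_simplex _) fun K => ?_
    exact ((ℓ K).continuous_of_finiteDimensional.continuousOn).congr (hv K K.2)
  · have hp' : {p} ∈ T.faces := hp
    obtain ⟨t, ht, hst, hc⟩ := T.pure _ hp'
    have htE : t ∈ T.elements := T.mem_elements.2 ⟨ht, hc⟩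
    have hpt : p ∈ t := Finset.singleton_subset_iff.1 hst
    rw [hv t htE (mem_simplex hpt), hℓ t htE p hpt]

theorem Mesh.IsFEFunction.sub {v w : Space d → ℝ} (hv : T.IsFEFunction v)
    (hw : T.IsFEFunction w) : T.IsFEFunction (v - w) := by
  refine ⟨hv.1.sub hw.1, fun K hK => ?_⟩
  obtain ⟨ℓ, hℓ⟩ := hv.2 K hK
  obtain ⟨ℓ', hℓ'⟩ := hw.2 K hK
  exact ⟨ℓ - ℓ', fun x hx => by simp [hℓ hx, hℓ' hx]⟩

/-- A boundary point lies in a face contained in ∂Ω. On that face v is affine, and the vertices of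
the face are boundary vertices. -/
theorem Mesh.IsFEFunction.eq_zero_on_frontier {v : Space d → ℝ} (hv : T.IsFEFunction v)
    (h : ∀ p ∈ T.vertices, p ∈ frontier Ω → v p = 0) : ∀ x ∈ frontier Ω, v x = 0 := by
  intro x hx
  obtain ⟨s, hs, hxs, hsub⟩ := T.boundary x hx
  obtain ⟨t, ht, hst, hc⟩ := T.pure s hs
  obtain ⟨ℓ, hℓ⟩ := hv.2 t (T.mem_elements.2 ⟨ht, hc⟩)
  rw [hℓ (simplex_mono hst hxs)]
  refine affine_eq_of_mem_simplex ℓ (AffineMap.const ℝ (Space d) (0 : ℝ)) (fun p hp => ?_) hxs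
  rw [← hℓ (mem_simplex (hst hp))]
  refine h p ?_ (hsub (subset_convexHull ℝ _ hp))
  exact T.down_closed hs (Finset.singleton_subset_iff.2 hp) (Finset.singleton_nonempty p)

theorem hasFDerivAt_affine (ℓ : Space d →ᵃ[ℝ] ℝ) (x : Space d) :
    HasFDerivAt ℓ (LinearMap.toContinuousLinearMap ℓ.linear) x := by
  have h : (ℓ : Space d → ℝ) = fun y => LinearMap.toContinuousLinearMap ℓ.linear y + ℓ 0 := by
    funext y
    have := ℓ.linearMap_vsub y 0
    simp only [vsub_eq_sub, sub_zero] at this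
    simp [this]
  rw [h]
  exact (LinearMap.toContinuousLinearMap ℓ.linear).hasFDerivAt.add_const _

/-- The gradient of an affine function. -/
def affGrad (ℓ : Space d →ᵃ[ℝ] ℝ) : Space d :=
  (InnerProductSpace.toDual ℝ (Space d)).symm (LinearMap.toContinuousLinearMap ℓ.linear)

theorem inner_affGrad (ℓ : Space d →ᵃ[ℝ] ℝ) (ξ : Space d) :
    inner ℝ (affGrad ℓ) ξ = ℓ.linear ξ := by
  simp [affGrad]

theorem hasGradientAt_of_eqOn {K : Finset (Space d)} {v : Space d → ℝ} {ℓ : Space d →ᵃ[ℝ] ℝ}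
    (h : Set.EqOn v ℓ (simplex K)) {x : Space d} (hx : x ∈ interior (simplex K)) :
    HasGradientAt v (affGrad ℓ) x := by
  rw [hasGradientAt_iff_hasFDerivAt, affGrad, LinearIsometryEquiv.apply_symm_apply]
  refine (hasFDerivAt_affine ℓ x).congr_of_eventuallyEq ?_
  filter_upwards [mem_interior_iff_mem_nhds.1 hx] with y hy using h hy

end MeshGeometry

end

end AnisoFEM

namespace AnisoFEM

noncomputable section

open Filter Topology ContinuousLinearMap
open scoped Convolution

/-! ### Mollification, almost everywhere Taylor inequality, symmetry of the weak Hessian -/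

section WeakDerivatives

variable {d : ℕ}

theorem inner_gradient (φ : Space d → ℝ) (x v : Space d) :
    inner ℝ (gradient φ x) v = fderiv ℝ φ x v := by
  rw [← toDual_gradient, InnerProductSpace.toDual_apply_apply]

theorem gradient_apply (φ : Space d → ℝ) (x : Space d) (i : Fin d) :
    gradient φ x i = fderiv ℝ φ x (EuclideanSpace.single i 1) := by
  rw [← inner_gradient, EuclideanSpace.inner_single_right]
  simp

/-- Convolution with a normalised bump function. -/
def mollify {E : Type*} [NormedAddCommGroup E] [NormedSpace ℝ E] (η : ContDiffBump (0 : Space d))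
    (w : Space d → E) : Space d → E :=
  η.normed volume ⋆[lsmul ℝ ℝ, volume] w

theorem hasFDerivAt_mollify (η : ContDiffBump (0 : Space d)) {w : Space d → ℝ}
    (hw : LocallyIntegrable w volume) (x : Space d) :
    DifferentiableAt ℝ (mollify η w) x ∧ ∀ v, fderiv ℝ (mollify η w) x v =
      ∫ y, fderiv ℝ (η.normed volume) (x - y) v * w y := by
  have h := η.hasCompactSupport_normed (μ := volume).hasFDerivAt_convolution_left
    (lsmul ℝ ℝ) (η.contDiff_normed (μ := volume) (n := 1)) hw x
  refine ⟨h.differentiableAt, fun v => ?_⟩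
  have hex := (η.hasCompactSupport_normed (μ := volume)).fderiv (𝕜 := ℝ)
    |>.convolutionExists_left ((lsmul ℝ ℝ : ℝ →L[ℝ] ℝ →L[ℝ] ℝ).precompL (Space d))
      ((η.contDiff_normed (μ := volume) (n := 1)).continuous_fderiv one_ne_zero) hw x
  have : fderiv ℝ (mollify η w) x = _ := h.fderiv
  rw [this, convolution_eq_swap, ContinuousLinearMap.integral_apply]
  · rfl
  · exact hex.integrable_swap

theorem isTestFunction_bump {Ω : Set (Space d)} (η : ContDiffBump (0 : Space d)) {x : Space d}
    (hx : Metric.closedBall x η.rOut ⊆ Ω) :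
    IsTestFunction Ω (fun y => η.normed volume (x - y)) := by
  have hts : tsupport (fun y => η.normed volume (x - y)) ⊆ Metric.closedBall x η.rOut := by
    refine closure_minimal (fun y hy => ?_) Metric.isClosed_closedBall
    have : x - y ∈ Function.support (η.normed volume) := hy
    rw [η.support_normed_eq, mem_ball_zero_iff] at this
    rw [Metric.mem_closedBall, dist_comm, dist_eq_norm]
    exact this.le
  refine ⟨?_, HasCompactSupport.of_support_subset_isCompact (isCompact_closedBall x η.rOut)
    (subset_closure.trans hts), hts.trans hx⟩
  exact (η.contDiff_normed (μ := volume) (n := ⊤)).comp (contDiff_const.sub contDiff_id)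

/-- The translated kernel y ↦ η(x - y) is a test function in Ω as soon as its ball lies in Ω. The
weak derivative identity for this test function moves the derivative from the kernel to w. -/
theorem fderiv_mollify_single {Ω : Set (Space d)} (hΩ : MeasurableSet Ω) {w w' : Space d → ℝ}
    {i : Fin d} (hw : IntegrableOn w Ω volume) (h : HasWeakPartial Ω i w w')
    (η : ContDiffBump (0 : Space d)) {x : Space d} (hx : Metric.closedBall x η.rOut ⊆ Ω) :
    fderiv ℝ (mollify η (Ω.indicator w)) x (EuclideanSpace.single i 1) =
      mollify η (Ω.indicator w') x := by
  have hint : LocallyIntegrable (Ω.indicator w) volume :=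
    (hw.integrable_indicator hΩ).locallyIntegrable
  rw [(hasFDerivAt_mollify η hint x).2]
  have hφ := isTestFunction_bump η hx
  have hg : ∀ y, gradient (fun y => η.normed volume (x - y)) y i =
      - fderiv ℝ (η.normed volume) (x - y) (EuclideanSpace.single i 1) := by
    intro y
    rw [gradient_apply]
    have hd : HasFDerivAt (fun y : Space d => x - y) (-ContinuousLinearMap.id ℝ (Space d)) y := by
      simpa using (hasFDerivAt_id (𝕜 := ℝ) y).const_sub x
    have h1 : HasFDerivAt (η.normed volume) (fderiv ℝ (η.normed volume) (x - y)) (x - y) :=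
      ((η.contDiff_normed (μ := volume) (n := 1)).differentiable one_ne_zero _).hasFDerivAt
    have h2 := h1.comp y hd
    have h3 : fderiv ℝ (fun y => η.normed volume (x - y)) y = _ := h2.fderiv
    rw [h3]
    simp
  have key := h _ hφ
  simp only [hg] at key
  have e1 : ∫ y, fderiv ℝ (η.normed volume) (x - y) (EuclideanSpace.single i 1) * Ω.indicator w y
      = ∫ y in Ω, fderiv ℝ (η.normed volume) (x - y) (EuclideanSpace.single i 1) * w y := by
    rw [← integral_indicator hΩ]
    congr 1; ext y
    by_cases hy : y ∈ Ω <;> simp [hy]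
  have e2 : mollify η (Ω.indicator w') x = ∫ y in Ω, w' y * η.normed volume (x - y) := by
    rw [mollify, convolution_lsmul_swap, ← integral_indicator hΩ]
    congr 1; ext y
    by_cases hy : y ∈ Ω <;> simp [hy, mul_comm]
  rw [e1, e2]
  have e3 : ∫ y in Ω, w y * -fderiv ℝ (η.normed volume) (x - y) (EuclideanSpace.single i 1)
      = -∫ y in Ω, fderiv ℝ (η.normed volume) (x - y) (EuclideanSpace.single i 1) * w y := by
    rw [← integral_neg]
    congr 1; ext y; ring
  rw [e3] at key
  linarith

theorem fderiv_eq_sum_single (F : Space d →L[ℝ] ℝ) (ξ : Space d) :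
    F ξ = ∑ i, ξ i * F (EuclideanSpace.single i 1) := by
  conv_lhs => rw [← (EuclideanSpace.basisFun (Fin d) ℝ).sum_repr ξ, map_sum]
  simp

theorem abs_sub_sub_deriv_le {h h' h'' : ℝ → ℝ} {B : ℝ}
    (h1 : ∀ t ∈ Set.Icc (0 : ℝ) 1, HasDerivAt h (h' t) t)
    (h2 : ∀ t ∈ Set.Icc (0 : ℝ) 1, HasDerivAt h' (h'' t) t)
    (hB : ∀ t ∈ Set.Icc (0 : ℝ) 1, |h'' t| ≤ B) : |h 1 - h 0 - h' 0| ≤ B / 2 := by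
  have s1 : ∀ t ∈ Set.Icc (0 : ℝ) 1, ‖h' t - h' 0‖ ≤ B * t := by
    intro t ht
    have := image_norm_le_of_norm_deriv_right_le_deriv_boundary (f := fun t => h' t - h' 0)
      (f' := h'') (a := 0) (b := 1) (B := fun t => B * t) (B' := fun _ => B)
      (fun t ht => ((h2 t ht).continuousAt.sub continuousAt_const).continuousWithinAt)
      (fun t ht => ((h2 t ⟨ht.1, ht.2.le⟩).sub_const _).hasDerivWithinAt) (by simp)
      (fun t => by simpa using (hasDerivAt_id t).const_mul B)
      (fun t ht => hB t ⟨ht.1, ht.2.le⟩) ht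
    exact this
  have := image_norm_le_of_norm_deriv_right_le_deriv_boundary (f := fun t => h t - h 0 - h' 0 * t)
    (f' := fun t => h' t - h' 0) (a := 0) (b := 1) (B := fun t => B / 2 * t ^ 2)
    (B' := fun t => B * t)
    (fun t ht => (((h1 t ht).continuousAt.sub continuousAt_const).sub
      (continuousAt_const.mul continuousAt_id)).continuousWithinAt)
    (fun t ht => by
      have := ((h1 t ⟨ht.1, ht.2.le⟩).sub_const (h 0)).sub ((hasDerivAt_id t).const_mul (h' 0))
      have h3 := this.hasDerivWithinAt (s := Set.Ici t)
      rw [mul_one] at h3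
      exact h3) (by simp)
    (fun t => by
      have := (hasDerivAt_pow 2 t).const_mul (B / 2)
      have e : B / 2 * (((2 : ℕ) : ℝ) * t ^ (2 - 1)) = B * t := by norm_num; ring
      rwa [e] at this)
    (fun t ht => s1 t ⟨ht.1, ht.2.le⟩) (Set.right_mem_Icc.2 zero_le_one)
  simpa using this

/-- A sequence of bump functions shrinking to the origin. -/
def bumpSeq (d : ℕ) (n : ℕ) : ContDiffBump (0 : Space d) where
  rIn := 1 / ((n : ℝ) + 1)
  rOut := 2 / ((n : ℝ) + 1)
  rIn_pos := by positivity
  rIn_lt_rOut := by gcongr; norm_num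

theorem tendsto_bumpSeq_rOut (d : ℕ) : Tendsto (fun n => (bumpSeq d n).rOut) atTop (𝓝 0) := by
  have := (tendsto_one_div_add_atTop_nhds_zero_nat (𝕜 := ℝ)).const_mul 2
  simpa [bumpSeq, div_eq_mul_inv] using this

theorem ae_tendsto_mollify_bumpSeq {E : Type*} [NormedAddCommGroup E] [NormedSpace ℝ E]
    [CompleteSpace E] {w : Space d → E} (hw : LocallyIntegrable w volume) :
    ∀ᵐ x, Tendsto (fun n => mollify (bumpSeq d n) w x) atTop (𝓝 (w x)) :=
  -- The value 2 bounds rOut / rIn; a bounded ratio lets Lebesgue differentiation give almost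
  -- everywhere convergence without continuity of w.
  ContDiffBump.ae_convolution_tendsto_right_of_locallyIntegrable (K := 2)
    (tendsto_bumpSeq_rOut d) (Eventually.of_forall fun n => by
      simp [bumpSeq, div_eq_mul_inv]) hw

theorem tendsto_mollify_bumpSeq_of_continuousAt {w : Space d → ℝ}
    (hw : AEStronglyMeasurable w volume) {x : Space d} (hx : ContinuousAt w x) :
    Tendsto (fun n => mollify (bumpSeq d n) w x) atTop (𝓝 (w x)) :=
  ContDiffBump.convolution_tendsto_right (tendsto_bumpSeq_rOut d)
    (Eventually.of_forall fun _ => hw) (hx.tendsto.comp tendsto_snd) tendsto_const_nhds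

/-- If `|w| ≤ m` almost everywhere on the ball of radius `rOut`, then `|η ⋆ w| ≤ m`. -/
theorem norm_mollify_le {E : Type*} [NormedAddCommGroup E] [NormedSpace ℝ E]
    (η : ContDiffBump (0 : Space d)) {w : Space d → E} {m : ℝ} {x : Space d}
    (h : ∀ᵐ y ∂(volume : Measure (Space d)), y ∈ Metric.ball x η.rOut → ‖w y‖ ≤ m) :
    ‖mollify η w x‖ ≤ m := by
  rw [mollify, convolution_lsmul_swap]
  have hint : Integrable (fun y => η.normed volume (x - y) * m) :=
    ((η.integrable_normed (μ := volume)).comp_sub_left x).mul_const m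
  refine (norm_integral_le_of_norm_le hint ?_).trans ?_
  · filter_upwards [h] with y hy
    rw [norm_smul, Real.norm_of_nonneg (η.nonneg_normed _)]
    by_cases hyb : y ∈ Metric.ball x η.rOut
    · exact mul_le_mul_of_nonneg_left (hy hyb) (η.nonneg_normed _)
    · have : η.normed volume (x - y) = 0 := by
        by_contra hne
        have : x - y ∈ Function.support (η.normed volume) := hne
        rw [η.support_normed_eq, mem_ball_zero_iff] at this
        rw [Metric.mem_ball, dist_comm, dist_eq_norm] at hyb
        exact hyb this
      simp [this]
  · rw [integral_mul_const]
    have : ∫ y, η.normed volume (x - y) = 1 := by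
      rw [integral_sub_left_eq_self (fun y => η.normed volume y) volume x]
      exact η.integral_normed
    rw [this, one_mul]

theorem mollify_sum {ι : Type*} (s : Finset ι) (η : ContDiffBump (0 : Space d))
    (c : ι → ℝ) {w : ι → Space d → ℝ} (hw : ∀ i ∈ s, LocallyIntegrable (w i) volume)
    (x : Space d) :
    ∑ i ∈ s, c i * mollify η (w i) x = mollify η (fun y => ∑ i ∈ s, c i * w i y) x := by
  simp only [mollify, convolution_lsmul_swap, smul_eq_mul, Finset.mul_sum]
  rw [integral_finsetSum]
  · refine Finset.sum_congr rfl fun i _ => ?_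
    rw [← integral_const_mul]
    congr 1; ext y; ring
  · intro i hi
    have hex := (η.hasCompactSupport_normed (μ := volume)).convolutionExists_left (lsmul ℝ ℝ)
      (η.continuous_normed) (hw i hi) x
    have := (hex.integrable_swap).const_mul (c i)
    refine this.congr (ae_of_all _ fun y => ?_)
    simp; ring

theorem IsH2.integrableOn {Ω : Set (Space d)} (hΩ : volume Ω < ⊤) {w : Space d → ℝ}
    (hw : MemLp w 2 (volume.restrict Ω)) : IntegrableOn w Ω volume := by
  have : IsFiniteMeasure (volume.restrict Ω) := ⟨by simpa using hΩ⟩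
  exact hw.integrable (by norm_num)

/-- Along the segment from x to x + ξ the mollified function is twice differentiable, its
derivatives being the mollified weak ones. The second derivative is an average of values ξᵀHξ taken
in U, so it inherits the bound q ξ, and the one-dimensional Taylor estimate applies. -/
theorem abs_taylor_mollify_le {Ω U : Set (Space d)} (hΩ : MeasurableSet Ω)
    (hvol : volume Ω < ⊤) (hUΩ : U ⊆ Ω) {u : Space d → ℝ} {Du : Space d → Space d}
    {H : Space d → Mat d} (hu : IsH2 Ω u Du H) {q : Space d → ℝ}
    (hq : ∀ᵐ x ∂(volume : Measure (Space d)), x ∈ U → ∀ ξ, |quad (H x) ξ| ≤ q ξ)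
    (η : ContDiffBump (0 : Space d)) {x ξ : Space d}
    (hx : ∀ t ∈ Set.Icc (0 : ℝ) 1, Metric.closedBall (x + t • ξ) η.rOut ⊆ U) :
    |mollify η (Ω.indicator u) (x + ξ) - mollify η (Ω.indicator u) x -
      ∑ i, ξ i * mollify η (Ω.indicator fun y => Du y i) x| ≤ q ξ / 2 := by
  have hlu := ((IsH2.integrableOn hvol hu.memLp).integrable_indicator hΩ).locallyIntegrable
  have hlD := fun i =>
    ((IsH2.integrableOn hvol (hu.memLp_grad i)).integrable_indicator hΩ).locallyIntegrable
  have hlH := fun i j =>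
    ((IsH2.integrableOn hvol (hu.memLp_hess i j)).integrable_indicator hΩ).locallyIntegrable
  have hline : ∀ t : ℝ, HasDerivAt (fun t : ℝ => x + t • ξ) ξ t := fun t => by
    simpa using ((hasDerivAt_id t).smul_const ξ).const_add x
  have key : ∀ {w : Space d → ℝ} {w' : Fin d → Space d → ℝ}, IntegrableOn w Ω volume →
      (∀ i, HasWeakPartial Ω i w (w' i)) → ∀ t ∈ Set.Icc (0 : ℝ) 1,
      HasDerivAt (fun t : ℝ => mollify η (Ω.indicator w) (x + t • ξ))
        (∑ i, ξ i * mollify η (Ω.indicator (w' i)) (x + t • ξ)) t := by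
    intro w w' hw hw' t ht
    have hl := (hw.integrable_indicator hΩ).locallyIntegrable
    have h1 := (hasFDerivAt_mollify η hl (x + t • ξ)).1.hasFDerivAt.comp_hasDerivAt t (hline t)
    have e : fderiv ℝ (mollify η (Ω.indicator w)) (x + t • ξ) ξ =
        ∑ i, ξ i * mollify η (Ω.indicator (w' i)) (x + t • ξ) := by
      rw [fderiv_eq_sum_single]
      refine Finset.sum_congr rfl fun i _ => ?_
      rw [fderiv_mollify_single hΩ hw (hw' i) η ((hx t ht).trans hUΩ)]
    rw [e] at h1
    exact h1
  have h1 := fun t ht => key (IsH2.integrableOn hvol hu.memLp) hu.grad t ht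
  have h2 : ∀ t ∈ Set.Icc (0 : ℝ) 1, HasDerivAt
      (fun t : ℝ => ∑ i, ξ i * mollify η (Ω.indicator fun y => Du y i) (x + t • ξ))
      (∑ i, ξ i * ∑ j, ξ j * mollify η (Ω.indicator fun y => H y i j) (x + t • ξ)) t := by
    intro t ht
    refine HasDerivAt.fun_sum (u := Finset.univ) fun i _ =>
      (key (IsH2.integrableOn hvol (hu.memLp_grad i)) (hu.hess i) t ht).const_mul (ξ i)
  have := abs_sub_sub_deriv_le h1 h2 (B := q ξ) fun t ht => by
    -- For fixed ξ, mollification commutes with taking the quadratic form, so the pointwise bound on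
    -- the form can be averaged without entrywise losses.
    have e1 : ∑ i, ξ i * ∑ j, ξ j * mollify η (Ω.indicator fun y => H y i j) (x + t • ξ) =
        mollify η (fun y => ∑ p : Fin d × Fin d,
          (ξ p.1 * ξ p.2) * (Ω.indicator fun y => H y p.1 p.2) y) (x + t • ξ) := by
      rw [← mollify_sum Finset.univ η (fun p : Fin d × Fin d => ξ p.1 * ξ p.2)
        (fun p _ => hlH p.1 p.2), Fintype.sum_prod_type]
      refine Finset.sum_congr rfl fun i _ => ?_
      rw [Finset.mul_sum]
      exact Finset.sum_congr rfl fun j _ => by ring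
    rw [e1, ← Real.norm_eq_abs]
    refine norm_mollify_le η ?_
    filter_upwards [hq] with y hy hyb
    have hyU : y ∈ U := hx t ht (Metric.ball_subset_closedBall hyb)
    have := hy hyU ξ
    rw [quad_eq_sum] at this
    rw [Real.norm_eq_abs, Fintype.sum_prod_type]
    simpa [Set.indicator_of_mem (hUΩ hyU)] using this
  simpa using this

/-- Taylor's inequality almost everywhere for a continuous function whose weak Hessian is bounded
by a quadratic form on a convex open set. -/
theorem ae_abs_taylor_le {Ω U : Set (Space d)} (hΩ : MeasurableSet Ω)
    (hvol : volume Ω < ⊤) (hU : IsOpen U) (hUc : Convex ℝ U) (hUΩ : U ⊆ Ω)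
    {u : Space d → ℝ} {Du : Space d → Space d} {H : Space d → Mat d} (hu : IsH2 Ω u Du H)
    (hcont : ContinuousOn u (closure U)) {q : Space d → ℝ} (hqc : Continuous q)
    (hq : ∀ᵐ x ∂(volume : Measure (Space d)), x ∈ U → ∀ ξ, |quad (H x) ξ| ≤ q ξ) :
    ∀ᵐ x ∂(volume : Measure (Space d)), x ∈ U → ∀ y ∈ closure U,
      |u y - u x - inner ℝ (Du x) (y - x)| ≤ q (y - x) / 2 := by
  have hlu := (IsH2.integrableOn hvol hu.memLp).integrable_indicator hΩ
  have hlD := fun i =>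
    ((IsH2.integrableOn hvol (hu.memLp_grad i)).integrable_indicator hΩ).locallyIntegrable
  -- Only the gradient at the base point x needs an exceptional null set: u is continuous, so its
  -- mollifications converge at every point of U. Hence one null set of x serves all y.
  have hae : ∀ᵐ x ∂(volume : Measure (Space d)), ∀ i, Tendsto
      (fun n => mollify (bumpSeq d n) (Ω.indicator fun y => Du y i) x) atTop
      (𝓝 (Ω.indicator (fun y => Du y i) x)) :=
    ae_all_iff.2 fun i => ae_tendsto_mollify_bumpSeq (hlD i)
  filter_upwards [hae] with x hx hxU
  have hlim : ∀ z ∈ U, Tendsto (fun n => mollify (bumpSeq d n) (Ω.indicator u) z) atTop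
      (𝓝 (u z)) := by
    intro z hz
    have hev : Ω.indicator u =ᶠ[𝓝 z] u := by
      filter_upwards [hU.mem_nhds hz] with y hy using Set.indicator_of_mem (hUΩ hy) u
    have hc : ContinuousAt (Ω.indicator u) z :=
      ((hcont.mono subset_closure).continuousAt (hU.mem_nhds hz)).congr hev.symm
    have := tendsto_mollify_bumpSeq_of_continuousAt hlu.aestronglyMeasurable hc
    rwa [Set.indicator_of_mem (hUΩ hz)] at this
  have main : ∀ y ∈ U, |u y - u x - inner ℝ (Du x) (y - x)| ≤ q (y - x) / 2 := by
    intro y hy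
    have hin : inner ℝ (Du x) (y - x) = ∑ i, (y - x) i * Du x i := by
      rw [PiLp.inner_apply]
      exact Finset.sum_congr rfl fun i _ => by simp
    have hl : Tendsto (fun n => |mollify (bumpSeq d n) (Ω.indicator u) y -
        mollify (bumpSeq d n) (Ω.indicator u) x -
        ∑ i, (y - x) i * mollify (bumpSeq d n) (Ω.indicator fun y => Du y i) x|) atTop
        (𝓝 |u y - u x - ∑ i, (y - x) i * Du x i|) := by
      refine (((hlim y hy).sub (hlim x hxU)).sub
        (tendsto_finsetSum _ fun i _ => Tendsto.const_mul _ ?_)).abs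
      have := hx i
      rwa [Set.indicator_of_mem (hUΩ hxU)] at this
    rw [hin]
    refine le_of_tendsto hl ?_
    have hseg : IsCompact (segment ℝ x y) := by
      rw [segment_eq_image_lineMap]
      exact isCompact_Icc.image (by fun_prop)
    -- The segment is compact in the open set U, so all mollification balls along it stay in U once
    -- their radius is below ε.
    obtain ⟨ε, hε, hthick⟩ := hseg.exists_cthickening_subset_open hU
      (hUc.segment_subset hxU hy)
    filter_upwards [(tendsto_bumpSeq_rOut d).eventually (gt_mem_nhds hε)] with n hn
    have := abs_taylor_mollify_le hΩ hvol hUΩ hu hq (bumpSeq d n) (x := x) (ξ := y - x) ?_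
    · simpa using this
    intro t ht
    refine (Metric.closedBall_subset_closedBall hn.le).trans
      ((Metric.closedBall_subset_cthickening ?_ ε).trans hthick)
    rw [segment_eq_image']
    exact ⟨t, ht, rfl⟩
  -- Both sides are continuous in y on the closure, so the inequality passes from U to its closure.
  intro y hy
  have hc1 : ContinuousOn (fun y => |u y - u x - inner ℝ (Du x) (y - x)|) (closure U) :=
    ((hcont.sub continuousOn_const).sub (by fun_prop)).abs
  have hc2 : ContinuousOn (fun y => q (y - x) / 2) (closure U) := by fun_prop
  have hne : (𝓝[U] y).NeBot := mem_closure_iff_nhdsWithin_neBot.1 hy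
  refine le_of_tendsto_of_tendsto ((hc1 y hy).mono_left (nhdsWithin_mono _ subset_closure))
    ((hc2 y hy).mono_left (nhdsWithin_mono _ subset_closure)) ?_
  filter_upwards [self_mem_nhdsWithin] with z hz using main z hz

theorem IsTestFunction.partialDeriv {Ω : Set (Space d)} {φ : Space d → ℝ} (hφ : IsTestFunction Ω φ)
    (i : Fin d) : IsTestFunction Ω (fun x => gradient φ x i) := by
  have he : (fun x => gradient φ x i) =
      (fun F : Space d →L[ℝ] ℝ => F (EuclideanSpace.single i 1)) ∘ fderiv ℝ φ := by
    funext x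
    rw [gradient_apply]; rfl
  have hsub : tsupport (fun x => gradient φ x i) ⊆ tsupport φ := by
    rw [he]
    exact (closure_mono (Function.support_comp_subset (by simp) _)).trans
      (tsupport_fderiv_subset ℝ)
  refine ⟨?_, hφ.2.1.mono' (subset_closure.trans hsub), hsub.trans hφ.2.2⟩
  rw [he]
  have h1 : ContDiff ℝ ∞ (fderiv ℝ φ) := hφ.1.fderiv_right (by exact le_rfl)
  exact (ContinuousLinearMap.apply ℝ ℝ (EuclideanSpace.single i (1 : ℝ))).contDiff.comp h1

theorem gradient_gradient_comm {φ : Space d → ℝ} (hφ : ContDiff ℝ ∞ φ) (x : Space d)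
    (i j : Fin d) : gradient (fun y => gradient φ y j) x i = gradient (fun y => gradient φ y i) x j := by
  have hd : DifferentiableAt ℝ (fderiv ℝ φ) x :=
    ((hφ.fderiv_right (m := ∞) (by exact le_rfl)).differentiable (by simp)) x
  have h : ∀ k l : Fin d, gradient (fun y => gradient φ y k) x l =
      fderiv ℝ (fderiv ℝ φ) x (EuclideanSpace.single l 1) (EuclideanSpace.single k 1) := by
    intro k l
    rw [gradient_apply]
    have he : (fun x => gradient φ x k) = fun x => fderiv ℝ φ x (EuclideanSpace.single k 1) := by
      funext x
      rw [gradient_apply]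
    rw [he, fderiv_clm_apply hd (differentiableAt_const _)]
    simp
  rw [h, h]
  have hs : IsSymmSndFDerivAt ℝ φ x := hφ.contDiffAt.isSymmSndFDerivAt (by simpa using (WithTop.coe_le_coe.2 (le_top : (2 : ℕ∞) ≤ ⊤)))
  exact hs _ _

/-- Symmetry is not part of the definition of the weak Hessian. Moving both derivatives onto a test
function, whose second partials commute, shows that H i j - H j i integrates to zero against every
test function. -/
theorem IsH2.ae_isHermitian {Ω : Set (Space d)} (hΩ : IsOpen Ω) (hvol : volume Ω < ⊤)
    {u : Space d → ℝ} {Du : Space d → Space d} {H : Space d → Mat d} (hu : IsH2 Ω u Du H) :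
    ∀ᵐ x ∂(volume : Measure (Space d)), x ∈ Ω → (H x).IsHermitian := by
  have hij : ∀ i j, ∀ᵐ x ∂(volume : Measure (Space d)), x ∈ Ω → H x i j - H x j i = 0 := by
    intro i j
    have hI := fun i j => IsH2.integrableOn hvol (hu.memLp_hess i j)
    refine hΩ.ae_eq_zero_of_integral_contDiff_smul_eq_zero
      ((hI i j).sub (hI j i)).locallyIntegrableOn fun φ h1 h2 h3 => ?_
    have hφ : IsTestFunction Ω φ := ⟨h1, h2, h3⟩
    have key : ∀ k l, ∫ x in Ω, H x k l * φ x =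
        ∫ x in Ω, u x * gradient (fun y => gradient φ y l) x k := by
      intro k l
      have e1 := hu.hess k l φ hφ
      have e2 := hu.grad k _ (hφ.partialDeriv l)
      linarith
    have hint : ∀ k l, Integrable (fun x => H x k l * φ x) (volume.restrict Ω) := by
      intro k l
      obtain ⟨m, hm⟩ := h2.exists_bound_of_continuous h1.continuous
      exact (hI k l).mul_bdd h1.continuous.aestronglyMeasurable (c := m) (ae_of_all _ hm)
    have e : ∫ x, φ x • (H x i j - H x j i) = ∫ x in Ω, (H x i j * φ x - H x j i * φ x) := by
      rw [← integral_indicator hΩ.measurableSet]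
      congr 1; ext x
      by_cases hx : x ∈ Ω
      · simp [hx]; ring
      · have : φ x = 0 := image_eq_zero_of_notMem_tsupport fun h => hx (h3 h)
        simp [hx, this]
    rw [e, integral_sub (hint i j) (hint j i), key, key, sub_eq_zero]
    simp only [gradient_gradient_comm h1 _ i j]
  have := ae_all_iff.2 fun i => ae_all_iff.2 fun j => hij i j
  filter_upwards [this] with x hx hxΩ
  ext i j
  have := hx j i hxΩ
  simp only [Matrix.conjTranspose_apply, star_trivial]
  linarith

end WeakDerivatives

end

end AnisoFEM

namespace AnisoFEM

noncomputable section

open Filter Topology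

/-! ### Interpolation error on one element through the pulled-back matrix F'ᵀAF' -/

section LocalInterpolation

variable {d : ℕ}

theorem toEuclideanLin_jacobian (F : Space d →ᵃ[ℝ] Space d) (ξ : Space d) :
    Matrix.toEuclideanLin (jacobian F) ξ = F.linear ξ := by
  simp [jacobian]

theorem quad_jacobian (F : Space d →ᵃ[ℝ] Space d) (A : Mat d) (ξ : Space d) :
    quad ((jacobian F).transpose * A * jacobian F) ξ = quad A (F.linear ξ) := by
  have h : (F.linear ξ).ofLp = (jacobian F).mulVec ξ.ofLp := by
    rw [← toEuclideanLin_jacobian]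
    rfl
  rw [quad_eq_dotProduct, quad_eq_dotProduct, h, ← Matrix.mulVec_mulVec, ← Matrix.mulVec_mulVec,
    Matrix.dotProduct_mulVec, Matrix.vecMul_transpose]

theorem det_jacobian (F : Space d →ᵃ[ℝ] Space d) :
    (jacobian F).det = LinearMap.det F.linear := by
  have h : F.linear = Matrix.toEuclideanLin (jacobian F) := by simp [jacobian]
  conv_rhs => rw [h, Matrix.toEuclideanLin_eq_toLin_orthonormal, LinearMap.det_toLin]

theorem abs_det_jacobian {V K : Finset (Space d)} (hV : vol V = 1) {F : Space d →ᵃ[ℝ] Space d}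
    (hF : F '' simplex V = simplex K) : |(jacobian F).det| = vol K := by
  have h : F '' simplex V = (fun y => y + F 0) '' (F.linear '' simplex V) := by
    rw [Set.image_image]
    refine Set.image_congr fun x _ => ?_
    have := F.linearMap_vsub x 0
    simp only [vsub_eq_sub, sub_zero] at this
    simp [this]
  rw [vol, ← hF, h, measureReal_def, Set.image_add_right, measure_preimage_add_right,
    Measure.addHaar_image_linearMap, ENNReal.toReal_mul, ENNReal.toReal_ofReal (abs_nonneg _),
    ← measureReal_def, det_jacobian]
  change _ = _ * vol V
  rw [hV, mul_one]

theorem pullback_posDef {F : Space d →ᵃ[ℝ] Space d} (hF : (jacobian F).det ≠ 0) {A : Mat d}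
    (hA : A.PosDef) : ((jacobian F).transpose * A * jacobian F).PosDef := by
  have hu : IsUnit (jacobian F) := (Matrix.isUnit_iff_isUnit_det _).2 hF.isUnit
  have := hA.conjTranspose_mul_mul_same (B := jacobian F) (Matrix.mulVec_injective_of_isUnit hu)
  rwa [Matrix.conjTranspose_eq_transpose_of_trivial] at this

theorem det_pullback (F : Space d →ᵃ[ℝ] Space d) (A : Mat d) :
    ((jacobian F).transpose * A * jacobian F).det = |(jacobian F).det| ^ 2 * A.det := by
  rw [Matrix.det_mul, Matrix.det_mul, Matrix.det_transpose, sq_abs]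
  ring

variable {V K : Finset (Space d)} {F : Space d →ᵃ[ℝ] Space d}

/-- The difference y - x is the image under F' of a vector of length at most D, and the spectrum of
the pulled-back matrix S is bounded by its trace. -/
theorem quad_sub_le {A : Mat d} (hA : A.PosDef) (hJ : (jacobian F).det ≠ 0)
    (hF : F '' simplex V = simplex K) {D : ℝ}
    (hD : ∀ p ∈ simplex V, ∀ q ∈ simplex V, ‖p - q‖ ≤ D) {x y : Space d} (hx : x ∈ simplex K)
    (hy : y ∈ simplex K) :
    quad A (y - x) ≤ ((jacobian F).transpose * A * jacobian F).trace * D ^ 2 := by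
  rw [← hF] at hx hy
  obtain ⟨p, hp, rfl⟩ := hx
  obtain ⟨q, hq, rfl⟩ := hy
  have h : F q - F p = F.linear (q - p) := by
    have := F.linearMap_vsub q p
    simpa using this.symm
  have hS := pullback_posDef hJ hA
  rw [h, ← quad_jacobian]
  refine (quad_le_trace hS.posSemidef _).trans ?_
  exact mul_le_mul_of_nonneg_left (pow_le_pow_left₀ (norm_nonneg _) (hD q hq p hp) 2)
    hS.posSemidef.trace_nonneg

/-- Testing with the ξ for which F'ξ = ζ gives ‖ζ‖² ≤ m‖ξ‖, while the spectral lower bound for S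
gives det S ‖ξ‖² ≤ (tr S)^{d-1} ζᵀAζ. Eliminating ‖ξ‖ bounds the Euclidean norm of ζ without any
condition on the shape of the element. -/
theorem det_mul_norm_sq_le {A : Mat d} (hA : A.PosDef) (hJ : (jacobian F).det ≠ 0)
    {ζ : Space d} {m : ℝ}
    (h : ∀ ξ, inner ℝ ζ (F.linear ξ) ≤ m * ‖ξ‖) :
    ((jacobian F).transpose * A * jacobian F).det * ‖ζ‖ ^ 2 ≤
      norm2 A * ((jacobian F).transpose * A * jacobian F).trace ^ (d - 1) * m ^ 2 := by
  have hS := pullback_posDef hJ hA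
  set S := (jacobian F).transpose * A * jacobian F with hSdef
  have htr : 0 ≤ S.trace ^ (d - 1) := pow_nonneg hS.posSemidef.trace_nonneg _
  have hR : 0 ≤ norm2 A * S.trace ^ (d - 1) * m ^ 2 :=
    mul_nonneg (mul_nonneg (norm2_nonneg A) htr) (sq_nonneg m)
  rcases eq_or_ne ζ 0 with rfl | hζ
  · simpa using hR
  have hsurj : Function.Surjective F.linear := by
    rw [det_jacobian] at hJ
    exact (LinearMap.equivOfDetNeZero F.linear hJ).surjective
  obtain ⟨ξ, hξ⟩ := hsurj ζ
  have h1 := h ξ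
  rw [hξ, real_inner_self_eq_norm_sq] at h1
  have h2 := det_mul_sq_le_trace_pow_mul_quad hS ξ
  rw [quad_jacobian, hξ] at h2
  have h3 := mul_le_mul_of_nonneg_left (quad_le_norm2 A ζ) htr
  have hn : 0 < ‖ζ‖ := norm_pos_iff.2 hζ
  have h4 : (‖ζ‖ ^ 2) ^ 2 ≤ (m * ‖ξ‖) ^ 2 := pow_le_pow_left₀ (sq_nonneg _) h1 2
  have h5 : S.det * (‖ζ‖ ^ 2) ^ 2 ≤ S.det * (m * ‖ξ‖) ^ 2 :=
    mul_le_mul_of_nonneg_left h4 hS.det_pos.le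
  have h6 : m ^ 2 * (S.det * ‖ξ‖ ^ 2) ≤ m ^ 2 * (S.trace ^ (d - 1) * (norm2 A * ‖ζ‖ ^ 2)) :=
    mul_le_mul_of_nonneg_left (h2.trans h3) (sq_nonneg m)
  have h7 : (S.det * ‖ζ‖ ^ 2) * ‖ζ‖ ^ 2 ≤
      (norm2 A * S.trace ^ (d - 1) * m ^ 2) * ‖ζ‖ ^ 2 := by linarith
  exact le_of_mul_le_mul_right h7 (by positivity)

/-- Bounds for the error of linear interpolation at a point where a second order Taylor
inequality holds. -/
theorem abs_interpolant_sub_le {A : Mat d} (hA : A.PosDef) (hJ : (jacobian F).det ≠ 0)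
    (hF : F '' simplex V = simplex K) {D : ℝ}
    (hD : ∀ p ∈ simplex V, ∀ q ∈ simplex V, ‖p - q‖ ≤ D) {u : Space d → ℝ} {g x : Space d}
    {c : ℝ} (hc : 0 ≤ c) (hx : x ∈ simplex K)
    (hT : ∀ y ∈ simplex K, |u y - u x - inner ℝ g (y - x)| ≤ c * quad A (y - x) / 2)
    {ℓ : Space d →ᵃ[ℝ] ℝ} (hℓ : ∀ p ∈ K, ℓ p = u p) {y : Space d} (hy : y ∈ simplex K) :
    |ℓ y - u x - inner ℝ g (y - x)| ≤
      c * (((jacobian F).transpose * A * jacobian F).trace * D ^ 2) / 2 := by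
  -- The interpolant minus the first order Taylor polynomial of u at x. It is affine, so it suffices
  -- to bound it at the vertices, where ℓ equals u.
  let E : Space d →ᵃ[ℝ] ℝ := ℓ - AffineMap.const ℝ (Space d) (u x - inner ℝ g x) -
    ((innerSL ℝ g : Space d →L[ℝ] ℝ) : Space d →ₗ[ℝ] ℝ).toAffineMap
  have hE : ∀ z, E z = ℓ z - u x - inner ℝ g (z - x) := by
    intro z
    simp only [E, AffineMap.coe_sub, Pi.sub_apply, AffineMap.const_apply,
      LinearMap.coe_toAffineMap, ContinuousLinearMap.coe_coe, innerSL_apply_apply, inner_sub_right]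
    ring
  rw [← hE]
  refine abs_affine_le_of_mem_simplex E (s := K) (fun p hp => ?_) hy
  rw [hE, hℓ p hp]
  refine (hT p (mem_simplex hp)).trans ?_
  have := mul_le_mul_of_nonneg_left (quad_sub_le hA hJ hF hD hx (mem_simplex hp)) hc
  linarith

/-- At the point x itself the Taylor polynomial equals u x, which gives the value error. For the
gradient, the same affine error is compared at F c₀ and at the image of a point of the sphere of
radius r about c₀; the two halves add up to the oscillation, and division by r gives the slope in
every direction. -/
theorem interpolation_error_le {A : Mat d} (hA : A.PosDef) (hJ : (jacobian F).det ≠ 0)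
    (hF : F '' simplex V = simplex K) {D r : ℝ} (hr : 0 < r) {c₀ : Space d}
    (hball : Metric.closedBall c₀ r ⊆ simplex V)
    (hD : ∀ p ∈ simplex V, ∀ q ∈ simplex V, ‖p - q‖ ≤ D) {u : Space d → ℝ} {g x : Space d}
    {c : ℝ} (hc : 0 ≤ c) (hx : x ∈ simplex K)
    (hT : ∀ y ∈ simplex K, |u y - u x - inner ℝ g (y - x)| ≤ c * quad A (y - x) / 2)
    {ℓ : Space d →ᵃ[ℝ] ℝ} (hℓ : ∀ p ∈ K, ℓ p = u p) :
    |ℓ x - u x| ≤ c * (((jacobian F).transpose * A * jacobian F).trace * D ^ 2) / 2 ∧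
    ((jacobian F).transpose * A * jacobian F).det * ‖g - affGrad ℓ‖ ^ 2 ≤
      norm2 A * ((jacobian F).transpose * A * jacobian F).trace ^ (d - 1) *
        (c * (((jacobian F).transpose * A * jacobian F).trace * D ^ 2) / r) ^ 2 := by
  have hbd := fun y hy => abs_interpolant_sub_le hA hJ hF hD hc hx hT hℓ (y := y) hy
  refine ⟨by simpa using hbd x hx, ?_⟩
  have hS := pullback_posDef hJ hA
  set S := (jacobian F).transpose * A * jacobian F with hSdef
  have htr := hS.posSemidef.trace_nonneg
  refine det_mul_norm_sq_le hA hJ fun ξ => ?_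
  rcases eq_or_ne ξ 0 with rfl | hξ
  · simp
  have hn : 0 < ‖ξ‖ := norm_pos_iff.2 hξ
  have hp : c₀ + (r / ‖ξ‖) • ξ ∈ simplex V := hball (by
    rw [mem_closedBall_iff_norm, add_sub_cancel_left, norm_smul, Real.norm_of_nonneg (by positivity),
      div_mul_cancel₀ _ hn.ne'])
  have hq : c₀ ∈ simplex V := hball (Metric.mem_closedBall_self hr.le)
  have b1 := abs_le.1 (hbd (F (c₀ + (r / ‖ξ‖) • ξ)) (hF ▸ Set.mem_image_of_mem F hp))
  have b2 := abs_le.1 (hbd (F c₀) (hF ▸ Set.mem_image_of_mem F hq))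
  have e1 : F (c₀ + (r / ‖ξ‖) • ξ) = F c₀ + (r / ‖ξ‖) • F.linear ξ := by
    have := F.map_vadd c₀ ((r / ‖ξ‖) • ξ)
    rw [vadd_eq_add, vadd_eq_add, map_smul, add_comm, add_comm _ (F c₀)] at this
    exact this
  have e2 : ℓ (F c₀ + (r / ‖ξ‖) • F.linear ξ) =
      ℓ (F c₀) + (r / ‖ξ‖) * inner ℝ (affGrad ℓ) (F.linear ξ) := by
    have := ℓ.map_vadd (F c₀) ((r / ‖ξ‖) • F.linear ξ)
    rw [vadd_eq_add, vadd_eq_add, map_smul, add_comm, add_comm _ (ℓ (F c₀)), smul_eq_mul] at this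
    rw [inner_affGrad]
    exact this
  rw [e1, e2, inner_sub_right, inner_add_right, inner_smul_right] at b1
  rw [inner_sub_right] at b2
  have b3 : (r / ‖ξ‖) * inner ℝ (g - affGrad ℓ) (F.linear ξ) ≤ c * (S.trace * D ^ 2) := by
    rw [inner_sub_left, mul_sub]
    linarith [b1.1, b1.2, b2.1, b2.2]
  rw [div_mul_eq_mul_div, div_le_iff₀ hn] at b3
  rw [div_mul_eq_mul_div, le_div_iff₀ hr]
  linarith

/-- The image of a vector of length r inside the reference simplex has length at most δ. This
inequality makes the value error, which is of higher order, comparable with the gradient error at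
the cost of the diameter of the domain. -/
theorem sq_mul_det_le {A : Mat d} (hd : 1 ≤ d) (hA : A.PosDef) (hJ : (jacobian F).det ≠ 0)
    (hF : F '' simplex V = simplex K) {r : ℝ} (hr : 0 < r) {c₀ : Space d}
    (hball : Metric.closedBall c₀ r ⊆ simplex V) {δ : ℝ}
    (hδ : ∀ p ∈ simplex K, ∀ q ∈ simplex K, ‖p - q‖ ≤ δ) :
    r ^ 2 * ((jacobian F).transpose * A * jacobian F).det ≤
      norm2 A * ((jacobian F).transpose * A * jacobian F).trace ^ (d - 1) * δ ^ 2 := by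
  have hS := pullback_posDef hJ hA
  set S := (jacobian F).transpose * A * jacobian F with hSdef
  have htr : 0 ≤ S.trace ^ (d - 1) := pow_nonneg hS.posSemidef.trace_nonneg _
  let ξ : Space d := r • EuclideanSpace.single (⟨0, hd⟩ : Fin d) 1
  have hξ : ‖ξ‖ = r := by simp [ξ, norm_smul, abs_of_pos hr]
  have hp : c₀ + ξ ∈ simplex V := hball (by
    rw [mem_closedBall_iff_norm, add_sub_cancel_left, hξ])
  have hq : c₀ ∈ simplex V := hball (Metric.mem_closedBall_self hr.le)
  have h1 := hδ _ (hF ▸ Set.mem_image_of_mem F hp) _ (hF ▸ Set.mem_image_of_mem F hq)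
  have e1 : F (c₀ + ξ) - F c₀ = F.linear ξ := by
    have := F.linearMap_vsub (c₀ + ξ) c₀
    simpa using this.symm
  rw [e1] at h1
  have h2 := det_mul_sq_le_trace_pow_mul_quad hS ξ
  rw [quad_jacobian, hξ] at h2
  have h3 := (quad_le_norm2 A (F.linear ξ)).trans (mul_le_mul_of_nonneg_left
    (pow_le_pow_left₀ (norm_nonneg _) h1 2) (norm2_nonneg A))
  have h4 := mul_le_mul_of_nonneg_left h3 htr
  linarith

theorem exists_reference_constants (hV : IsReferenceElement V) :
    ∃ (c₀ : Space d) (r D : ℝ), 0 < r ∧ 0 < D ∧ Metric.closedBall c₀ r ⊆ simplex V ∧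
      ∀ p ∈ simplex V, ∀ q ∈ simplex V, ‖p - q‖ ≤ D := by
  obtain ⟨c₀, hc₀⟩ := (interior_simplex_nonempty_iff hV.2.1).2 hV.1
  obtain ⟨r, hr, hball⟩ := Metric.nhds_basis_closedBall.mem_iff.1
    (mem_interior_iff_mem_nhds.1 hc₀)
  obtain ⟨D, hD⟩ := Metric.isBounded_iff.1 (isCompact_simplex V).isBounded
  refine ⟨c₀, r, max D 1, hr, by positivity, hball, fun p hp q hq => ?_⟩
  rw [← dist_eq_norm]
  exact (hD hp hq).trans (le_max_left _ _)

end LocalInterpolation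

end

end AnisoFEM

namespace AnisoFEM

noncomputable section

open Filter Topology ContinuousLinearMap
open scoped Convolution NNReal

/-! ### Approximation of finite element functions vanishing on the boundary by test functions -/

section Approximation

variable {d : ℕ}

/-- Bounded almost everywhere convergence of functions together with their gradients. -/
structure BddAETendsto (Ω : Set (Space d)) (φ : ℕ → Space d → ℝ) (Dφ : ℕ → Space d → Space d)
    (w : Space d → ℝ) (Dw : Space d → Space d) : Prop where
  bound : ∃ M, ∀ n, ∀ᵐ x ∂(volume.restrict Ω), |φ n x| ≤ M ∧ ‖Dφ n x‖ ≤ M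
  tendsto : ∀ᵐ x ∂(volume.restrict Ω), Tendsto (fun n => φ n x) atTop (𝓝 (w x)) ∧
    Tendsto (fun n => Dφ n x) atTop (𝓝 (Dw x))

theorem norm_gradient_le {W : Space d → ℝ} {M : ℝ≥0} (hW : LipschitzWith M W) (x : Space d) :
    ‖gradient W x‖ ≤ M := by
  rw [← (InnerProductSpace.toDual ℝ (Space d)).norm_map, toDual_gradient]
  exact norm_fderiv_le_of_lipschitz ℝ hW

theorem measurable_gradient (W : Space d → ℝ) : Measurable (gradient W) :=
  (InnerProductSpace.toDual ℝ (Space d)).symm.continuous.measurable.comp (measurable_fderiv ℝ W)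

theorem locallyIntegrable_gradient {W : Space d → ℝ} {M : ℝ≥0} (hW : LipschitzWith M W) :
    LocallyIntegrable (gradient W) volume := by
  refine (locallyIntegrable_const (M : ℝ)).mono (measurable_gradient W).aestronglyMeasurable ?_
  filter_upwards with x
  simpa using norm_gradient_le hW x

/-- By Rademacher's theorem the classical gradient exists almost everywhere, and Lipschitz functions
can be integrated by parts against a test function. -/
theorem hasWeakPartial_gradient {W : Space d → ℝ} {M : ℝ≥0} (hW : LipschitzWith M W)
    (i : Fin d) : HasWeakPartial Set.univ i W (fun x => gradient W x i) := by
  intro φ hφ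
  obtain ⟨D, hD⟩ := (hφ.1.of_le (by simp) : ContDiff ℝ 1 φ).lipschitzWith_of_hasCompactSupport
    hφ.2.1 one_ne_zero
  have h := LipschitzWith.integral_lineDeriv_mul_eq (μ := volume) hW hD hφ.2.1
    (EuclideanSpace.single i 1)
  rw [Measure.restrict_univ]
  have e1 : ∫ x, lineDeriv ℝ W x (EuclideanSpace.single i 1) * φ x =
      ∫ x, gradient W x i * φ x := by
    refine integral_congr_ae ?_
    filter_upwards [hW.ae_differentiableAt] with x hx
    rw [hx.lineDeriv_eq_fderiv, gradient_apply]
  have e2 : ∫ x, lineDeriv ℝ φ x (-EuclideanSpace.single i 1) * W x =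
      -∫ x, W x * gradient φ x i := by
    rw [← integral_neg]
    congr 1; ext x
    rw [(hφ.1.differentiable (by simp) x).lineDeriv_eq_fderiv, gradient_apply, map_neg]
    ring
  rw [e1, e2] at h
  linarith

theorem gradient_mollify {W : Space d → ℝ} {M : ℝ≥0} (hW : LipschitzWith M W)
    (hc : HasCompactSupport W) (η : ContDiffBump (0 : Space d)) (x : Space d) :
    gradient (mollify η W) x = mollify η (gradient W) x := by
  ext i
  have h := fderiv_mollify_single MeasurableSet.univ
    (hW.continuous.integrable_of_hasCompactSupport hc).integrableOn
    (hasWeakPartial_gradient hW i) η (x := x) (Set.subset_univ _)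
  rw [Set.indicator_univ, Set.indicator_univ, ← gradient_apply] at h
  rw [h, mollify, mollify, convolution_lsmul_swap, convolution_lsmul_swap]
  have hex := (η.hasCompactSupport_normed (μ := volume)).convolutionExists_left
    (lsmul ℝ ℝ : ℝ →L[ℝ] Space d →L[ℝ] Space d)
    η.continuous_normed (locallyIntegrable_gradient hW) x
  have := (EuclideanSpace.proj (𝕜 := ℝ) i).integral_comp_comm hex.integrable_swap
  simpa using this

/-- Mollification at radii below the distance from the support to the complement of Ω. The Lipschitz
constant bounds all gradients, and Lebesgue differentiation gives the convergence. -/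
theorem exists_testFunctions_tendsto {Ω : Set (Space d)} (hΩ : IsOpen Ω) {W : Space d → ℝ}
    {M : ℝ≥0} (hW : LipschitzWith M W) (hc : HasCompactSupport W) (hs : tsupport W ⊆ Ω) :
    ∃ φ : ℕ → Space d → ℝ, (∀ n, IsTestFunction Ω (φ n)) ∧
      BddAETendsto Ω φ (fun n => gradient (φ n)) W (gradient W) := by
  obtain ⟨ε, hε, hthick⟩ := hc.isCompact.exists_cthickening_subset_open hΩ hs
  obtain ⟨n₀, hn₀⟩ := eventually_atTop.1 ((tendsto_bumpSeq_rOut d).eventually (gt_mem_nhds hε))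
  have hli : LocallyIntegrable W volume := hW.continuous.locallyIntegrable
  obtain ⟨B, hB⟩ := hc.exists_bound_of_continuous hW.continuous
  refine ⟨fun n => mollify (bumpSeq d (n + n₀)) W, fun n => ?_, ?_, ?_⟩
  · have hsup : Function.support (mollify (bumpSeq d (n + n₀)) W) ⊆
        Metric.cthickening ε (tsupport W) := by
      intro x hx
      by_contra hxn
      apply hx
      have : ‖mollify (bumpSeq d (n + n₀)) W x‖ ≤ 0 := by
        refine norm_mollify_le _ (ae_of_all _ fun y hy => ?_)
        have hyn : y ∉ tsupport W := by
          intro hyt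
          apply hxn
          refine Metric.mem_cthickening_of_dist_le x y ε _ hyt ?_
          rw [dist_comm]
          exact (Metric.mem_ball.1 hy).le.trans (hn₀ (n + n₀) (by lia)).le
        rw [image_eq_zero_of_notMem_tsupport hyn, norm_zero]
      simpa using this
    have hclosed := Metric.isClosed_cthickening (δ := ε) (E := tsupport W)
    have hts : tsupport (mollify (bumpSeq d (n + n₀)) W) ⊆ Metric.cthickening ε (tsupport W) :=
      closure_minimal hsup hclosed
    refine ⟨?_, HasCompactSupport.of_support_subset_isCompact hc.isCompact.cthickening hsup,
      hts.trans hthick⟩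
    exact (ContDiffBump.hasCompactSupport_normed _).contDiff_convolution_left _
      ((bumpSeq d (n + n₀)).contDiff_normed (n := ⊤)) hli
  · refine ⟨max B M, fun n => ae_of_all _ fun x => ⟨?_, ?_⟩⟩
    · rw [← Real.norm_eq_abs]
      exact (norm_mollify_le _ (ae_of_all _ fun y _ => hB y)).trans (le_max_left _ _)
    · dsimp only
      rw [gradient_mollify hW hc]
      exact (norm_mollify_le _ (ae_of_all _ fun y _ => norm_gradient_le hW y)).trans
        (le_max_right _ _)
  · refine ae_restrict_of_ae ?_
    filter_upwards [ae_tendsto_mollify_bumpSeq hli,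
      ae_tendsto_mollify_bumpSeq (locallyIntegrable_gradient hW)] with x h1 h2
    refine ⟨h1.comp (tendsto_add_atTop_nat n₀), ?_⟩
    simp only [gradient_mollify hW hc]
    exact h2.comp (tendsto_add_atTop_nat n₀)

/-- A continuous function that is Lipschitz on each set of a finite closed cover is Lipschitz. -/
theorem lipschitzWith_of_finite_closed_cover {ι : Type*} [Finite ι] {f : Space d → ℝ}
    (hf : Continuous f) {C : ι → Set (Space d)} (hC : ∀ i, IsClosed (C i))
    (hcov : ∀ x, ∃ i, x ∈ C i) {M : ℝ≥0}
    (h : ∀ i, ∀ a ∈ C i, ∀ b ∈ C i, |f a - f b| ≤ M * ‖a - b‖) : LipschitzWith M f := by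
  have key : ∀ a b, f b ≤ f a + M * ‖b - a‖ := by
    intro a b
    have hline : Continuous fun t : ℝ => a + t • (b - a) := by fun_prop
    have := image_le_of_liminf_slope_right_le_deriv_boundary
      (f := fun t : ℝ => f (a + t • (b - a))) (a := 0) (b := 1)
      (B := fun t => f a + M * ‖b - a‖ * t) (B' := fun _ => M * ‖b - a‖)
      (hf.comp hline).continuousOn (by simp) (by fun_prop)
      (fun t _ => by
        simpa using (((hasDerivAt_id t).const_mul (M * ‖b - a‖)).const_add (f a)).hasDerivWithinAt)
      (fun t _ r hr => by
        -- Finitely many sets cover the segment, so one of them is met for parameters arbitrarily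
        -- close to t from the right; being closed, it also contains the point at t. This bounds the
        -- lower right slope at t by the Lipschitz constant.
        have hfr : ∃ i, ∃ᶠ z in 𝓝[>] t, a + z • (b - a) ∈ C i := by
          by_contra hcon
          push Not at hcon
          have := eventually_all.2 hcon
          obtain ⟨z, hz⟩ := this.exists
          obtain ⟨i, hi⟩ := hcov (a + z • (b - a))
          exact hz i hi
        obtain ⟨i, hi⟩ := hfr
        have hti : a + t • (b - a) ∈ C i := by
          refine (hC i).mem_of_frequently_of_tendsto hi ?_
          exact (hline.tendsto t).mono_left nhdsWithin_le_nhds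
        refine (hi.and_eventually self_mem_nhdsWithin).mono ?_
        rintro z ⟨hz, hzt : t < z⟩
        refine lt_of_le_of_lt ?_ hr
        have hpos : 0 < z - t := sub_pos.2 hzt
        rw [slope_def_field, div_le_iff₀ hpos]
        refine (le_abs_self _).trans ((h i _ hz _ hti).trans_eq ?_)
        have e : a + z • (b - a) - (a + t • (b - a)) = (z - t) • (b - a) := by
          rw [sub_smul]; abel
        rw [e, norm_smul, Real.norm_of_nonneg hpos.le]
        ring)
      (Set.right_mem_Icc.2 zero_le_one)
    simpa using this
  refine LipschitzWith.of_dist_le_mul fun a b => ?_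
  rw [Real.dist_eq, dist_eq_norm, abs_le]
  have h1 := key a b
  have h2 := key b a
  rw [norm_sub_rev b a] at h1
  exact ⟨by linarith, by linarith⟩

theorem volume_affine_zero {ℓ : Space d →ᵃ[ℝ] ℝ} (h : affGrad ℓ ≠ 0) :
    volume {x | ℓ x = 0} = 0 := by
  let s : AffineSubspace ℝ (Space d) := (AffineSubspace.mk' (0 : ℝ) ⊥).comap ℓ
  have hs : (s : Set (Space d)) = {x | ℓ x = 0} := by
    ext x
    simp [s, AffineSubspace.mem_mk']
  rw [← hs]
  refine Measure.addHaar_affineSubspace volume s fun htop => h ?_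
  have hz : ∀ x, ℓ x = 0 := fun x => by
    have : x ∈ (s : Set (Space d)) := by rw [htop]; trivial
    rwa [hs] at this
  refine ext_inner_right ℝ fun ξ => ?_
  rw [inner_affGrad, inner_zero_left]
  have := ℓ.linearMap_vsub ξ 0
  simpa [hz] using this

theorem affine_eq_const {ℓ : Space d →ᵃ[ℝ] ℝ} (h : affGrad ℓ = 0) (x y : Space d) :
    ℓ y = ℓ x := by
  have h1 := ℓ.linearMap_vsub y x
  rw [← inner_affGrad, h, inner_zero_left] at h1
  simp only [vsub_eq_sub] at h1
  linarith

theorem abs_affine_sub_le (ℓ : Space d →ᵃ[ℝ] ℝ) (x y : Space d) :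
    |ℓ x - ℓ y| ≤ ‖affGrad ℓ‖ * ‖x - y‖ := by
  have h1 := ℓ.linearMap_vsub x y
  rw [← inner_affGrad] at h1
  simp only [vsub_eq_sub] at h1
  rw [← h1]
  exact abs_real_inner_le_norm _ _

/-- Soft thresholding. -/
def softThreshold (ε s : ℝ) : ℝ := s - max (-ε) (min ε s)

theorem lipschitzWith_softThreshold (ε : ℝ) : LipschitzWith 2 (softThreshold ε) := by
  have h := LipschitzWith.id.sub ((LipschitzWith.id (α := ℝ)).const_min ε |>.const_max (-ε))
  have e : (1 : ℝ≥0) + 1 = 2 := by norm_num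
  rw [e] at h
  exact h

theorem softThreshold_of_abs_le {ε s : ℝ} (h : |s| ≤ ε) : softThreshold ε s = 0 := by
  obtain ⟨h1, h2⟩ := abs_le.1 h
  rw [softThreshold, min_eq_right h2, max_eq_right h1, sub_self]

theorem softThreshold_of_le {ε s : ℝ} (hε : 0 ≤ ε) (h : ε ≤ s) : softThreshold ε s = s - ε := by
  rw [softThreshold, min_eq_left h, max_eq_right (by linarith)]

theorem softThreshold_of_le_neg {ε s : ℝ} (hε : 0 ≤ ε) (h : s ≤ -ε) :
    softThreshold ε s = s + ε := by
  rw [softThreshold, min_eq_right (by linarith), max_eq_left h, sub_neg_eq_add]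

theorem abs_softThreshold_sub_le {ε : ℝ} (hε : 0 ≤ ε) (s : ℝ) : |softThreshold ε s - s| ≤ ε := by
  rw [softThreshold, sub_sub_cancel_left, abs_neg, abs_le]
  exact ⟨le_max_left _ _, max_le (by linarith) (min_le_left _ _)⟩

variable {Ω : Set (Space d)} {T : Mesh Ω}

/-- The extension by zero is continuous because w vanishes on ∂Ω, and it is Lipschitz on each
simplex and on the complement of Ω, which together form a finite closed cover. -/
theorem Mesh.IsFEFunction.exists_lipschitz_indicator (hΩ : IsOpen Ω) {w : Space d → ℝ}
    (hw : T.IsFEFunction w) (h0 : ∀ x ∈ frontier Ω, w x = 0) :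
    ∃ M : ℝ≥0, LipschitzWith M (Ω.indicator w) := by
  classical
  have hcont : Continuous (Ω.indicator w) := continuous_indicator h0 hw.1
  choose! ℓ hℓ using hw.2
  let M : ℝ≥0 := ∑ K ∈ T.elements, ‖affGrad (ℓ K)‖₊
  have hind : ∀ x ∈ closure Ω, Ω.indicator w x = w x := by
    intro x hx
    by_cases hxΩ : x ∈ Ω
    · simp [hxΩ]
    · rw [Set.indicator_of_notMem hxΩ, h0 x (by rw [hΩ.frontier_eq]; exact ⟨hx, hxΩ⟩)]
  refine ⟨M, lipschitzWith_of_finite_closed_cover hcont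
    (C := fun o : Option T.elements => o.elim Ωᶜ fun K => simplex (K : Finset (Space d))) ?_ ?_ ?_⟩
  · rintro (_ | K)
    · exact hΩ.isClosed_compl
    · exact isClosed_simplex _
  · intro x
    by_cases hx : x ∈ Ω
    · obtain ⟨K, hK, hxK⟩ := T.exists_mem_simplex (subset_closure hx)
      exact ⟨some ⟨K, hK⟩, hxK⟩
    · exact ⟨none, hx⟩
  · rintro (_ | ⟨K, hK⟩) a ha b hb
    · have ha' : a ∉ Ω := ha
      have hb' : b ∉ Ω := hb
      simp only [Set.indicator_of_notMem ha', Set.indicator_of_notMem hb', sub_self, abs_zero]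
      positivity
    · have ha' : a ∈ simplex K := ha
      have hb' : b ∈ simplex K := hb
      rw [hind a (Mesh.simplex_subset hK ha'), hind b (Mesh.simplex_subset hK hb'),
        hℓ K hK ha', hℓ K hK hb']
      refine (abs_affine_sub_le (ℓ K) a b).trans ?_
      refine mul_le_mul_of_nonneg_right ?_ (norm_nonneg _)
      have : ‖affGrad (ℓ K)‖₊ ≤ M :=
        Finset.single_le_sum (f := fun K => ‖affGrad (ℓ K)‖₊) (fun _ _ => zero_le) hK
      exact_mod_cast this

/-- Soft thresholding at level ε cuts the extension by zero down to the set where |w| ≥ ε, a closed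
set inside Ω, while at most doubling the Lipschitz bound. No regularity of ∂Ω enters. -/
theorem Mesh.IsFEFunction.exists_compactSupport_tendsto (hΩ : IsOpen Ω) {w : Space d → ℝ}
    (hw : T.IsFEFunction w) (h0 : ∀ x ∈ frontier Ω, w x = 0) :
    ∃ W : ℕ → Space d → ℝ, (∀ n, (∃ M : ℝ≥0, LipschitzWith M (W n)) ∧ HasCompactSupport (W n) ∧
      tsupport (W n) ⊆ Ω) ∧
      BddAETendsto Ω W (fun n => gradient (W n)) w (gradient w) := by
  obtain ⟨M, hM⟩ := hw.exists_lipschitz_indicator hΩ h0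
  set V := Ω.indicator w with hV
  have hcV : Continuous V := hM.continuous
  let ε : ℕ → ℝ := fun n => 1 / ((n : ℝ) + 1)
  have hε : ∀ n, 0 < ε n := fun n => by positivity
  have hεt : Tendsto ε atTop (𝓝 0) := tendsto_one_div_add_atTop_nhds_zero_nat
  have hlip : ∀ n, LipschitzWith (2 * M) (fun x => softThreshold (ε n) (V x)) := fun n =>
    (lipschitzWith_softThreshold (ε n)).comp hM
  have hsub : ∀ n, tsupport (fun x => softThreshold (ε n) (V x)) ⊆ Ω := by
    intro n
    have h1 : tsupport (fun x => softThreshold (ε n) (V x)) ⊆ {x | ε n ≤ |V x|} := by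
      refine closure_minimal (fun x hx => ?_) (isClosed_le continuous_const hcV.abs)
      by_contra hlt
      exact hx (softThreshold_of_abs_le (not_le.1 hlt).le)
    intro x hx
    have h2 := h1 hx
    by_contra hxΩ
    have h3 : ε n ≤ |V x| := h2
    rw [hV, Set.indicator_of_notMem hxΩ, abs_zero] at h3
    linarith [hε n]
  have hcomp : ∀ n, HasCompactSupport (fun x => softThreshold (ε n) (V x)) := fun n =>
    HasCompactSupport.of_support_subset_isCompact T.isCompact_closure
      ((subset_closure.trans (hsub n)).trans subset_closure)
  refine ⟨fun n x => softThreshold (ε n) (V x), fun n => ⟨⟨_, hlip n⟩, hcomp n, hsub n⟩, ?_, ?_⟩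
  · have hcs : HasCompactSupport V := HasCompactSupport.of_support_subset_isCompact
      T.isCompact_closure (Set.support_indicator_subset.trans subset_closure)
    obtain ⟨B, hB⟩ := hcs.exists_bound_of_continuous hcV
    refine ⟨max (B + 1) (2 * M), fun n => ae_of_all _ fun x => ⟨?_, ?_⟩⟩
    · refine le_trans ?_ (le_max_left _ _)
      have h1 := abs_softThreshold_sub_le (hε n).le (V x)
      have h2 := hB x
      rw [Real.norm_eq_abs] at h2
      have h3 : ε n ≤ 1 := by
        have : (1 : ℝ) ≤ (n : ℝ) + 1 := by linarith [n.cast_nonneg (α := ℝ)]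
        exact div_le_one_of_le₀ this (by positivity)
      have := abs_add_le (softThreshold (ε n) (V x) - V x) (V x)
      rw [sub_add_cancel] at this
      linarith
    · refine le_trans ?_ (le_max_right _ _)
      have := norm_gradient_le (hlip n) x
      exact_mod_cast this
  · choose! ℓ hℓ using hw.2
    -- Gradients could fail to converge only on zero sets of nonconstant affine pieces, which are
    -- null hyperplanes.
    have hnull : ∀ᵐ x ∂(volume.restrict Ω), ∀ K ∈ T.elements, affGrad (ℓ K) ≠ 0 → ℓ K x ≠ 0 := by
      refine (Finset.eventually_all T.elements).2 fun K _ => ?_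
      by_cases hg : affGrad (ℓ K) = 0
      · exact ae_of_all _ fun x h => absurd hg h
      · have := measure_eq_zero_iff_ae_notMem.1 (volume_affine_zero hg)
        filter_upwards [ae_restrict_of_ae this] with x hx _ using hx
    filter_upwards [hnull, T.ae_mem_interior hΩ] with x hx ⟨K, hK, hxK⟩
    have hgw : gradient w x = affGrad (ℓ K) := (hasGradientAt_of_eqOn (hℓ K hK) hxK).gradient
    have hVK : ∀ᶠ y in 𝓝 x, V y = ℓ K y := by
      filter_upwards [isOpen_interior.mem_nhds hxK] with y hy
      rw [hV, Set.indicator_of_mem (Mesh.interior_subset hΩ hK hy), hℓ K hK (_root_.interior_subset hy)]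
    have hVx : V x = w x := Set.indicator_of_mem (Mesh.interior_subset hΩ hK hxK) w
    constructor
    · rw [← hVx]
      refine tendsto_iff_dist_tendsto_zero.2 (squeeze_zero (fun _ => dist_nonneg) (fun n => ?_) hεt)
      exact abs_softThreshold_sub_le (hε n).le (V x)
    · rw [hgw]
      refine tendsto_const_nhds.congr' ?_
      have hgℓ : HasGradientAt (ℓ K) (affGrad (ℓ K)) x :=
        hasGradientAt_of_eqOn (fun _ _ => rfl) hxK
      -- If the piece vanishes at x it vanishes identically, and so does its threshold near x. If
      -- not, then for small ε the threshold near x is the piece shifted by the constant ±ε, with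
      -- the same gradient.
      by_cases hz : ℓ K x = 0
      · have hg0 : affGrad (ℓ K) = 0 := by
          by_contra hne
          exact hx K hK hne hz
        filter_upwards with n
        have : HasGradientAt (fun x => softThreshold (ε n) (V x)) (affGrad (ℓ K)) x := by
          refine hgℓ.congr_of_eventuallyEq ?_
          filter_upwards [hVK] with y hy
          have hy0 : ℓ K y = 0 := (affine_eq_const hg0 x y).trans hz
          rw [hy, hy0, softThreshold_of_abs_le (by simpa using (hε n).le)]
        exact this.gradient.symm
      · have hcℓ : Continuous (ℓ K) := (ℓ K).continuous_of_finiteDimensional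
        rcases lt_or_gt_of_ne hz with hneg | hpos
        · filter_upwards [hεt.eventually (gt_mem_nhds (show (0 : ℝ) < -ℓ K x by linarith))] with n hn
          have : HasGradientAt (fun x => softThreshold (ε n) (V x)) (affGrad (ℓ K)) x := by
            have h1 : HasGradientAt (fun y => ℓ K y + ε n) (affGrad (ℓ K)) x := by
              rw [hasGradientAt_iff_hasFDerivAt] at hgℓ ⊢
              exact hgℓ.add_const _
            refine h1.congr_of_eventuallyEq ?_
            filter_upwards [hVK, hcℓ.continuousAt.eventually (gt_mem_nhds
              (show ℓ K x < -ε n by linarith))] with y hy hy2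
            rw [hy, softThreshold_of_le_neg (hε n).le hy2.le]
          exact this.gradient.symm
        · filter_upwards [hεt.eventually (gt_mem_nhds hpos)] with n hn
          have : HasGradientAt (fun x => softThreshold (ε n) (V x)) (affGrad (ℓ K)) x := by
            have h1 : HasGradientAt (fun y => ℓ K y - ε n) (affGrad (ℓ K)) x := by
              rw [hasGradientAt_iff_hasFDerivAt] at hgℓ ⊢
              exact hgℓ.sub_const _
            refine h1.congr_of_eventuallyEq ?_
            filter_upwards [hVK, hcℓ.continuousAt.eventually (lt_mem_nhds
              (show ε n < ℓ K x from hn))] with y hy hy2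
            rw [hy, softThreshold_of_le (hε n).le hy2.le]
          exact this.gradient.symm

end Approximation

end

end AnisoFEM

namespace AnisoFEM

noncomputable section

open Filter Topology
open scoped NNReal

/-! ### Poincaré's inequality and quasi-optimality of the finite element solution -/

section Cea

variable {d : ℕ}

/-- Integrating by parts against the coordinate x_i gives ∫ φ² = -∫ 2 x_i φ ∂_iφ ≤ ½ ∫ φ² + 2R² ∫
‖∇φ‖²; absorbing the first term yields the factor 4R². -/
theorem IsTestFunction.integral_sq_le {Ω : Set (Space d)} (hd : 1 ≤ d) {R : ℝ} (hR : ∀ x ∈ Ω, ‖x‖ ≤ R) {φ : Space d → ℝ}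
    (hφ : IsTestFunction Ω φ) :
    ∫ x in Ω, φ x ^ 2 ≤ 4 * R ^ 2 * ∫ x in Ω, ‖gradient φ x‖ ^ 2 := by
  let i : Fin d := ⟨0, hd⟩
  let e : Space d := EuclideanSpace.single i 1
  have hdiff : Differentiable ℝ φ := hφ.1.differentiable (by simp)
  have hcg : Continuous (gradient φ) :=
    (InnerProductSpace.toDual ℝ (Space d)).symm.continuous.comp (hφ.1.continuous_fderiv (by simp))
  have hcf : Continuous (fun x => fderiv ℝ φ x e) :=
    (hφ.1.continuous_fderiv (by simp)).clm_apply continuous_const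
  have hz : ∀ x, x ∉ Ω → φ x = 0 := fun x hx =>
    image_eq_zero_of_notMem_tsupport fun h => hx (hφ.2.2 h)
  have hgz : ∀ x, x ∉ tsupport φ → gradient φ x = 0 := by
    intro x hx
    have : fderiv ℝ φ x = 0 := image_eq_zero_of_notMem_tsupport fun h =>
      hx (tsupport_fderiv_subset ℝ h)
    rw [gradient, this, map_zero]
  have hcgs : HasCompactSupport (gradient φ) := HasCompactSupport.intro hφ.2.1 hgz
  have hproj : Differentiable ℝ (fun x : Space d => x i) :=
    (EuclideanSpace.proj (𝕜 := ℝ) i).differentiable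
  have hprojd : ∀ x : Space d, fderiv ℝ (fun x : Space d => x i) x e = 1 := by
    intro x
    have : fderiv ℝ (fun x : Space d => x i) x = EuclideanSpace.proj (𝕜 := ℝ) i :=
      (EuclideanSpace.proj (𝕜 := ℝ) i).fderiv
    rw [this]
    simp [e]
  have hsqd : ∀ x, fderiv ℝ (fun x => φ x ^ 2) x e = 2 * φ x * fderiv ℝ φ x e := by
    intro x
    have := ((hdiff x).hasFDerivAt.pow 2).fderiv
    rw [this]
    simp
  have hsqc : HasCompactSupport (fun x => φ x ^ 2) := HasCompactSupport.intro hφ.2.1 fun x hx => by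
    simp [image_eq_zero_of_notMem_tsupport hx]
  have hiq : Integrable (fun x => φ x ^ 2) :=
    (hφ.1.continuous.pow 2).integrable_of_hasCompactSupport hsqc
  have hcp : Continuous (fun x : Space d => x i) := hproj.continuous
  have h1 : Integrable (fun x : Space d => x i * (2 * φ x * fderiv ℝ φ x e)) := by
    refine Continuous.integrable_of_hasCompactSupport (by
      have := hφ.1.continuous
      fun_prop) (HasCompactSupport.intro hφ.2.1 fun x hx => ?_)
    simp [image_eq_zero_of_notMem_tsupport hx]
  have h2 : Integrable (fun x : Space d => x i * φ x ^ 2) :=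
    Continuous.integrable_of_hasCompactSupport (hcp.mul (hφ.1.continuous.pow 2)) (HasCompactSupport.intro hφ.2.1
      fun x hx => by simp [image_eq_zero_of_notMem_tsupport hx])
  have hibp := integral_mul_fderiv_eq_neg_fderiv_mul_of_integrable (μ := volume)
    (f := fun x : Space d => x i) (g := fun x => φ x ^ 2) (v := e)
    (by simpa only [hprojd, one_mul] using hiq) (by simpa only [hsqd] using h1) h2
    (fun x _ => hproj x) (fun x _ => (hdiff x).pow 2)
  simp only [hprojd, one_mul, hsqd] at hibp
  have hig : Integrable (fun x => ‖gradient φ x‖ ^ 2) :=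
    (hcg.norm.pow 2).integrable_of_hasCompactSupport (HasCompactSupport.intro hφ.2.1 fun x hx => by
      simp [hgz x hx])
  have e1 : ∫ x in Ω, φ x ^ 2 = ∫ x, φ x ^ 2 := setIntegral_eq_integral_of_forall_compl_eq_zero
    fun x hx => by simp [hz x hx]
  have e2 : ∫ x in Ω, ‖gradient φ x‖ ^ 2 = ∫ x, ‖gradient φ x‖ ^ 2 :=
    setIntegral_eq_integral_of_forall_compl_eq_zero fun x hx => by
      simp [hgz x fun h => hx (hφ.2.2 h)]
  rw [e1, e2]
  have hle : ∫ x, -(x i * (2 * φ x * fderiv ℝ φ x e)) ≤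
      ∫ x, (1 / 2 * φ x ^ 2 + 2 * R ^ 2 * ‖gradient φ x‖ ^ 2) := by
    refine integral_mono h1.neg ((hiq.const_mul _).add (hig.const_mul _)) fun x => ?_
    dsimp only
    by_cases hx : x ∈ Ω
    · have b1 : |x i| ≤ R := (PiLp.norm_apply_le x i).trans (hR x hx)
      have b2 : |fderiv ℝ φ x e| ≤ ‖gradient φ x‖ := by
        have := PiLp.norm_apply_le (gradient φ x) i
        rwa [gradient_apply] at this
      have b3 : |x i * fderiv ℝ φ x e| ≤ R * ‖gradient φ x‖ := by
        rw [abs_mul]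
        exact mul_le_mul b1 b2 (abs_nonneg _) ((abs_nonneg _).trans b1)
      have b4 : (x i * fderiv ℝ φ x e) ^ 2 ≤ (R * ‖gradient φ x‖) ^ 2 := by
        rw [← sq_abs]
        exact pow_le_pow_left₀ (abs_nonneg _) b3 2
      nlinarith [sq_nonneg (φ x + 2 * (x i * fderiv ℝ φ x e))]
    · rw [hz x hx]
      have : 0 ≤ 2 * R ^ 2 * ‖gradient φ x‖ ^ 2 := by positivity
      simp only [mul_zero, zero_mul, neg_zero, ne_eq, OfNat.ofNat_ne_zero, not_false_eq_true,
        zero_pow, zero_add]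
      exact this
  rw [integral_neg, integral_add (hiq.const_mul _) (hig.const_mul _), integral_const_mul,
    integral_const_mul] at hle
  linarith

/-- A square integrable function together with a square integrable vector field. -/
structure IsL2Pair (Ω : Set (Space d)) (w : Space d → ℝ) (Dw : Space d → Space d) : Prop where
  meas : AEStronglyMeasurable w (volume.restrict Ω)
  measD : AEStronglyMeasurable Dw (volume.restrict Ω)
  int : Integrable (fun x => w x ^ 2) (volume.restrict Ω)
  intD : Integrable (fun x => ‖Dw x‖ ^ 2) (volume.restrict Ω)

theorem IsL2Pair.of_memLp {Ω : Set (Space d)} {w : Space d → ℝ} {Dw : Space d → Space d}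
    (h : MemLp w 2 (volume.restrict Ω)) (hD : MemLp Dw 2 (volume.restrict Ω)) :
    IsL2Pair Ω w Dw :=
  ⟨h.1, hD.1, h.integrable_sq, hD.norm.integrable_sq⟩

theorem IsL2Pair.memLp {Ω : Set (Space d)} {w : Space d → ℝ} {Dw : Space d → Space d}
    (h : IsL2Pair Ω w Dw) :
    MemLp w 2 (volume.restrict Ω) ∧ MemLp Dw 2 (volume.restrict Ω) :=
  ⟨(memLp_two_iff_integrable_sq h.meas).2 h.int,
    (memLp_two_iff_integrable_sq_norm h.measD).2 h.intD⟩

theorem IsL2Pair.sub {Ω : Set (Space d)} {w w' : Space d → ℝ} {Dw Dw' : Space d → Space d}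
    (h : IsL2Pair Ω w Dw) (h' : IsL2Pair Ω w' Dw') : IsL2Pair Ω (w - w') (Dw - Dw') :=
  .of_memLp (h.memLp.1.sub h'.memLp.1) (h.memLp.2.sub h'.memLp.2)

theorem IsL2Pair.of_bounded {Ω : Set (Space d)} (hΩ : volume Ω < ⊤) {w : Space d → ℝ}
    {Dw : Space d → Space d} (h : AEStronglyMeasurable w (volume.restrict Ω))
    (hD : AEStronglyMeasurable Dw (volume.restrict Ω)) {M : ℝ}
    (hM : ∀ᵐ x ∂(volume.restrict Ω), |w x| ≤ M ∧ ‖Dw x‖ ≤ M) : IsL2Pair Ω w Dw := by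
  have : IsFiniteMeasure (volume.restrict Ω) := ⟨by simpa using hΩ⟩
  exact .of_memLp (MemLp.of_bound h M (hM.mono fun x hx => hx.1))
    (MemLp.of_bound hD M (hM.mono fun x hx => hx.2))

theorem IsH2.isL2Pair {Ω : Set (Space d)} {u : Space d → ℝ} {Du : Space d → Space d}
    {H : Space d → Mat d} (hu : IsH2 Ω u Du H) : IsL2Pair Ω u Du :=
  .of_memLp hu.memLp (MemLp.of_eval_piLp hu.memLp_grad)

/-- The integrand of the bilinear form. -/
def Coeffs.integrand (L : Coeffs d) (w : Space d → ℝ) (Dw : Space d → Space d) (v : Space d → ℝ)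
    (Dv : Space d → Space d) (x : Space d) : ℝ :=
  inner ℝ (Matrix.toEuclideanLin (L.a x) (Dw x)) (Dv x)
    + inner ℝ (L.b x) (Dw x) * v x + L.c x * w x * v x

theorem inner_toEuclideanLin (A : Mat d) (ξ ζ : Space d) :
    inner ℝ (Matrix.toEuclideanLin A ξ) ζ = ∑ i, ∑ j, A i j * ξ j * ζ i := by
  rw [PiLp.inner_apply]
  refine Finset.sum_congr rfl fun i _ => ?_
  have e : inner ℝ (Matrix.toEuclideanLin A ξ i) (ζ i) = (∑ j, A i j * ξ j) * ζ i := by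
    simp [Matrix.mulVec, dotProduct, mul_comm (ζ i)]
  rw [e, Finset.sum_mul]

theorem abs_apply_le_norm (ξ : Space d) (i : Fin d) : |ξ i| ≤ ‖ξ‖ := PiLp.norm_apply_le ξ i

theorem Coeffs.IsElliptic.exists_bound {L : Coeffs d} {Ω : Set (Space d)} (hL : L.IsElliptic Ω) :
    ∃ Λ : ℝ, 0 ≤ Λ ∧ ∀ᵐ x ∂(volume.restrict Ω),
      (∀ ξ ζ : Space d, |inner ℝ (Matrix.toEuclideanLin (L.a x) ξ) ζ| ≤ Λ * ‖ξ‖ * ‖ζ‖) ∧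
      (∀ ξ : Space d, |inner ℝ (L.b x) ξ| ≤ Λ * ‖ξ‖) ∧ |L.c x| ≤ Λ := by
  have hbd : ∀ {g : Space d → ℝ}, MemLp g ⊤ (volume.restrict Ω) →
      ∃ m : ℝ, 0 ≤ m ∧ ∀ᵐ x ∂(volume.restrict Ω), |g x| ≤ m := by
    intro g hg
    refine ⟨(eLpNormEssSup g (volume.restrict Ω)).toReal, ENNReal.toReal_nonneg, ?_⟩
    have hfin : eLpNormEssSup g (volume.restrict Ω) ≠ ⊤ := by
      have := hg.2
      rw [eLpNorm_exponent_top] at this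
      exact this.ne
    filter_upwards [ae_le_eLpNormEssSup (f := g) (μ := volume.restrict Ω)] with x hx
    have := ENNReal.toReal_mono hfin hx
    simpa using this
  choose ma hma0 hma using fun i j => hbd (hL.bdd_a i j)
  choose mb hmb0 hmb using fun i => hbd (hL.bdd_b i)
  obtain ⟨mc, hmc0, hmc⟩ := hbd hL.bdd_c
  have hsa : 0 ≤ ∑ i, ∑ j, ma i j := Finset.sum_nonneg fun i _ => Finset.sum_nonneg fun j _ => hma0 i j
  have hsb : 0 ≤ ∑ i, mb i := Finset.sum_nonneg fun i _ => hmb0 i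
  refine ⟨∑ i, ∑ j, ma i j + ∑ i, mb i + mc, by positivity, ?_⟩
  have hma' := ae_all_iff.2 fun i => ae_all_iff.2 fun j => hma i j
  have hmb' := ae_all_iff.2 hmb
  filter_upwards [hma', hmb', hmc] with x ha hb hc
  refine ⟨fun ξ ζ => ?_, fun ξ => ?_, by linarith⟩
  · have h1 : |inner ℝ (Matrix.toEuclideanLin (L.a x) ξ) ζ| ≤ (∑ i, ∑ j, ma i j) * (‖ξ‖ * ‖ζ‖) := by
      rw [inner_toEuclideanLin, Finset.sum_mul]
      refine (Finset.abs_sum_le_sum_abs _ _).trans (Finset.sum_le_sum fun i _ => ?_)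
      rw [Finset.sum_mul]
      refine (Finset.abs_sum_le_sum_abs _ _).trans (Finset.sum_le_sum fun j _ => ?_)
      rw [abs_mul, abs_mul, mul_assoc]
      exact mul_le_mul (ha i j) (mul_le_mul (abs_apply_le_norm ξ j) (abs_apply_le_norm ζ i)
        (abs_nonneg _) (norm_nonneg _)) (by positivity) (hma0 i j)
    have h2 : 0 ≤ (∑ i, mb i + mc) * (‖ξ‖ * ‖ζ‖) := by positivity
    nlinarith
  · have h1 : |inner ℝ (L.b x) ξ| ≤ (∑ i, mb i) * ‖ξ‖ := by
      rw [PiLp.inner_apply, Finset.sum_mul]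
      refine (Finset.abs_sum_le_sum_abs _ _).trans (Finset.sum_le_sum fun i _ => ?_)
      have e : inner ℝ (L.b x i) (ξ i) = L.b x i * ξ i := by simp [mul_comm]
      rw [e, abs_mul]
      exact mul_le_mul (hb i) (abs_apply_le_norm ξ i) (abs_nonneg _) (hmb0 i)
    have h2 : 0 ≤ (∑ i, ∑ j, ma i j + mc) * ‖ξ‖ := by positivity
    nlinarith

variable {Ω : Set (Space d)} {L : Coeffs d}

theorem Coeffs.IsElliptic.aestronglyMeasurable_integrand (hL : L.IsElliptic Ω)
    {w v : Space d → ℝ} {Dw Dv : Space d → Space d}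
    (hw : AEStronglyMeasurable w (volume.restrict Ω))
    (hDw : AEStronglyMeasurable Dw (volume.restrict Ω))
    (hv : AEStronglyMeasurable v (volume.restrict Ω))
    (hDv : AEStronglyMeasurable Dv (volume.restrict Ω)) :
    AEStronglyMeasurable (L.integrand w Dw v Dv) (volume.restrict Ω) := by
  have hc : ∀ {G : Space d → Space d}, AEStronglyMeasurable G (volume.restrict Ω) → ∀ i,
      AEStronglyMeasurable (fun x => G x i) (volume.restrict Ω) := fun hG i =>
    (EuclideanSpace.proj (𝕜 := ℝ) i).continuous.comp_aestronglyMeasurable hG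
  have h1 : AEStronglyMeasurable (fun x => ∑ i, ∑ j, L.a x i j * Dw x j * Dv x i)
      (volume.restrict Ω) :=
    Finset.aestronglyMeasurable_fun_sum _ fun i _ => Finset.aestronglyMeasurable_fun_sum _ fun j _ =>
      ((hL.bdd_a i j).1.mul (hc hDw j)).mul (hc hDv i)
  have h2 : AEStronglyMeasurable (fun x => ∑ i, L.b x i * Dw x i) (volume.restrict Ω) :=
    Finset.aestronglyMeasurable_fun_sum _ fun i _ => (hL.bdd_b i).1.mul (hc hDw i)
  have h3 := (h1.add (h2.mul hv)).add ((hL.bdd_c.1.mul hw).mul hv)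
  refine h3.congr (ae_of_all _ fun x => ?_)
  have e : inner ℝ (L.b x) (Dw x) = ∑ i, L.b x i * Dw x i := by
    rw [PiLp.inner_apply]
    exact Finset.sum_congr rfl fun i _ => by simp [mul_comm]
  simp only [Coeffs.integrand, inner_toEuclideanLin, e]
  rfl

theorem Coeffs.abs_integrand_le {Λ : ℝ} {x : Space d}
    (h : (∀ ξ ζ : Space d, |inner ℝ (Matrix.toEuclideanLin (L.a x) ξ) ζ| ≤ Λ * ‖ξ‖ * ‖ζ‖) ∧
      (∀ ξ : Space d, |inner ℝ (L.b x) ξ| ≤ Λ * ‖ξ‖) ∧ |L.c x| ≤ Λ)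
    (w v : Space d → ℝ) (Dw Dv : Space d → Space d) :
    |L.integrand w Dw v Dv x| ≤ Λ * (‖Dw x‖ * ‖Dv x‖ + ‖Dw x‖ * |v x| + |w x| * |v x|) := by
  obtain ⟨ha, hb, hc⟩ := h
  have h1 := ha (Dw x) (Dv x)
  have h2 := mul_le_mul_of_nonneg_right (hb (Dw x)) (abs_nonneg (v x))
  have h3 := mul_le_mul_of_nonneg_right hc (mul_nonneg (abs_nonneg (w x)) (abs_nonneg (v x)))
  rw [Coeffs.integrand]
  refine (abs_add_le _ _).trans ((add_le_add_left (abs_add_le _ _) _).trans ?_)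
  rw [abs_mul, abs_mul, abs_mul]
  nlinarith

/-- Young's inequality on each of the three products. Each of the four squares occurs at most twice,
which is where the factors 2δ and Λ²/(2δ) = 2 · Λ²/(4δ) come from. -/
theorem Coeffs.abs_integrand_le_sq {Λ : ℝ} {x : Space d}
    (h : (∀ ξ ζ : Space d, |inner ℝ (Matrix.toEuclideanLin (L.a x) ξ) ζ| ≤ Λ * ‖ξ‖ * ‖ζ‖) ∧
      (∀ ξ : Space d, |inner ℝ (L.b x) ξ| ≤ Λ * ‖ξ‖) ∧ |L.c x| ≤ Λ)
    (w v : Space d → ℝ) (Dw Dv : Space d → Space d) {δ : ℝ} (hδ : 0 < δ) :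
    |L.integrand w Dw v Dv x| ≤ 2 * δ * (‖Dv x‖ ^ 2 + v x ^ 2) +
      Λ ^ 2 / (2 * δ) * (‖Dw x‖ ^ 2 + w x ^ 2) := by
  have h0 := Coeffs.abs_integrand_le h w v Dw Dv
  have young : ∀ a b : ℝ, Λ * (a * b) ≤ δ * b ^ 2 + Λ ^ 2 / (4 * δ) * a ^ 2 := by
    intro a b
    have : Λ * (a * b) = 2 * (δ * b * (Λ / (2 * δ) * a)) := by field_simp
    have e : δ * b ^ 2 + Λ ^ 2 / (4 * δ) * a ^ 2 - Λ * (a * b) =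
        δ * (b - Λ / (2 * δ) * a) ^ 2 := by field_simp; ring
    nlinarith [mul_nonneg hδ.le (sq_nonneg (b - Λ / (2 * δ) * a))]
  have y1 := young ‖Dw x‖ ‖Dv x‖
  have y2 := young ‖Dw x‖ |v x|
  have y3 := young |w x| |v x|
  rw [sq_abs] at y2 y3
  rw [sq_abs] at y3
  have e2 : Λ ^ 2 / (2 * δ) = 2 * (Λ ^ 2 / (4 * δ)) := by field_simp; norm_num
  rw [e2]
  have hk : 0 ≤ Λ ^ 2 / (4 * δ) := by positivity
  nlinarith [sq_nonneg (w x), sq_nonneg ‖Dv x‖, mul_nonneg hk (sq_nonneg (w x)),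
    mul_nonneg hδ.le (sq_nonneg ‖Dv x‖)]

theorem Coeffs.IsElliptic.integrable_integrand (hL : L.IsElliptic Ω)
    {w v : Space d → ℝ} {Dw Dv : Space d → Space d} (hw : IsL2Pair Ω w Dw)
    (hv : IsL2Pair Ω v Dv) : Integrable (L.integrand w Dw v Dv) (volume.restrict Ω) := by
  obtain ⟨Λ, hΛ, hbd⟩ := hL.exists_bound
  refine Integrable.mono' (((hv.intD.add hv.int).const_mul (2 * 1)).add
    ((hw.intD.add hw.int).const_mul (Λ ^ 2 / (2 * 1))))
    (hL.aestronglyMeasurable_integrand hw.meas hw.measD hv.meas hv.measD) ?_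
  filter_upwards [hbd] with x hx
  exact Coeffs.abs_integrand_le_sq hx w v Dw Dv one_pos

theorem Coeffs.IsElliptic.form_sub_left (hL : L.IsElliptic Ω)
    {w w' v : Space d → ℝ} {Dw Dw' Dv : Space d → Space d} (hw : IsL2Pair Ω w Dw)
    (hw' : IsL2Pair Ω w' Dw') (hv : IsL2Pair Ω v Dv) :
    L.form Ω (w - w') (Dw - Dw') v Dv = L.form Ω w Dw v Dv - L.form Ω w' Dw' v Dv := by
  have := integral_sub (hL.integrable_integrand hw hv) (hL.integrable_integrand hw' hv)
  refine Eq.trans ?_ this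
  refine integral_congr_ae (ae_of_all _ fun x => ?_)
  simp only [Coeffs.integrand, Pi.sub_apply, map_sub, inner_sub_left, inner_sub_right]
  ring

/-- The weak equation, coercivity and Poincaré's inequality for a bounded test pair. -/
structure IsAdmissible (Ω : Set (Space d)) (L : Coeffs d) (β P : ℝ) (f u : Space d → ℝ)
    (Du : Space d → Space d) (v : Space d → ℝ) (Dv : Space d → Space d) : Prop where
  meas : AEStronglyMeasurable v (volume.restrict Ω)
  measD : AEStronglyMeasurable Dv (volume.restrict Ω)
  eq : L.form Ω u Du v Dv = ∫ x in Ω, f x * v x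
  coercive : β * ∫ x in Ω, ‖Dv x‖ ^ 2 ≤ L.form Ω v Dv v Dv
  poincare : ∫ x in Ω, v x ^ 2 ≤ P * ∫ x in Ω, ‖Dv x‖ ^ 2

theorem tendsto_integrand {w v : ℕ → Space d → ℝ} {Dw Dv : ℕ → Space d → Space d}
    {w₀ v₀ : Space d → ℝ} {Dw₀ Dv₀ : Space d → Space d} {x : Space d}
    (hw : Tendsto (fun n => w n x) atTop (𝓝 (w₀ x)))
    (hDw : Tendsto (fun n => Dw n x) atTop (𝓝 (Dw₀ x)))
    (hv : Tendsto (fun n => v n x) atTop (𝓝 (v₀ x)))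
    (hDv : Tendsto (fun n => Dv n x) atTop (𝓝 (Dv₀ x))) :
    Tendsto (fun n => L.integrand (w n) (Dw n) (v n) (Dv n) x) atTop
      (𝓝 (L.integrand w₀ Dw₀ v₀ Dv₀ x)) := by
  have hc : Continuous (Matrix.toEuclideanLin (L.a x)) := LinearMap.continuous_of_finiteDimensional _
  exact ((((hc.tendsto _).comp hDw).inner hDv).add ((tendsto_const_nhds.inner hDw).mul hv)).add
    ((hw.const_mul _).mul hv)

/-- Every term in the equation and the two inequalities is an integral that converges by dominated
convergence: the functions and gradients are uniformly bounded and Ω has finite volume. -/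
theorem IsAdmissible.of_tendsto (hL : L.IsElliptic Ω) (hΩ : volume Ω < ⊤) {β P : ℝ}
    {f u : Space d → ℝ} {Du : Space d → Space d} (hf : MemLp f 2 (volume.restrict Ω))
    (hu : IsL2Pair Ω u Du) {φ : ℕ → Space d → ℝ} {Dφ : ℕ → Space d → Space d}
    {v : Space d → ℝ} {Dv : Space d → Space d}
    (hφ : ∀ n, IsAdmissible Ω L β P f u Du (φ n) (Dφ n)) (h : BddAETendsto Ω φ Dφ v Dv) :
    IsAdmissible Ω L β P f u Du v Dv := by
  have hfin : IsFiniteMeasure (volume.restrict Ω) := ⟨by simpa using hΩ⟩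
  obtain ⟨M, hM⟩ := h.bound
  obtain ⟨Λ, hΛ, hbd⟩ := hL.exists_bound
  have hM' : ∀ n, ∀ᵐ x ∂(volume.restrict Ω), ‖Dφ n x‖ ^ 2 ≤ M ^ 2 ∧ φ n x ^ 2 ≤ M ^ 2 := by
    intro n
    filter_upwards [hM n] with x hx
    refine ⟨pow_le_pow_left₀ (norm_nonneg _) hx.2 2, ?_⟩
    rw [← sq_abs]
    exact pow_le_pow_left₀ (abs_nonneg _) hx.1 2
  have t1 : Tendsto (fun n => ∫ x in Ω, φ n x ^ 2) atTop (𝓝 (∫ x in Ω, v x ^ 2)) := by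
    refine tendsto_integral_of_dominated_convergence (fun _ => M ^ 2)
      (fun n => (hφ n).meas.pow 2) (integrable_const _) (fun n => ?_) ?_
    · filter_upwards [hM' n] with x hx
      rw [Real.norm_of_nonneg (sq_nonneg _)]
      exact hx.2
    · filter_upwards [h.tendsto] with x hx using hx.1.pow 2
  have t2 : Tendsto (fun n => ∫ x in Ω, ‖Dφ n x‖ ^ 2) atTop (𝓝 (∫ x in Ω, ‖Dv x‖ ^ 2)) := by
    refine tendsto_integral_of_dominated_convergence (fun _ => M ^ 2)
      (fun n => (hφ n).measD.norm.pow 2) (integrable_const _) (fun n => ?_) ?_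
    · filter_upwards [hM' n] with x hx
      rw [Real.norm_of_nonneg (sq_nonneg _)]
      exact hx.1
    · filter_upwards [h.tendsto] with x hx using hx.2.norm.pow 2
  have t3 : Tendsto (fun n => ∫ x in Ω, f x * φ n x) atTop (𝓝 (∫ x in Ω, f x * v x)) := by
    refine tendsto_integral_of_dominated_convergence (fun x => |f x| * M)
      (fun n => hf.1.mul (hφ n).meas) ((hf.integrable (by norm_num)).abs.mul_const M)
      (fun n => ?_) ?_
    · filter_upwards [hM n] with x hx
      rw [norm_mul]
      exact mul_le_mul_of_nonneg_left hx.1 (norm_nonneg _)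
    · filter_upwards [h.tendsto] with x hx using hx.1.const_mul _
  have t4 : Tendsto (fun n => L.form Ω u Du (φ n) (Dφ n)) atTop (𝓝 (L.form Ω u Du v Dv)) := by
    refine tendsto_integral_of_dominated_convergence
      (fun x => 2 * 1 * (M ^ 2 + M ^ 2) + Λ ^ 2 / (2 * 1) * (‖Du x‖ ^ 2 + u x ^ 2))
      (fun n => hL.aestronglyMeasurable_integrand hu.meas hu.measD (hφ n).meas (hφ n).measD)
      ((integrable_const _).add ((hu.intD.add hu.int).const_mul _)) (fun n => ?_) ?_
    · filter_upwards [hM' n, hbd] with x hx hb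
      have := Coeffs.abs_integrand_le_sq hb u (φ n) Du (Dφ n) one_pos
      refine this.trans ?_
      linarith [hx.1, hx.2]
    · filter_upwards [h.tendsto] with x hx using
        tendsto_integrand (w := fun _ => u) (Dw := fun _ => Du) tendsto_const_nhds
          tendsto_const_nhds hx.1 hx.2
  have t5 : Tendsto (fun n => L.form Ω (φ n) (Dφ n) (φ n) (Dφ n)) atTop
      (𝓝 (L.form Ω v Dv v Dv)) := by
    refine tendsto_integral_of_dominated_convergence
      (fun x => 2 * 1 * (M ^ 2 + M ^ 2) + Λ ^ 2 / (2 * 1) * (M ^ 2 + M ^ 2))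
      (fun n => hL.aestronglyMeasurable_integrand (hφ n).meas (hφ n).measD (hφ n).meas (hφ n).measD)
      (integrable_const _) (fun n => ?_) ?_
    · filter_upwards [hM' n, hbd] with x hx hb
      have := Coeffs.abs_integrand_le_sq hb (φ n) (φ n) (Dφ n) (Dφ n) one_pos
      refine this.trans ?_
      have h2 : 0 ≤ Λ ^ 2 / (2 * 1) := by positivity
      nlinarith [hx.1, hx.2]
    · filter_upwards [h.tendsto] with x hx using tendsto_integrand hx.1 hx.2 hx.1 hx.2
  exact
    { meas := aestronglyMeasurable_of_tendsto_ae atTop (fun n => (hφ n).meas)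
        (h.tendsto.mono fun x hx => hx.1)
      measD := aestronglyMeasurable_of_tendsto_ae atTop (fun n => (hφ n).measD)
        (h.tendsto.mono fun x hx => hx.2)
      eq := tendsto_nhds_unique t4 (t3.congr fun n => (hφ n).eq.symm)
      coercive := le_of_tendsto_of_tendsto' (t2.const_mul β) t5 fun n => (hφ n).coercive
      poincare := le_of_tendsto_of_tendsto' t1 (t2.const_mul P) fun n => (hφ n).poincare }

variable {T : Mesh Ω}

/-- Two limit passages: from test functions to compactly supported Lipschitz functions, and from
these to w. -/
theorem Mesh.IsFEFunction.isAdmissible (hd : 1 ≤ d) (hΩ : IsOpen Ω) (hL : L.IsElliptic Ω)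
    {β : ℝ} (hβ : ∀ φ, IsTestFunction Ω φ →
      β * ∫ x in Ω, ‖gradient φ x‖ ^ 2 ≤ L.form Ω φ (gradient φ) φ (gradient φ))
    {R : ℝ} (hR : ∀ x ∈ Ω, ‖x‖ ≤ R) {f g u : Space d → ℝ} {Du : Space d → Space d}
    (hf : MemLp f 2 (volume.restrict Ω)) (hu : IsL2Pair Ω u Du) (hsol : IsSolution L Ω f g u Du)
    {w : Space d → ℝ} (hw : T.IsFEFunction w) (h0 : ∀ x ∈ frontier Ω, w x = 0) :
    IsAdmissible Ω L β (4 * R ^ 2) f u Du w (gradient w) := by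
  have htest : ∀ φ, IsTestFunction Ω φ →
      IsAdmissible Ω L β (4 * R ^ 2) f u Du φ (gradient φ) := fun φ hφ =>
    { meas := hφ.1.continuous.aestronglyMeasurable
      measD := (measurable_gradient φ).aestronglyMeasurable
      eq := hsol.eq φ hφ
      coercive := hβ φ hφ
      poincare := hφ.integral_sq_le hd hR }
  obtain ⟨W, hW, hlim⟩ := hw.exists_compactSupport_tendsto hΩ h0
  refine IsAdmissible.of_tendsto hL T.volume_lt_top hf hu (fun n => ?_) hlim
  obtain ⟨⟨M, hM⟩, hc, hs⟩ := hW n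
  obtain ⟨φ, hφ, hφlim⟩ := exists_testFunctions_tendsto hΩ hM hc hs
  exact IsAdmissible.of_tendsto hL T.volume_lt_top hf hu (fun k => htest _ (hφ k)) hφlim

theorem Mesh.IsFEFunction.isL2Pair (hΩ : IsOpen Ω) {w : Space d → ℝ} (hw : T.IsFEFunction w) :
    IsL2Pair Ω w (gradient w) := by
  classical
  choose! ℓ hℓ using hw.2
  obtain ⟨B, hB⟩ := T.isCompact_closure.exists_bound_of_continuousOn hw.1
  refine IsL2Pair.of_bounded T.volume_lt_top
    ((hw.1.mono subset_closure).aestronglyMeasurable hΩ.measurableSet)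
    (measurable_gradient w).aestronglyMeasurable
    (M := max B (∑ K ∈ T.elements, ‖affGrad (ℓ K)‖)) ?_
  filter_upwards [T.ae_mem_interior hΩ] with x ⟨K, hK, hx⟩
  refine ⟨(hB x (subset_closure (Mesh.interior_subset hΩ hK hx))).trans (le_max_left _ _), ?_⟩
  rw [(hasGradientAt_of_eqOn (hℓ K hK) hx).gradient]
  exact (Finset.single_le_sum (f := fun K => ‖affGrad (ℓ K)‖) (fun _ _ => norm_nonneg _) hK).trans
    (le_max_right _ _)

theorem Mesh.IsFEFunction.gradient_sub (hΩ : IsOpen Ω) {v w : Space d → ℝ}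
    (hv : T.IsFEFunction v) (hw : T.IsFEFunction w) :
    ∀ᵐ x ∂(volume.restrict Ω), gradient (v - w) x = gradient v x - gradient w x := by
  filter_upwards [T.ae_mem_interior hΩ] with x ⟨K, hK, hx⟩
  obtain ⟨ℓ, hℓ⟩ := hv.2 K hK
  obtain ⟨ℓ', hℓ'⟩ := hw.2 K hK
  have h1 := hasGradientAt_of_eqOn hℓ hx
  have h2 := hasGradientAt_of_eqOn hℓ' hx
  rw [h1.gradient, h2.gradient]
  refine HasGradientAt.gradient ?_
  rw [hasGradientAt_iff_hasFDerivAt] at h1 h2 ⊢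
  rw [map_sub]
  exact h1.sub h2

/-- Quasi-optimality of the finite element solution for the nodal interpolant. -/
theorem exists_cea_constant (hd : 1 ≤ d) (hΩ : IsPolyhedralDomain Ω) (hL : L.IsElliptic Ω) :
    ∃ C : ℝ, 0 < C ∧ ∀ (f g u : Space d → ℝ) (Du : Space d → Space d) (H : Space d → Mat d),
      MemLp f 2 (volume.restrict Ω) → IsSolution L Ω f g u Du → IsH2 Ω u Du H →
      ∀ (T : Mesh Ω) (uh v : Space d → ℝ), IsFESolution L T f g uh → T.IsFEFunction v →
      (∀ p ∈ T.vertices, v p = u p) →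
      ∫ x in Ω, ‖Du x - gradient uh x‖ ^ 2 ≤
        C * ((∫ x in Ω, ‖Du x - gradient v x‖ ^ 2) + ∫ x in Ω, (u x - v x) ^ 2) := by
  obtain ⟨Λ, hΛ, hbd⟩ := hL.exists_bound
  obtain ⟨β, hβ, hcoer⟩ := hL.coercive
  -- A mesh of Ω fixed once; it serves only to bound Ω, so that the Poincaré constant does not
  -- depend on the mesh T below.
  obtain ⟨T₀⟩ := hΩ.nonempty_mesh
  obtain ⟨R, hR⟩ := T₀.isBounded.exists_norm_le
  set P : ℝ := 4 * R ^ 2 with hP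
  have hP0 : 0 ≤ P := by positivity
  -- Young's parameter is chosen so that 2δ(1 + P) = β/2: the full H¹ norm of w on the right is then
  -- absorbed into half of the coercivity term.
  set δ : ℝ := β / (4 * (1 + P)) with hδ
  have hδ0 : 0 < δ := by positivity
  refine ⟨2 + 2 * (Λ ^ 2 / (δ * β)), by positivity, ?_⟩
  intro f g u Du H hf hsol hu T uh v huh hv hvu
  have hu2 := hu.isL2Pair
  have hv2 := hv.isL2Pair hΩ.isOpen
  have huh2 := huh.mem.isL2Pair hΩ.isOpen
  have hw : T.IsFEFunction (uh - v) := huh.mem.sub hv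
  have hw0 : ∀ x ∈ frontier Ω, (uh - v) x = 0 := by
    refine hw.eq_zero_on_frontier fun p hp hpf => ?_
    rw [Pi.sub_apply, huh.boundary p hp hpf, hvu p hp, hsol.boundary p hpf, sub_self]
  have hadm := hw.isAdmissible hd hΩ.isOpen hL hcoer hR hf hu2 hsol hw0
  have hw2 := hw.isL2Pair hΩ.isOpen
  set w := uh - v with hwdef
  have hgrad := huh.mem.gradient_sub hΩ.isOpen hv
  -- Galerkin orthogonality: B(u_h, w) and B(u, w) both equal ∫ f w, so u_h may be replaced by u in
  -- the first argument.
  have hform : L.form Ω w (gradient w) w (gradient w) =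
      L.form Ω (u - v) (Du - gradient v) w (gradient w) := by
    have e1 : L.form Ω w (gradient w) w (gradient w) =
        L.form Ω (uh - v) (gradient uh - gradient v) w (gradient w) := by
      refine integral_congr_ae ?_
      filter_upwards [hgrad] with x hx
      rw [hx]
      rfl
    rw [e1, hL.form_sub_left huh2 hv2 hw2, hL.form_sub_left hu2 hv2 hw2, hadm.eq,
      huh.galerkin w hw hw0]
  have he2 := hu2.sub hv2
  have hle : L.form Ω (u - v) (Du - gradient v) w (gradient w) ≤
      ∫ x in Ω, (2 * δ * (‖gradient w x‖ ^ 2 + w x ^ 2) +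
        Λ ^ 2 / (2 * δ) * (‖(Du - gradient v) x‖ ^ 2 + (u - v) x ^ 2)) := by
    refine integral_mono_ae (hL.integrable_integrand he2 hw2)
      (((hw2.intD.add hw2.int).const_mul _).add ((he2.intD.add he2.int).const_mul _)) ?_
    filter_upwards [hbd] with x hx
    exact (le_abs_self _).trans (Coeffs.abs_integrand_le_sq hx _ _ _ _ hδ0)
  have hsw : Integrable (fun x => ‖gradient w x‖ ^ 2 + w x ^ 2) (volume.restrict Ω) :=
    hw2.intD.add hw2.int
  have hse : Integrable (fun x => ‖(Du - gradient v) x‖ ^ 2 + (u - v) x ^ 2)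
      (volume.restrict Ω) := he2.intD.add he2.int
  rw [integral_add (hsw.const_mul _) (hse.const_mul _), integral_const_mul, integral_const_mul, integral_add hw2.intD hw2.int,
    integral_add he2.intD he2.int] at hle
  have hc := hadm.coercive
  have hp := hadm.poincare
  rw [hform] at hc
  have hEdef : ∀ x, (Du - gradient v) x = Du x - gradient v x := fun x => rfl
  have hedef : ∀ x, (u - v) x = u x - v x := fun x => rfl
  simp only [hEdef, hedef] at hle
  have hDuInt := he2.intD
  simp only [hEdef] at hDuInt
  have hsplit : ∫ x in Ω, ‖Du x - gradient uh x‖ ^ 2 ≤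
      ∫ x in Ω, (2 * ‖Du x - gradient v x‖ ^ 2 + 2 * ‖gradient w x‖ ^ 2) := by
    refine integral_mono_ae (hu2.sub huh2).intD
      ((hDuInt.const_mul _).add (hw2.intD.const_mul _)) ?_
    filter_upwards [hgrad] with x hx
    rw [hx]
    have e : Du x - gradient uh x = (Du x - gradient v x) - (gradient uh x - gradient v x) := by abel
    have h1 := norm_sub_le (Du x - gradient v x) (gradient uh x - gradient v x)
    rw [← e] at h1
    have h2 := pow_le_pow_left₀ (norm_nonneg _) h1 2
    nlinarith [sq_nonneg (‖Du x - gradient v x‖ - ‖gradient uh x - gradient v x‖)]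
  rw [integral_add (hDuInt.const_mul _) (hw2.intD.const_mul _), integral_const_mul,
    integral_const_mul] at hsplit
  have hnn : 0 ≤ ∫ x in Ω, (u x - v x) ^ 2 := integral_nonneg fun x => sq_nonneg _
  have hnD : 0 ≤ ∫ x in Ω, ‖Du x - gradient v x‖ ^ 2 := integral_nonneg fun x => sq_nonneg _
  set I := ∫ x in Ω, ‖gradient w x‖ ^ 2
  set J := ∫ x in Ω, w x ^ 2
  set E := ∫ x in Ω, ‖Du x - gradient v x‖ ^ 2
  set e := ∫ x in Ω, (u x - v x) ^ 2
  have hδβ : 2 * δ * (1 + P) = β / 2 := by rw [hδ]; field_simp; norm_num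
  have h3 : 2 * δ * (I + J) ≤ β / 2 * I := by
    rw [← hδβ]
    have : I + J ≤ (1 + P) * I := by linarith
    have := mul_le_mul_of_nonneg_left this (by positivity : 0 ≤ 2 * δ)
    linarith
  have h4 : β / 2 * I ≤ Λ ^ 2 / (2 * δ) * (E + e) := by linarith
  have h5 : I ≤ Λ ^ 2 / (δ * β) * (E + e) := by
    have e1 : Λ ^ 2 / (δ * β) * (E + e) = (Λ ^ 2 / (2 * δ) * (E + e)) / (β / 2) := by
      field_simp
    rw [e1, le_div_iff₀ (by positivity)]
    linarith
  nlinarith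

end Cea

end

end AnisoFEM

namespace AnisoFEM

noncomputable section

open Filter Topology

/-! ### Scaling identities, elementwise error bound, summation over the mesh -/

section ErrorBound

variable {d : ℕ}

/-! ### Scaling of the metric tensor -/

theorem metric_scale_pos (hd : 1 ≤ d) {A : Mat d} (hA : A.PosDef) :
    0 < A.det ^ (-(1 / ((d : ℝ) + 2))) * norm2 A ^ (2 / ((d : ℝ) + 2)) :=
  mul_pos (Real.rpow_pos_of_pos hA.det_pos _) (Real.rpow_pos_of_pos (norm2_pos hd hA) _)

/-- This is the purpose of the scalar factor in the metric: the metric density becomes the d/(d+2)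
power of the quantity whose quasi-norm appears in the final bound. -/
theorem sqrt_det_metric (hd : 1 ≤ d) {α : ℝ} (hα : 0 < α) (R : Mat d) :
    (metric α R).det ^ (1 / 2 : ℝ) =
      ((regAbs α R).det ^ (1 / (d : ℝ)) * norm2 (regAbs α R)) ^ ((d : ℝ) / ((d : ℝ) + 2)) := by
  have hA := regAbs_posDef hα R
  rw [metric, Matrix.det_smul, Fintype.card_fin]
  have h1 := hA.det_pos
  have h2 := norm2_pos hd hA
  generalize (regAbs α R).det = a at *
  generalize norm2 (regAbs α R) = n at *
  -- Writing positive numbers as exponentials reduces the identity of real powers to a linear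
  -- identity between exponents.
  obtain ⟨x, rfl⟩ : ∃ x, a = Real.exp x := ⟨Real.log a, (Real.exp_log h1).symm⟩
  obtain ⟨y, rfl⟩ : ∃ y, n = Real.exp y := ⟨Real.log n, (Real.exp_log h2).symm⟩
  have hd0 : (d : ℝ) ≠ 0 := by positivity
  simp only [← Real.exp_mul, ← Real.exp_add, ← Real.exp_nat_mul]
  congr 1
  field_simp
  ring

/-- The left side is the volume times the geometric part of the pointwise squared error; the right
side is a power of the metric volume of the element, the quantity that equidistribution controls. -/
theorem elementScale_mul_eq (hd : 1 ≤ d) {a n v : ℝ} (ha : 0 < a) (hn : 0 < n) (hv : 0 < v) :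
    v * (n * (v ^ (2 / (d : ℝ)) * a ^ (1 / (d : ℝ)))) =
      (v * (a ^ (1 / (d : ℝ)) * n) ^ ((d : ℝ) / ((d : ℝ) + 2))) ^ (((d : ℝ) + 2) / (d : ℝ)) := by
  obtain ⟨x, rfl⟩ : ∃ x, a = Real.exp x := ⟨Real.log a, (Real.exp_log ha).symm⟩
  obtain ⟨y, rfl⟩ : ∃ y, n = Real.exp y := ⟨Real.log n, (Real.exp_log hn).symm⟩
  obtain ⟨z, rfl⟩ : ∃ z, v = Real.exp z := ⟨Real.log v, (Real.exp_log hv).symm⟩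
  have hd0 : (d : ℝ) ≠ 0 := by positivity
  simp only [← Real.exp_mul, ← Real.exp_add]
  congr 1
  field_simp
  ring

theorem elementScale_pow (hd : 1 ≤ d) {a v : ℝ} (ha : 0 < a) (hv : 0 < v) :
    (v ^ (2 / (d : ℝ)) * a ^ (1 / (d : ℝ))) ^ d = v ^ 2 * a := by
  have hd0 : (d : ℝ) ≠ 0 := by positivity
  rw [mul_pow, ← Real.rpow_natCast, ← Real.rpow_natCast (a ^ _), ← Real.rpow_mul hv.le,
    ← Real.rpow_mul ha.le, div_mul_cancel₀ _ hd0, div_mul_cancel₀ _ hd0, Real.rpow_one]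
  norm_num

/-- Both sides of the alignment condition are homogeneous of degree one in the metric, so its scalar
factor cancels. -/
theorem trace_le_of_alignment (hd : 1 ≤ d) {α : ℝ} (hα : 0 < α) {R J : Mat d} {v Cali : ℝ}
    (h : (1 / (d : ℝ)) * (J.transpose * metric α R * J).trace ≤
      Cali * v ^ (2 / (d : ℝ)) * (metric α R).det ^ (1 / (d : ℝ))) :
    (J.transpose * regAbs α R * J).trace ≤
      d * Cali * (v ^ (2 / (d : ℝ)) * (regAbs α R).det ^ (1 / (d : ℝ))) := by
  have hA := regAbs_posDef hα R
  have hd0 : (0 : ℝ) < d := by positivity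
  have hρ := metric_scale_pos hd hA
  rw [metric] at h
  generalize (regAbs α R).det ^ (-(1 / ((d : ℝ) + 2))) * norm2 (regAbs α R) ^ (2 / ((d : ℝ) + 2)) = ρ
    at *
  rw [Matrix.det_smul, Fintype.card_fin, Matrix.mul_smul, Matrix.smul_mul, Matrix.trace_smul,
    smul_eq_mul, Real.mul_rpow (by positivity) hA.det_pos.le, ← Real.rpow_natCast,
    ← Real.rpow_mul hρ.le, mul_one_div_cancel hd0.ne', Real.rpow_one] at h
  have h2 : ρ * ((J.transpose * regAbs α R * J).trace) ≤
      ρ * (d * Cali * (v ^ (2 / (d : ℝ)) * (regAbs α R).det ^ (1 / (d : ℝ)))) := by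
    have := mul_le_mul_of_nonneg_left h hd0.le
    rw [← mul_assoc, mul_one_div_cancel hd0.ne', one_mul] at this
    linarith
  exact le_of_mul_le_mul_left h2 hρ

/-! ### Interpolation error on one element -/

/-- The constant in the elementwise interpolation estimate. -/
def interpConst (d : ℕ) (D r δ : ℝ) : ℝ := (d : ℝ) ^ (d + 1) * (D ^ 2 / r) ^ 2 * (1 + δ ^ 2)

/-- The trace enters with total power d + 1, namely d - 1 from the spectral bound and 2 from the
squared Taylor remainder. Alignment turns t^{d+1} into (d Cali τ)^{d+1}, and division by S = τ^d
leaves a single τ. The factor 1 + δ² covers the gradient error X and the value error Y at once. -/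
theorem interp_bounds_of_trace_le (hd : 1 ≤ d) {D r δ n t τ c Cali X Y S : ℝ} (hr : 0 < r)
    (hn : 0 ≤ n) (ht : 0 ≤ t) (hτ : 0 < τ) (hCali : 0 ≤ Cali) (hS : S = τ ^ d)
    (htτ : t ≤ d * Cali * τ)
    (hY : |Y| ≤ c * (t * D ^ 2) / 2) (hX : S * X ^ 2 ≤ n * t ^ (d - 1) * (c * (t * D ^ 2) / r) ^ 2)
    (hδ : r ^ 2 * S ≤ n * t ^ (d - 1) * δ ^ 2) :
    Y ^ 2 ≤ interpConst d D r δ * c ^ 2 * Cali ^ (d + 1) * (n * τ) ∧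
      X ^ 2 ≤ interpConst d D r δ * c ^ 2 * Cali ^ (d + 1) * (n * τ) := by
  obtain ⟨m, rfl⟩ : ∃ m, d = m + 1 := ⟨d - 1, by lia⟩
  simp only [Nat.add_sub_cancel] at hX hδ
  set k : ℝ := ((m + 1 : ℕ) : ℝ) with hk
  have hk0 : 0 ≤ k := by positivity
  have hpow : t ^ (m + 2) ≤ k ^ (m + 2) * Cali ^ (m + 2) * (τ ^ (m + 1) * τ) := by
    have := pow_le_pow_left₀ ht htτ (m + 2)
    rw [mul_pow, mul_pow] at this
    rwa [← pow_succ]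
  have hSpos : 0 < S := hS ▸ pow_pos hτ _
  have hmain : (c * D ^ 2 / r) ^ 2 * (n * t ^ (m + 2)) ≤
      S * (k ^ (m + 2) * (D ^ 2 / r) ^ 2 * c ^ 2 * Cali ^ (m + 2) * (n * τ)) := by
    have h1 := mul_le_mul_of_nonneg_left hpow
      (mul_nonneg (sq_nonneg (c * D ^ 2 / r)) hn)
    rw [← hS] at h1
    refine le_trans (le_of_eq (by ring)) (h1.trans (le_of_eq ?_))
    ring
  have hnn : 0 ≤ k ^ (m + 2) * (D ^ 2 / r) ^ 2 * c ^ 2 * Cali ^ (m + 2) * (n * τ) := by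
    positivity
  have hconst : interpConst (m + 1) D r δ * c ^ 2 * Cali ^ (m + 1 + 1) * (n * τ) =
      (1 + δ ^ 2) * (k ^ (m + 2) * (D ^ 2 / r) ^ 2 * c ^ 2 * Cali ^ (m + 2) * (n * τ)) := by
    rw [interpConst]; ring
  rw [hconst]
  constructor
  · have h1 : Y ^ 2 ≤ (c * (t * D ^ 2) / 2) ^ 2 := by
      rw [← sq_abs]
      exact pow_le_pow_left₀ (abs_nonneg _) hY 2
    have h2 : (r ^ 2 * S) * Y ^ 2 ≤ (n * t ^ m * δ ^ 2) * (c * (t * D ^ 2) / 2) ^ 2 :=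
      mul_le_mul hδ h1 (sq_nonneg _) (by positivity)
    have h3 : (n * t ^ m * δ ^ 2) * (c * (t * D ^ 2) / 2) ^ 2 =
        r ^ 2 * (δ ^ 2 / 4 * ((c * D ^ 2 / r) ^ 2 * (n * t ^ (m + 2)))) := by
      field_simp
      ring
    rw [h3, mul_assoc] at h2
    have h4 := le_of_mul_le_mul_left h2 (by positivity : 0 < r ^ 2)
    have h5 := mul_le_mul_of_nonneg_left hmain (by positivity : 0 ≤ δ ^ 2 / 4)
    have h6 := h4.trans h5
    rw [mul_left_comm] at h6
    have h7 := le_of_mul_le_mul_left h6 hSpos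
    nlinarith [mul_nonneg (sq_nonneg δ) hnn]
  · have h1 : n * t ^ m * (c * (t * D ^ 2) / r) ^ 2 =
        (c * D ^ 2 / r) ^ 2 * (n * t ^ (m + 2)) := by ring
    rw [h1] at hX
    have h2 := le_of_mul_le_mul_left (hX.trans hmain) hSpos
    nlinarith [mul_nonneg (sq_nonneg δ) hnn]

theorem ae_abs_quad_hessian_le {Ω : Set (Space d)} (hΩ : IsOpen Ω) (hvol : volume Ω < ⊤)
    {u : Space d → ℝ} {Du : Space d → Space d} {H : Space d → Mat d} (hu : IsH2 Ω u Du H)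
    {U : Set (Space d)} (hU : U ⊆ Ω) {A : Mat d} (hA : A.PosDef) {c : ℝ}
    (hc : ∀ᵐ x ∂(volume : Measure (Space d)), x ∈ U → LEScalar (A⁻¹ * matAbs (H x)) c) :
    ∀ᵐ x ∂(volume : Measure (Space d)), x ∈ U → ∀ ξ, |quad (H x) ξ| ≤ |c| * quad A ξ := by
  filter_upwards [hc, hu.ae_isHermitian hΩ hvol] with x hx hH hxU ξ
  have h1 := abs_quad_le_quad_matAbs (hH (hU hxU)) ξ
  have h2 := quad_le_quad (posSemidef_smul_sub_of_leScalar hA (matAbs_posSemidef (H x)).isHermitian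
    (hx hxU)) ξ
  rw [quad_smul] at h2
  have h3 := mul_le_mul_of_nonneg_right (le_abs_self c) (quad_nonneg hA.posSemidef ξ)
  linarith

theorem closure_interior_simplex {K : Finset (Space d)}
    (hK : (interior (simplex K)).Nonempty) : closure (interior (simplex K)) = simplex K := by
  rw [(convex_simplex K).closure_interior_eq_closure_of_nonempty_interior hK,
    (isClosed_simplex K).closure_eq]

theorem continuous_quad (A : Mat d) : Continuous (quad A) :=
  continuous_id.inner (Matrix.toEuclideanCLM (n := Fin d) (𝕜 := ℝ) A).continuous

theorem ae_interpolation_error_le (hd : 1 ≤ d) {Ω : Set (Space d)} (hΩ : IsOpen Ω) {T : Mesh Ω}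
    {u v : Space d → ℝ} {Du : Space d → Space d} {H : Space d → Mat d} (hu : IsH2 Ω u Du H)
    (hcont : ContinuousOn u (closure Ω)) (hv : T.IsFEFunction v)
    (hvu : ∀ p ∈ T.vertices, v p = u p) {V K : Finset (Space d)} (hV : vol V = 1)
    (hK : K ∈ T.elements) {F : Space d →ᵃ[ℝ] Space d} (hF : F '' simplex V = simplex K)
    {c₀ : Space d} {r D δ : ℝ} (hr : 0 < r) (hball : Metric.closedBall c₀ r ⊆ simplex V)
    (hD : ∀ p ∈ simplex V, ∀ q ∈ simplex V, ‖p - q‖ ≤ D)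
    (hδ : ∀ p ∈ closure Ω, ∀ q ∈ closure Ω, ‖p - q‖ ≤ δ)
    {A : Mat d} (hA : A.PosDef) {c Cali : ℝ} (hCali : 0 ≤ Cali)
    (htr : ((jacobian F).transpose * A * jacobian F).trace ≤
      d * Cali * (vol K ^ (2 / (d : ℝ)) * A.det ^ (1 / (d : ℝ))))
    (hc : ∀ᵐ x ∂(volume.restrict (simplex K)), LEScalar (A⁻¹ * matAbs (H x)) c) :
    ∀ᵐ x ∂(volume : Measure (Space d)), x ∈ interior (simplex K) →
      (u x - v x) ^ 2 ≤ interpConst d D r δ * c ^ 2 * Cali ^ (d + 1) *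
        (norm2 A * (vol K ^ (2 / (d : ℝ)) * A.det ^ (1 / (d : ℝ)))) ∧
      ‖Du x - gradient v x‖ ^ 2 ≤ interpConst d D r δ * c ^ 2 * Cali ^ (d + 1) *
        (norm2 A * (vol K ^ (2 / (d : ℝ)) * A.det ^ (1 / (d : ℝ)))) := by
  have hvK := Mesh.vol_pos hK
  have hJ : (jacobian F).det ≠ 0 := by
    rw [← abs_pos, abs_det_jacobian hV hF]
    exact hvK
  have hint : (interior (simplex K)).Nonempty :=
    (interior_simplex_nonempty_iff (Mesh.indep_of_mem hK)).2 (T.mem_elements.1 hK).2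
  have hsub := Mesh.interior_subset hΩ hK
  have hc' : ∀ᵐ x ∂(volume : Measure (Space d)), x ∈ interior (simplex K) →
      LEScalar (A⁻¹ * matAbs (H x)) c := by
    filter_upwards [(ae_restrict_iff' (isClosed_simplex K).measurableSet).1 hc] with x hx hxK
    exact hx (interior_subset hxK)
  have hq := ae_abs_quad_hessian_le hΩ T.volume_lt_top hu hsub hA hc'
  -- Applied on the open convex interior of K, whose closure is all of K, so the vertices are
  -- admissible values of y. The absolute value of c is harmless since only c² survives.
  have htaylor := ae_abs_taylor_le hΩ.measurableSet T.volume_lt_top isOpen_interior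
    (convex_simplex K).interior hsub hu
    (hcont.mono (closure_mono hsub)) (q := fun ξ => |c| * quad A ξ)
    (continuous_const.mul (continuous_quad A)) hq
  obtain ⟨ℓ, hℓ⟩ := hv.2 K hK
  have hℓu : ∀ p ∈ K, ℓ p = u p := fun p hp => by
    rw [← hℓ (mem_simplex hp), hvu p (Mesh.mem_vertices_of_mem hK hp)]
  filter_upwards [htaylor] with x hx hxK
  have hx' := hx hxK
  rw [closure_interior_simplex hint] at hx'
  obtain ⟨h1, h2⟩ := interpolation_error_le hA hJ hF hr hball hD (abs_nonneg c)
    (interior_subset hxK) hx' hℓu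
  have h3 := sq_mul_det_le hd hA hJ hF hr hball (δ := δ) fun p hp q hq =>
    hδ p (Mesh.simplex_subset hK hp) q (Mesh.simplex_subset hK hq)
  have hS : ((jacobian F).transpose * A * jacobian F).det =
      (vol K ^ (2 / (d : ℝ)) * A.det ^ (1 / (d : ℝ))) ^ d := by
    rw [elementScale_pow hd hA.det_pos hvK, det_pullback, abs_det_jacobian hV hF]
  have hτ : 0 < vol K ^ (2 / (d : ℝ)) * A.det ^ (1 / (d : ℝ)) :=
    mul_pos (Real.rpow_pos_of_pos hvK _) (Real.rpow_pos_of_pos hA.det_pos _)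
  have := interp_bounds_of_trace_le hd hr (norm2_nonneg A)
    (pullback_posDef hJ hA).posSemidef.trace_nonneg hτ hCali hS htr h1 h2 h3
  rw [sq_abs] at this
  rw [hℓ (interior_subset hxK), (hasGradientAt_of_eqOn hℓ hxK).gradient]
  refine ⟨?_, this.2⟩
  have e : (u x - ℓ x) ^ 2 = (ℓ x - u x) ^ 2 := by ring
  rw [e]
  exact this.1

/-! ### Summation over the mesh -/

theorem Mesh.setIntegral_le_sum {Ω : Set (Space d)} (hΩ : IsOpen Ω) (T : Mesh Ω)
    {h : Space d → ℝ} (hh : Integrable h (volume.restrict Ω)) {m : Finset (Space d) → ℝ}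
    (hm0 : ∀ K ∈ T.elements, 0 ≤ m K)
    (hm : ∀ K ∈ T.elements, ∀ᵐ x ∂(volume : Measure (Space d)),
      x ∈ interior (simplex K) → h x ≤ m K) :
    ∫ x in Ω, h x ≤ ∑ K ∈ T.elements, vol K * m K := by
  have hi : ∀ K : Finset (Space d),
      Integrable ((simplex K).indicator fun _ => m K) (volume.restrict Ω) := fun K =>
    (integrable_indicator_iff (isClosed_simplex K).measurableSet).2
      (integrableOn_const (((Measure.restrict_apply_le _ _).trans_lt
        (isCompact_simplex K).measure_lt_top).ne))
  have h1 : ∫ x in Ω, h x ≤ ∫ x in Ω, ∑ K ∈ T.elements, (simplex K).indicator (fun _ => m K) x := by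
    refine integral_mono_ae hh (integrable_finsetSum _ fun K _ => hi K) ?_
    have := (Finset.eventually_all T.elements).2 hm
    filter_upwards [T.ae_mem_interior hΩ, ae_restrict_of_ae this] with x ⟨K, hK, hx⟩ hall
    refine (hall K hK hx).trans ?_
    have h2 := Finset.single_le_sum (f := fun K => (simplex K).indicator (fun _ => m K) x)
      (fun K hK => Set.indicator_nonneg (fun _ _ => hm0 K hK) x) hK
    simpa [Set.indicator_of_mem (_root_.interior_subset hx)] using h2
  refine h1.trans ?_
  rw [integral_finsetSum _ fun K _ => hi K]
  refine Finset.sum_le_sum fun K hK => ?_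
  rw [integral_indicator (isClosed_simplex K).measurableSet, integral_const, smul_eq_mul]
  refine mul_le_mul_of_nonneg_right ?_ (hm0 K hK)
  rw [vol, measureReal_restrict_apply_univ, measureReal_def, measureReal_def]
  exact ENNReal.toReal_mono (isCompact_simplex K).measure_lt_top.ne (Measure.restrict_apply_le _ _)

theorem Mesh.ofReal_sum_le_lintegral {Ω : Set (Space d)} (hΩ : IsOpen Ω) (T : Mesh Ω)
    {h : Space d → ENNReal} {s : Finset (Space d) → ℝ} (hs0 : ∀ K ∈ T.elements, 0 ≤ s K)
    (hs : ∀ K ∈ T.elements, ∀ᵐ x ∂(volume : Measure (Space d)),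
      x ∈ interior (simplex K) → ENNReal.ofReal (s K) ≤ h x) :
    ENNReal.ofReal (∑ K ∈ T.elements, vol K * s K) ≤ ∫⁻ x in Ω, h x := by
  have hK : ∀ K ∈ T.elements, ENNReal.ofReal (vol K * s K) ≤
      ∫⁻ x in interior (simplex K), h x := by
    intro K hK
    have h1 : ∫⁻ _ in interior (simplex K), ENNReal.ofReal (s K) ≤
        ∫⁻ x in interior (simplex K), h x := by
      refine lintegral_mono_ae ?_
      exact (ae_restrict_iff' isOpen_interior.measurableSet).2 (hs K hK)
    refine le_trans (le_of_eq ?_) h1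
    rw [lintegral_const, Measure.restrict_apply_univ,
      measure_interior_of_null_frontier (volume_frontier_simplex K), vol, measureReal_def,
      ENNReal.ofReal_mul ENNReal.toReal_nonneg,
      ENNReal.ofReal_toReal (isCompact_simplex K).measure_lt_top.ne, mul_comm]
  rw [ENNReal.ofReal_sum_of_nonneg fun K hK => mul_nonneg (Mesh.vol_pos hK).le (hs0 K hK)]
  refine (Finset.sum_le_sum hK).trans ?_
  rw [← lintegral_biUnion_finset (fun K hK K' hK' hne => Mesh.interior_disjoint hK hK' hne)
    (fun K _ => isOpen_interior.measurableSet)]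
  exact lintegral_mono_set (Set.iUnion₂_subset fun K hK => Mesh.interior_subset hΩ hK)

/-! ### Comparison with the Hessian factor -/

theorem norm2_scaled {B : Mat d} (hB : B.PosDef) :
    norm2 (B.det ^ (1 / (d : ℝ)) • B) = B.det ^ (1 / (d : ℝ)) * norm2 B := by
  rw [norm2_smul, abs_of_nonneg (Real.rpow_nonneg hB.det_pos.le _)]

/-- Both det^{1/d} and the spectral norm are monotone and homogeneous of degree one on positive
definite matrices; their product therefore picks up c². -/
theorem scaled_le_scaled (hd : 1 ≤ d) {A B : Mat d} (hA : A.PosDef) {c : ℝ} (hc : 0 < c)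
    (h : (B - c • A).PosSemidef) :
    c ^ 2 * (A.det ^ (1 / (d : ℝ)) * norm2 A) ≤ B.det ^ (1 / (d : ℝ)) * norm2 B := by
  have hcA : (c • A).PosDef := hA.smul hc
  have h1 := det_le_det_of_posSemidef_sub hcA h
  have h2 := norm2_le_norm2 hcA.posSemidef h
  rw [norm2_smul, abs_of_pos hc] at h2
  have hd0 : (d : ℝ) ≠ 0 := by positivity
  have h3 : c * A.det ^ (1 / (d : ℝ)) ≤ B.det ^ (1 / (d : ℝ)) := by
    have := Real.rpow_le_rpow hcA.det_pos.le h1 (by positivity : 0 ≤ 1 / (d : ℝ))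
    rwa [Matrix.det_smul, Fintype.card_fin, Real.mul_rpow (by positivity) hA.det_pos.le,
      ← Real.rpow_natCast, ← Real.rpow_mul hc.le, mul_one_div_cancel hd0, Real.rpow_one] at this
  have := mul_le_mul h3 h2 (mul_nonneg hc.le (norm2_nonneg A))
    ((mul_nonneg hc.le (Real.rpow_nonneg hA.det_pos.le _)).trans h3)
  nlinarith

/-- On each element αI + |H| ≥ CRminus (αI + |R_K|), so up to a power of CRminus the sum is a lower
sum for the integral that defines the quasi-norm. -/
theorem rpow_sum_le_hessianFactor (hd : 1 ≤ d) {Ω : Set (Space d)} (hΩ : IsOpen Ω) (T : Mesh Ω)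
    {H : Space d → Mat d} {RK : Finset (Space d) → Mat d} {α : ℝ} (hα : 0 < α)
    {CRminusK CRplusK : Finset (Space d) → ℝ} {CRminus : ℝ} (hC : 0 < CRminus)
    (hminus : ∀ K ∈ T.elements, ∀ᵐ x ∂(volume.restrict (simplex K)),
        ScalarLE (CRminusK K) ((regAbs α (RK K))⁻¹ * regAbs α (H x)))
    (hplus : ∀ K ∈ T.elements, ∀ᵐ x ∂(volume.restrict (simplex K)),
        LEScalar ((regAbs α (RK K))⁻¹ * matAbs (H x)) (CRplusK K))
    (hle : ∀ K ∈ T.elements, CRminus ≤ CRminusK K) :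
    CRminus ^ 2 * (∑ K ∈ T.elements, vol K * (metric α (RK K)).det ^ (1 / 2 : ℝ)) ^
      (((d : ℝ) + 2) / (d : ℝ)) ≤ hessianFactor Ω α H := by
  have hd0 : (0 : ℝ) < d := by positivity
  set p : ℝ := (d : ℝ) / ((d : ℝ) + 2) with hp
  have hp0 : 0 < p := by positivity
  have hpinv : ((d : ℝ) + 2) / (d : ℝ) = 1 / p := by rw [hp, one_div_div]
  set φ : Space d → ℝ := fun x => norm2 ((regAbs α (H x)).det ^ (1 / (d : ℝ)) • regAbs α (H x))
    with hφ
  have hφe : ∀ x, φ x = (regAbs α (H x)).det ^ (1 / (d : ℝ)) * norm2 (regAbs α (H x)) := fun x =>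
    norm2_scaled (regAbs_posDef hα (H x))
  have hconv : ∀ {K : Finset (Space d)} {Q : Space d → Prop},
      (∀ᵐ x ∂(volume.restrict (simplex K)), Q x) →
      ∀ᵐ x ∂(volume : Measure (Space d)), x ∈ interior (simplex K) → Q x := by
    intro K Q h
    filter_upwards [(ae_restrict_iff' (isClosed_simplex K).measurableSet).1 h] with x hx hxK
    exact hx (interior_subset hxK)
  have hlow : ∀ K ∈ T.elements, ∀ᵐ x ∂(volume : Measure (Space d)), x ∈ interior (simplex K) →
      CRminus ^ 2 * ((regAbs α (RK K)).det ^ (1 / (d : ℝ)) * norm2 (regAbs α (RK K))) ≤ φ x := by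
    intro K hK
    filter_upwards [hconv (hminus K hK)] with x hx hxK
    have hA := regAbs_posDef hα (RK K)
    rw [hφe]
    refine scaled_le_scaled hd hA hC ?_
    have h1 := posSemidef_sub_smul_of_scalarLE hA (regAbs_posDef hα (H x)).isHermitian (hx hxK)
    have h2 := hA.posSemidef.smul (sub_nonneg.2 (hle K hK))
    have := h1.add h2
    convert this using 1
    rw [sub_smul]; abel
  set up : Finset (Space d) → ℝ := fun K => (1 + |CRplusK K|) ^ 2 *
    ((regAbs α (RK K)).det ^ (1 / (d : ℝ)) * norm2 (regAbs α (RK K))) with hup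
  have hup0 : ∀ K, 0 ≤ up K := fun K => by
    have := (regAbs_posDef hα (RK K)).det_pos
    have := norm2_nonneg (regAbs α (RK K))
    positivity
  -- The upper closeness condition gives αI + |H| ≤ (1 + |CRplusK K|)(αI + |R_K|). It is needed only
  -- for finiteness: an infinite quasi-norm would be sent to 0 by `toReal` and the lower bound would
  -- be lost.
  have hupp : ∀ K ∈ T.elements, ∀ᵐ x ∂(volume : Measure (Space d)), x ∈ interior (simplex K) →
      φ x ≤ up K := by
    intro K hK
    filter_upwards [hconv (hplus K hK)] with x hx hxK
    have hA := regAbs_posDef hα (RK K)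
    have hB := regAbs_posDef hα (H x)
    set c := 1 + |CRplusK K| with hc
    have hc0 : 0 < c := by positivity
    have h1 := posSemidef_smul_sub_of_leScalar hA (matAbs_posSemidef (H x)).isHermitian (hx hxK)
    have h2 := hA.posSemidef.smul (sub_nonneg.2 (le_abs_self (CRplusK K)))
    have h3 := (h1.add h2).add (matAbs_posSemidef (RK K))
    have h4 : (regAbs α (RK K) - c⁻¹ • regAbs α (H x)).PosSemidef := by
      have h5 := h3.smul (inv_nonneg.2 hc0.le)
      convert h5 using 1
      have e : CRplusK K • regAbs α (RK K) - matAbs (H x) +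
          (|CRplusK K| - CRplusK K) • regAbs α (RK K) + matAbs (RK K) =
          c • regAbs α (RK K) - regAbs α (H x) := by
        rw [hc, add_smul, one_smul, sub_smul]
        have e1 : matAbs (RK K) = regAbs α (RK K) - α • (1 : Mat d) := by rw [regAbs]; abel
        have e2 : matAbs (H x) = regAbs α (H x) - α • (1 : Mat d) := by rw [regAbs]; abel
        rw [e1, e2]
        abel
      rw [e, smul_sub, inv_smul_smul₀ hc0.ne']
    have h5 := scaled_le_scaled hd hB (inv_pos.2 hc0) h4
    rw [hφe, hup]
    rw [inv_pow, inv_mul_le_iff₀ (by positivity)] at h5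
    exact h5
  have hfin : eLpNorm φ (ENNReal.ofReal p) (volume.restrict Ω) ≠ ⊤ := by
    have hb : ∀ᵐ x ∂(volume.restrict Ω), ‖φ x‖ ≤ ∑ K ∈ T.elements, up K := by
      filter_upwards [T.ae_mem_interior hΩ,
        ae_restrict_of_ae ((Finset.eventually_all T.elements).2 hupp)] with x ⟨K, hK, hx⟩ hall
      rw [Real.norm_of_nonneg (norm2_nonneg _)]
      exact (hall K hK hx).trans (Finset.single_le_sum (fun K _ => hup0 K) hK)
    refine ((eLpNorm_le_of_ae_bound hb).trans_lt ?_).ne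
    refine ENNReal.mul_lt_top (ENNReal.rpow_lt_top_of_nonneg (by positivity) ?_)
      ENNReal.ofReal_lt_top
    rw [Measure.restrict_apply_univ]
    exact T.volume_lt_top.ne
  have hmain : ENNReal.ofReal (∑ K ∈ T.elements, vol K *
      (CRminus ^ 2 * ((regAbs α (RK K)).det ^ (1 / (d : ℝ)) * norm2 (regAbs α (RK K)))) ^ p) ≤
      ∫⁻ x in Ω, ‖φ x‖ₑ ^ p := by
    refine T.ofReal_sum_le_lintegral hΩ (fun K _ => ?_) fun K hK => ?_
    · have := (regAbs_posDef hα (RK K)).det_pos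
      have := norm2_nonneg (regAbs α (RK K))
      positivity
    · filter_upwards [hlow K hK] with x hx hxK
      have := (regAbs_posDef hα (RK K)).det_pos
      have h2 := norm2_nonneg (regAbs α (RK K))
      rw [Real.enorm_of_nonneg (norm2_nonneg _), ENNReal.ofReal_rpow_of_nonneg (norm2_nonneg _) hp0.le]
      exact ENNReal.ofReal_le_ofReal (Real.rpow_le_rpow (by positivity) (hx hxK) hp0.le)
  have hsum : ∑ K ∈ T.elements, vol K *
      (CRminus ^ 2 * ((regAbs α (RK K)).det ^ (1 / (d : ℝ)) * norm2 (regAbs α (RK K)))) ^ p =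
      (CRminus ^ 2) ^ p * ∑ K ∈ T.elements, vol K * (metric α (RK K)).det ^ (1 / 2 : ℝ) := by
    rw [Finset.mul_sum]
    refine Finset.sum_congr rfl fun K _ => ?_
    have := (regAbs_posDef hα (RK K)).det_pos
    have h2 := norm2_nonneg (regAbs α (RK K))
    rw [sqrt_det_metric hd hα, Real.mul_rpow (by positivity) (by positivity)]
    ring
  set σ := ∑ K ∈ T.elements, vol K * (metric α (RK K)).det ^ (1 / 2 : ℝ) with hσ
  have hσ0 : 0 ≤ σ := Finset.sum_nonneg fun K hK => by
    have := (regAbs_posDef hα (RK K)).det_pos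
    have h2 := norm2_nonneg (regAbs α (RK K))
    have h3 := Mesh.vol_pos hK
    rw [sqrt_det_metric hd hα]
    positivity
  rw [hsum] at hmain
  have hpt : (ENNReal.ofReal p).toReal = p := ENNReal.toReal_ofReal hp0.le
  have heq : eLpNorm φ (ENNReal.ofReal p) (volume.restrict Ω) =
      (∫⁻ x in Ω, ‖φ x‖ₑ ^ p) ^ (1 / p) := by
    rw [eLpNorm_eq_lintegral_rpow_enorm_toReal (by simpa using hp0) ENNReal.ofReal_ne_top, hpt]
  have hle2 : ENNReal.ofReal (CRminus ^ 2 * σ ^ (1 / p)) ≤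
      eLpNorm φ (ENNReal.ofReal p) (volume.restrict Ω) := by
    rw [heq]
    refine le_trans (le_of_eq ?_) (ENNReal.rpow_le_rpow hmain (by positivity : 0 ≤ 1 / p))
    rw [ENNReal.ofReal_rpow_of_nonneg (by positivity) (by positivity),
      Real.mul_rpow (by positivity) hσ0, ← Real.rpow_mul (by positivity), mul_one_div_cancel hp0.ne',
      Real.rpow_one]
  rw [hpinv]
  have := ENNReal.toReal_mono hfin hle2
  rw [ENNReal.toReal_ofReal (by positivity)] at this
  exact this

end ErrorBound

end

end AnisoFEM

/-! ### Assembly of the error estimate -/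

theorem theorem3p1 {d : ℕ} (hd : 1 ≤ d)
    -- polyhedral domain, elliptic operator, reference element
    (Ω : Set (Space d)) (hΩ : IsPolyhedralDomain Ω)
    (L : Coeffs d) (hL : L.IsElliptic Ω)
    (Khat : Finset (Space d)) (hKhat : IsReferenceElement Khat) :
    -- `C` depends on these only
    ∃ C : ℝ, 0 < C ∧
      ∀ (f g : Space d → ℝ), MemLp f 2 (volume.restrict Ω) →
      -- the solution of the boundary value problem is in `H²(Ω)`, with Hessian `H`
      ∀ (u : Space d → ℝ) (Du : Space d → Space d) (H : Space d → Mat d),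
      IsSolution L Ω f g u Du → IsH2 Ω u Du H →
      -- mesh, affine maps from the reference element, finite element solution
      ∀ (T : Mesh Ω) (F : Finset (Space d) → Space d →ᵃ[ℝ] Space d),
      (∀ K ∈ T.elements, F K '' simplex Khat = simplex K) →
      ∀ uh : Space d → ℝ, IsFESolution L T f g uh →
      -- recovered Hessian and its averages over the elements
      ∀ (R : Space d → Mat d) (RK : Finset (Space d) → Mat d),
      (∀ x ∈ closure Ω, (R x).IsSymm) →
      (∀ K ∈ T.elements, IsAverageOver (simplex K) R (RK K)) →
      ∀ α : ℝ, 0 < α →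
      -- closeness conditions
      ∀ (CRminusK CRplusK : Finset (Space d) → ℝ) (CRminus CRplus : ℝ),
      0 < CRminus → 0 < CRplus →
      (∀ K ∈ T.elements, ∀ᵐ x ∂(volume.restrict (simplex K)),
        ScalarLE (CRminusK K) ((regAbs α (RK K))⁻¹ * regAbs α (H x))) →
      (∀ K ∈ T.elements, ∀ᵐ x ∂(volume.restrict (simplex K)),
        LEScalar ((regAbs α (RK K))⁻¹ * matAbs (H x)) (CRplusK K)) →
      (∀ K ∈ T.elements, CRminus ≤ CRminusK K) →
      Real.sqrt ((1 / (T.N : ℝ)) * ∑ K ∈ T.elements, CRplusK K ^ 2) ≤ CRplus →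
      -- quasi-`M`-uniformity
      ∀ Ceq Cali : ℝ, 1 ≤ Ceq → 1 ≤ Cali →
      IsQuasiMUniform T F (fun K => metric α (RK K)) Ceq Cali →
      gradSeminorm Ω (fun x => Du x - gradient uh x) ≤
        C * (Cali ^ (((d : ℝ) + 1) / 2) * Ceq ^ (((d : ℝ) + 2) / (2 * (d : ℝ)))) *
          (CRplus / CRminus) * (T.N : ℝ) ^ (-(1 / (d : ℝ))) *
          hessianFactor Ω α H ^ (1 / 2 : ℝ) := by
  obtain ⟨Ccea, hCcea, hcea⟩ := exists_cea_constant hd hΩ hL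
  obtain ⟨c₀, r, D, hr, hD, hball, hdiam⟩ := exists_reference_constants hKhat
  obtain ⟨T₀⟩ := hΩ.nonempty_mesh
  obtain ⟨δ, hδ⟩ := Metric.isBounded_iff.1 T₀.isCompact_closure.isBounded
  have hδ' : ∀ p ∈ closure Ω, ∀ q ∈ closure Ω, ‖p - q‖ ≤ δ := fun p hp q hq => by
    rw [← dist_eq_norm]
    exact hδ hp hq
  have hd0 : (0 : ℝ) < d := by positivity
  have hI : 0 < interpConst d D r δ := by
    unfold interpConst
    positivity
  -- The estimates below are for squares. The factor 2 arises because the squared gradient error and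
  -- the squared value error of the interpolant are bounded by the same sum.
  refine ⟨Real.sqrt (2 * Ccea * interpConst d D r δ), Real.sqrt_pos.2 (by positivity), ?_⟩
  intro f g hf u Du H hsol hu T F hF uh huh R RK _ _ α hα CRminusK CRplusK CRminus CRplus hCm hCp
    hminus hplus hle hsqrt Ceq Cali hCeq hCali hM
  obtain ⟨v, hv, hvu⟩ := T.exists_interpolant u
  have hN : 0 < (T.N : ℝ) := by exact_mod_cast T.N_pos hΩ.isConnected.nonempty
  have hA := fun K => regAbs_posDef hα (RK K)
  set I := interpConst d D r δ with hIdef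
  set q : ℝ := ((d : ℝ) + 2) / (d : ℝ) with hq
  set σ := ∑ K ∈ T.elements, vol K * (metric α (RK K)).det ^ (1 / 2 : ℝ) with hσ
  have hmeas0 : ∀ K ∈ T.elements, 0 ≤ vol K * (metric α (RK K)).det ^ (1 / 2 : ℝ) := fun K hK => by
    have h1 := (hA K).det_pos
    have h2 := norm2_nonneg (regAbs α (RK K))
    have h3 := Mesh.vol_pos hK
    rw [sqrt_det_metric hd hα]
    positivity
  have hσ0 : 0 ≤ σ := Finset.sum_nonneg hmeas0
  set m : Finset (Space d) → ℝ := fun K => I * CRplusK K ^ 2 * Cali ^ (d + 1) *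
    (norm2 (regAbs α (RK K)) * (vol K ^ (2 / (d : ℝ)) * (regAbs α (RK K)).det ^ (1 / (d : ℝ))))
    with hm
  have hm0 : ∀ K ∈ T.elements, 0 ≤ m K := fun K hK => by
    have h1 := (hA K).det_pos
    have h2 := norm2_nonneg (regAbs α (RK K))
    have h3 := Mesh.vol_pos hK
    positivity
  have herr : ∀ K ∈ T.elements, ∀ᵐ x ∂(volume : Measure (Space d)), x ∈ interior (simplex K) →
      (u x - v x) ^ 2 ≤ m K ∧ ‖Du x - gradient v x‖ ^ 2 ≤ m K := fun K hK =>
    ae_interpolation_error_le hd hΩ.isOpen hu hsol.continuousOn hv hvu hKhat.2.2 hK (hF K hK) hr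
      hball hdiam hδ' (hA K) (by linarith) (trace_le_of_alignment hd hα (hM.alignment K hK))
      (hplus K hK)
  have he2 := hu.isL2Pair.sub (hv.isL2Pair hΩ.isOpen)
  have hE : ∫ x in Ω, ‖Du x - gradient v x‖ ^ 2 ≤ ∑ K ∈ T.elements, vol K * m K :=
    T.setIntegral_le_sum hΩ.isOpen he2.intD hm0 fun K hK =>
      (herr K hK).mono fun x hx hxK => (hx hxK).2
  have he : ∫ x in Ω, (u x - v x) ^ 2 ≤ ∑ K ∈ T.elements, vol K * m K :=
    T.setIntegral_le_sum hΩ.isOpen he2.int hm0 fun K hK =>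
      (herr K hK).mono fun x hx hxK => (hx hxK).1
  have hcea' := hcea f g u Du H hf hsol hu T uh v huh hv hvu
  have hq0 : 0 ≤ q := by positivity
  have hsum : ∑ K ∈ T.elements, vol K * m K ≤
      I * Cali ^ (d + 1) * (Ceq * (1 / (T.N : ℝ) * σ)) ^ q * ∑ K ∈ T.elements, CRplusK K ^ 2 := by
    rw [Finset.mul_sum]
    refine Finset.sum_le_sum fun K hK => ?_
    have h1 : vol K * m K = I * Cali ^ (d + 1) *
        (vol K * (metric α (RK K)).det ^ (1 / 2 : ℝ)) ^ q * CRplusK K ^ 2 := by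
      rw [sqrt_det_metric hd hα, hq, ← elementScale_mul_eq hd (hA K).det_pos (norm2_pos hd (hA K))
        (Mesh.vol_pos hK), hm]
      ring
    rw [h1]
    have h2 := Real.rpow_le_rpow (hmeas0 K hK) (hM.equidistribution K hK) hq0
    gcongr
  have hCsum : ∑ K ∈ T.elements, CRplusK K ^ 2 ≤ T.N * CRplus ^ 2 := by
    have h1 := (Real.sqrt_le_iff.1 hsqrt).2
    rw [one_div, inv_mul_le_iff₀ hN] at h1
    exact h1
  have hhess := rpow_sum_le_hessianFactor hd hΩ.isOpen T hα hCm hminus hplus hle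
  rw [← hσ, ← hq] at hhess
  have hh0 : 0 ≤ hessianFactor Ω α H := ENNReal.toReal_nonneg
  -- Equidistribution contributes N^{-q} and the sum of the squared closeness constants contributes
  -- N; since 1 - q = -2/d, the squared error decays like N^{-2/d}.
  have hscale : (Ceq * (1 / (T.N : ℝ) * σ)) ^ q * (T.N * CRplus ^ 2) =
      Ceq ^ q * (T.N : ℝ) ^ (-(2 / (d : ℝ))) * CRplus ^ 2 * σ ^ q := by
    rw [Real.mul_rpow (by positivity) (by positivity), Real.mul_rpow (by positivity) hσ0, one_div,
      Real.inv_rpow hN.le, ← Real.rpow_neg hN.le]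
    have h1 : (T.N : ℝ) ^ (-q) * T.N = (T.N : ℝ) ^ (-(2 / (d : ℝ))) := by
      conv_lhs => rw [← Real.rpow_one (T.N : ℝ), ← Real.rpow_mul hN.le, one_mul,
        ← Real.rpow_add hN]
      congr 1
      rw [hq]
      field_simp
      ring
    rw [← h1]
    ring
  have hfinal : ∫ x in Ω, ‖Du x - gradient uh x‖ ^ 2 ≤ 2 * Ccea * I * Cali ^ (d + 1) *
      (Ceq ^ q * (T.N : ℝ) ^ (-(2 / (d : ℝ))) * CRplus ^ 2 *
        (hessianFactor Ω α H / CRminus ^ 2)) := by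
    have h1 : σ ^ q ≤ hessianFactor Ω α H / CRminus ^ 2 := by
      rw [le_div_iff₀ (by positivity)]
      linarith
    have h2 : ∑ K ∈ T.elements, vol K * m K ≤ I * Cali ^ (d + 1) *
        (Ceq ^ q * (T.N : ℝ) ^ (-(2 / (d : ℝ))) * CRplus ^ 2 *
          (hessianFactor Ω α H / CRminus ^ 2)) := by
      calc ∑ K ∈ T.elements, vol K * m K
          ≤ I * Cali ^ (d + 1) * (Ceq * (1 / (T.N : ℝ) * σ)) ^ q *
            ∑ K ∈ T.elements, CRplusK K ^ 2 := hsum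
        _ ≤ I * Cali ^ (d + 1) * (Ceq * (1 / (T.N : ℝ) * σ)) ^ q * (T.N * CRplus ^ 2) := by
            gcongr
        _ = I * Cali ^ (d + 1) * (Ceq ^ q * (T.N : ℝ) ^ (-(2 / (d : ℝ))) * CRplus ^ 2 * σ ^ q) := by
            rw [mul_assoc (I * Cali ^ (d + 1)), hscale]
        _ ≤ _ := by gcongr
    have h3 := mul_le_mul_of_nonneg_left (add_le_add hE he) hCcea.le
    have h4 := mul_le_mul_of_nonneg_left h2 (by positivity : 0 ≤ 2 * Ccea)
    linarith
  have hsq : ∀ {x : ℝ}, 0 ≤ x → ∀ a : ℝ, (x ^ a) ^ 2 = x ^ (a * 2) := by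
    intro x hx a
    rw [← Real.rpow_natCast, ← Real.rpow_mul hx]
    norm_num
  rw [gradSeminorm]
  refine Real.sqrt_le_iff.2 ⟨by positivity, hfinal.trans (le_of_eq ?_)⟩
  rw [mul_pow, mul_pow, mul_pow, mul_pow, mul_pow, Real.sq_sqrt (by positivity), div_pow,
    hsq (by positivity), hsq (by positivity), hsq hN.le, hsq hh0]
  have e1 : ((d : ℝ) + 1) / 2 * 2 = ((d + 1 : ℕ) : ℝ) := by push_cast; ring
  have e2 : ((d : ℝ) + 2) / (2 * (d : ℝ)) * 2 = q := by rw [hq]; field_simp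
  have e3 : -(1 / (d : ℝ)) * 2 = -(2 / (d : ℝ)) := by ring
  have e4 : (1 / 2 : ℝ) * 2 = 1 := by norm_num
  rw [e1, e2, e3, e4, Real.rpow_natCast, Real.rpow_one]
  ring
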